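/- Let $a_1,a_2,a_3>0$, let $\mathbb{T}^3=\prod_{i=1}^3 \mathbb{R}/2\pi a_i\mathbb{Z}$, and let $\nu_h,\nu_h'>0$, $F>0$, $F\neq 1$. For $n\in\mathbb{Z}^3$ put $\check n_j=n_j/a_j$, $\check n_h=(\check n_1,\check n_2)$, and write $f=\sum_n \hat f(n)e^{i\check n\cdot x}$. Let $\mathbb{P}_n$ be the $4\times4$ symbol of the Leray projector on the first three components (identity on the fourth), and $$\mathcal{A}=\begin{pmatrix}0&-1&0&0\\1&0&0&0\\0&0&0&F^{-1}\\0&0&-F^{-1}&0\end{pmatrix}.$$ For $n\ne0$ the matrix $\mathbb{P}_n\mathcal{A}$ has on the three-dimensional space $\{z\in\mathbb{C}^4:\check n_1z_1+\check n_2z_2+\check n_3z_3=0\}$ the simple eigenvalues $i\omega^{\sigma}(n)$, $\sigma\in\{-,0,+\}$, where $\omega^0(n)=0$ and $\omega^\pm(n)=\pm\frac{\sqrt{|\check n_h|^2+F^2\check n_3^2}}{F|\check n|}$, with orthonormal eigenvectors $e^\sigma(n)$. For a field $U:\mathbb{T}^3\to\mathbb{R}^4$ with zero average put $U^\sigma(n)=(\hat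 U(n)\,|\,e^\sigma(n))_{\mathbb{C}^4}\,e^\sigma(n)$. The limit bilinear form $\mathcal{Q}$ and the limit diffusion $\mathbb{D}$ are given by $$\widehat{\mathcal{Q}(U,V)}(n)=\sum_{\substack{k\in\mathbb{Z}^3,\ \sigma,\tau,\rho\in\{-,0,+\}\\ \omega^\sigma(k)+\omega^\tau(n-k)=\omega^\rho(n)}}\Big(\sum_{j=1}^3 i(\check n_j-\check k_j)\,U^{\sigma,j}(k)\,V^{\tau}(n-k)\,\Big|\,e^\rho(n)\Big)_{\mathbb{C}^4}e^\rho(n),$$ $$\widehat{\mathbb{D}U}(n)=\sum_{\sigma,\tau:\ \omega^\sigma(n)=\omega^\tau(n)}\big(\mathbf{D}(n)U^\tau(n)\,\big|\,e^\sigma(n)\big)_{\mathbb{C}^4}e^\sigma(n),\qquad \mathbf{D}(n)=-|\check n_h|^2\,\mathrm{diag}(\nu_h,\nu_h,\nu_h,\nu_h')$$ for $n\neq 0$, and both vanish at $n=0$. There is a constant $C>0$, independent of the data and of all the parameters, such that the following holds. Let $V_0=(v_0,T_0)\in L^2(\mathbb{T}^3;\mathbb{R}^4)$ have zero average, with $\operatorname{div}v_0=0$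 and $\Omega_0=-\partial_2v_0^1+\partial_1v_0^2-F\partial_3T_0\in L^2(\mathbb{T}^3)$. Then there is a solution $U=(u,U^4)$, with zero average, of the limit system $$\partial_tU+\mathcal{Q}(U,U)-\mathbb{D}U=0,\qquad \operatorname{div}u=0,\qquad U|_{t=0}=V_0$$ in the sense of distributions on $\mathbb{R}_+\times\mathbb{T}^3$ (tested against smooth fields with compact support in $[0,\infty)\times\mathbb{T}^3$, the initial datum being included in the weak formulation), such that $U\in L^\infty(\mathbb{R}_+;L^2(\mathbb{T}^3))$, $\nabla_hU=(\partial_1U,\partial_2U)\in L^2(\mathbb{R}_+;L^2(\mathbb{T}^3))$, and, for all $t\ge0$, $$\|U(t)\|_{L^2(\mathbb{T}^3)}^2+c\int_0^t\|\nabla_hU(s)\|_{L^2(\mathbb{T}^3)}^2\,ds\le C\,\|V_0\|_{L^2(\mathbb{T}^3)}^2,\qquad c=\min\{\nu_h,\nu_h'\}.$$ -/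

import Mathlib

open MeasureTheory Set
open scoped ContDiff Real

namespace LimitPE

/-- Four-component real vectors `V = (v, T)`: velocity `v ∈ ℝ³` and density fluctuation `T`. -/
abbrev E4 : Type := EuclideanSpace ℝ (Fin 4)

/-- Complex amplitudes, with the Hermitian inner product of `ℂ⁴`. -/
abbrev C4 : Type := EuclideanSpace ℂ (Fin 4)

/-- The torus `∏ᵢ ℝ / (2π aᵢ ℤ)`. -/
abbrev Torus (a : Fin 3 → ℝ) : Type := (i : Fin 3) → AddCircle (2 * π * a i)

instance factPeriod (r : ℝ) [h : Fact (0 < r)] : Fact (0 < 2 * π * r) :=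
  ⟨mul_pos Real.two_pi_pos h.out⟩

section Torus

variable (a : Fin 3 → ℝ)

/-- The quotient map `ℝ³ → 𝕋³`. -/
noncomputable def proj (y : Fin 3 → ℝ) : Torus a := fun i => (y i : AddCircle (2 * π * a i))

/-- The partial derivative `∂ⱼ φ` of a function on the torus. -/
noncomputable def pderiv (j : Fin 3) (φ : Torus a → ℝ) (x : Torus a) : ℝ :=
  deriv (fun s : ℝ => φ (x + Pi.single j (s : AddCircle (2 * π * a j)))) 0

/-- Smooth real functions on the torus (the lift to `ℝ³` is `C^∞`). -/
def IsSmooth (φ : Torus a → ℝ) : Prop :=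
  ContDiff ℝ ∞ (fun y : Fin 3 → ℝ => φ (proj a y))

/-- Test vector fields: smooth on `ℝ × 𝕋³`, with support bounded in time (they need not vanish
at `t = 0`). -/
def IsTest (φ : ℝ → Torus a → E4) : Prop :=
  ContDiff ℝ ∞ (fun p : ℝ × (Fin 3 → ℝ) => φ p.1 (proj a p.2)) ∧
    ∃ R : ℝ, ∀ t : ℝ, R ≤ |t| → ∀ x, φ t x = 0

/-- `e^{i ň·x}` with `ňⱼ = nⱼ / aⱼ`. -/
noncomputable def monomial (n : Fin 3 → ℤ) (x : Torus a) : ℂ := ∏ i, fourier (n i) (x i)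

/-- The rescaled frequency `ňⱼ = nⱼ / aⱼ`; the symbol of `∂ⱼ` is `i ňⱼ`. -/
noncomputable def freq (n : Fin 3 → ℤ) (j : Fin 3) : ℝ := (n j : ℝ) / a j

variable [∀ i, Fact (0 < a i)]

/-- The space `L²(𝕋³; ℝ⁴)`. -/
abbrev L2Field : Type := Lp E4 2 (volume : Measure (Torus a))

/-- The Fourier coefficient `f̂(n)`, so that `f = ∑ₙ f̂(n) e^{i ň·x}`. -/
noncomputable def coeff (f : Torus a → E4) (n : Fin 3 → ℤ) : C4 :=
  WithLp.toLp 2 fun l => ⨍ x, monomial a (-n) x * (f x l : ℂ)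

/-- Zero global average, of all four components. -/
def MeanZero (V : L2Field a) : Prop := ∀ l : Fin 4, ∫ x, V x l = 0

/-- `div v = 0` in the sense of distributions, `v` being the first three components of `V`. -/
def DivFree (V : L2Field a) : Prop :=
  ∀ φ : Torus a → ℝ, IsSmooth a φ →
    ∫ x, (V x 0 * pderiv a 0 φ x + V x 1 * pderiv a 1 φ x + V x 2 * pderiv a 2 φ x) = 0

/-- `G = ∂ⱼ V` in the sense of distributions. -/
def IsWeakPartial (j : Fin 3) (V G : L2Field a) : Prop :=
  ∀ l : Fin 4, ∀ φ : Torus a → ℝ, IsSmooth a φ →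
    ∫ x, V x l * pderiv a j φ x = - ∫ x, G x l * φ x

/-- `Ω = -∂₂ V¹ + ∂₁ V² - F ∂₃ V⁴` in the sense of distributions. -/
def IsPotentialVorticity (F : ℝ) (V : L2Field a) (Ω : Lp ℝ 2 (volume : Measure (Torus a))) :
    Prop :=
  ∀ φ : Torus a → ℝ, IsSmooth a φ →
    ∫ x, Ω x * φ x =
      ∫ x, (V x 0 * pderiv a 1 φ x - V x 1 * pderiv a 0 φ x + F * (V x 3 * pderiv a 2 φ x))

end Torus

section Spectral

variable (a : Fin 3 → ℝ) (F : ℝ)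

/-- `|ňₕ|²`. -/
noncomputable def normHsq (n : Fin 3 → ℤ) : ℝ := freq a n 0 ^ 2 + freq a n 1 ^ 2

/-- `|ň|²`. -/
noncomputable def normSq (n : Fin 3 → ℤ) : ℝ := normHsq a n + freq a n 2 ^ 2

/-- `|ň|_F² = |ňₕ|² + F² ň₃²`. -/
noncomputable def normFsq (n : Fin 3 → ℤ) : ℝ := normHsq a n + F ^ 2 * freq a n 2 ^ 2

/-- The symbol `ℙₙ` of the Leray projector on the first three components, the identity on the
fourth one. -/
noncomputable def leray (n : Fin 3 → ℤ) : Matrix (Fin 4) (Fin 4) ℂ :=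
  let w : Fin 4 → ℂ := ![(freq a n 0 : ℂ), (freq a n 1 : ℂ), (freq a n 2 : ℂ), 0]
  1 - ((normSq a n : ℂ))⁻¹ • Matrix.vecMulVec w w

/-- The matrix `𝒜` of the Coriolis and stratification forces. -/
noncomputable def penal : Matrix (Fin 4) (Fin 4) ℂ :=
  !![0, -1, 0, 0; 1, 0, 0, 0; 0, 0, 0, (F : ℂ)⁻¹; 0, 0, -(F : ℂ)⁻¹, 0]

/-- `ω(n) = |ň|_F / (F |ň|)`. -/
noncomputable def omega (n : Fin 3 → ℤ) : ℝ := √(normFsq a F n) / (F * √(normSq a n))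

/-- `ω^σ(n)` for `σ ∈ {-, 0, +}`: on divergence-free amplitudes the eigenvalues of `ℙₙ𝒜` are
`i ω^σ(n)`. -/
noncomputable def omegaS (σ : SignType) (n : Fin 3 → ℤ) : ℝ := (σ : ℝ) * omega a F n

/-- Eigenvectors of `ℙₙ𝒜` before normalization. -/
noncomputable def rawVec (σ : SignType) (n : Fin 3 → ℤ) : C4 :=
  let n₁ : ℂ := (freq a n 0 : ℂ)
  let n₂ : ℂ := (freq a n 1 : ℂ)
  let n₃ : ℂ := (freq a n 2 : ℂ)
  let h : ℂ := (normHsq a n : ℂ)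
  let iw : ℂ := Complex.I * (omegaS a F σ n : ℂ)
  if σ = 0 then !₂[-n₂, n₁, 0, -(F : ℂ) * n₃]
  else if n 0 = 0 ∧ n 1 = 0 then !₂[Complex.I * ((σ : ℝ) : ℂ), 1, 0, 0]
  else !₂[-(F : ℂ) * n₃ * (n₂ - iw * n₁), (F : ℂ) * n₃ * (n₁ + iw * n₂), -(F : ℂ) * iw * h, h]

/-- The normalized divergence-free eigenvectors `e^σ(n)`, `n ≠ 0`, with
`ℙₙ 𝒜 e^σ(n) = i ω^σ(n) e^σ(n)`. All fields have zero average, so the frequency `0` plays no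
role, and the value there is set to `0`. -/
noncomputable def eigvec (σ : SignType) (n : Fin 3 → ℤ) : C4 :=
  if n = 0 then 0 else ((‖rawVec a F σ n‖⁻¹ : ℝ) : ℂ) • rawVec a F σ n

/-- The component `(z | e^σ(n)) e^σ(n)` of `z ∈ ℂ⁴`. -/
noncomputable def modePart (σ : SignType) (n : Fin 3 → ℤ) (z : C4) : C4 :=
  inner ℂ (eigvec a F σ n) z • eigvec a F σ n

/-- The contribution of the pair of frequencies `(k, n - k)` to the `n`-th Fourier coefficient of
`𝒬(U, V)`, given the Fourier coefficients `u`, `v` of `U`, `V`: the sum over the resonances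
`ω^σ(k) + ω^τ(n-k) = ω^ρ(n)` of
`( ∑ⱼ i (ň-ǩ)ⱼ U^{σ,j}(k) V^τ(n-k) | e^ρ(n) ) e^ρ(n)`. -/
noncomputable def bilinTerm (u v : (Fin 3 → ℤ) → C4) (n k : Fin 3 → ℤ) : C4 :=
  open Classical in
  ∑ σ : SignType, ∑ τ : SignType, ∑ ρ : SignType,
    if omegaS a F σ k + omegaS a F τ (n - k) = omegaS a F ρ n then
      modePart a F ρ n
        ((∑ j : Fin 3, Complex.I * (freq a (n - k) j : ℂ) * modePart a F σ k (u k) j.castSucc) •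
          modePart a F τ (n - k) (v (n - k)))
    else 0

/-- The `n`-th Fourier coefficient of the limit bilinear form `𝒬(U, V)`. -/
noncomputable def bilin (u v : (Fin 3 → ℤ) → C4) (n : Fin 3 → ℤ) : C4 :=
  ∑' k : Fin 3 → ℤ, bilinTerm a F u v n k

/-- The symbol `𝐃(n)` of `𝐃 = diag(νₕ Δₕ, νₕ Δₕ, νₕ Δₕ, νₕ' Δₕ)`, applied to `z`. -/
noncomputable def diffusion (ν ν' : ℝ) (n : Fin 3 → ℤ) (z : C4) : C4 :=
  let d : ℂ := -(normHsq a n : ℂ)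
  !₂[(ν : ℂ) * d * z 0, (ν : ℂ) * d * z 1, (ν : ℂ) * d * z 2, (ν' : ℂ) * d * z 3]

/-- The `n`-th Fourier coefficient of the limit linear operator `𝔻 U`: the non-oscillating part of
`e^{τ ℙ𝒜} 𝐃 e^{-τ ℙ𝒜} U`. -/
noncomputable def limitDiffusion (ν ν' : ℝ) (u : (Fin 3 → ℤ) → C4) (n : Fin 3 → ℤ) : C4 :=
  open Classical in
  ∑ σ : SignType, ∑ τ : SignType,
    if omegaS a F σ n = omegaS a F τ n then
      modePart a F σ n (diffusion a ν ν' n (modePart a F τ n (u n)))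
    else 0

end Spectral

section Solution

variable (a : Fin 3 → ℝ) [∀ i, Fact (0 < a i)] (F ν ν' : ℝ)

/-- The `n`-th Fourier coefficient of `𝒬(W, W) - 𝔻 W`. -/
noncomputable def limitOp (W : L2Field a) (n : Fin 3 → ℤ) : C4 :=
  bilin a F (coeff a W) (coeff a W) n - limitDiffusion a F ν ν' (coeff a W) n

/-- The pairing of the distribution with Fourier coefficients `q` and a smooth real field `ψ`:
`|𝕋³| ∑ₙ q(n) · conj ψ̂(n)`. -/
noncomputable def pairing (q : (Fin 3 → ℤ) → C4) (ψ : Torus a → E4) : ℂ :=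
  ((volume : Measure (Torus a)).real univ : ℂ) * ∑' n : Fin 3 → ℤ, inner ℂ (coeff a ψ n) (q n)

/-- `U` solves `∂ₜU + 𝒬(U,U) - 𝔻U = 0`, `div u = 0`, `U(0) = V₀` in the sense of distributions on
`[0,∞) × 𝕋³`, all the series and integrals involved being convergent. -/
structure IsDistribSolution (V₀ : L2Field a) (U : ℝ → L2Field a) : Prop where
  meanZero : ∀ᵐ t ∂(volume.restrict (Ioi (0 : ℝ))), MeanZero a (U t)
  divFree : ∀ᵐ t ∂(volume.restrict (Ioi (0 : ℝ))), DivFree a (U t)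
  summable_bilin : ∀ᵐ t ∂(volume.restrict (Ioi (0 : ℝ))), ∀ n : Fin 3 → ℤ,
    Summable (bilinTerm a F (coeff a (U t)) (coeff a (U t)) n)
  summable_pairing : ∀ φ : ℝ → Torus a → E4, IsTest a φ →
    ∀ᵐ t ∂(volume.restrict (Ioi (0 : ℝ))),
      Summable fun n => inner ℂ (coeff a (φ t) n) (limitOp a F ν ν' (U t) n)
  integrable_pairing : ∀ φ : ℝ → Torus a → E4, IsTest a φ →
    IntegrableOn (fun t => pairing a (limitOp a F ν ν' (U t)) (φ t)) (Ioi 0)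
  equation : ∀ φ : ℝ → Torus a → E4, IsTest a φ →
    -(((∫ t in Ioi (0 : ℝ), ∫ x, inner ℝ (U t x) (deriv (fun s => φ s x) t)) : ℝ) : ℂ)
      - ((∫ x, inner ℝ (V₀ x) (φ 0 x) : ℝ) : ℂ)
      + ∫ t in Ioi (0 : ℝ), pairing a (limitOp a F ν ν' (U t)) (φ t) = 0

end Solution

end LimitPE

open LimitPE

/-!
The solution is a limit of Galerkin approximations on the Fourier side, and its energy inequality
holds with `C = 1`. What has to be explained is why energy and potential vorticity are controlled,
and why the two bounds are enough to pass to the limit: the diffusion acts only in the horizontal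
directions, so that there is no compactness in `x₃` from the energy alone.

*Conservation laws.* A resonant triad `(k, σ), (n - k, τ), (n, ρ)` stays resonant when
`(n - k, τ)` and `(-n, -ρ)` are exchanged, and for a real divergence-free field its energy transfer
changes sign; hence `𝒬` conserves the energy (`tsum_inner_bilin`). The slow mode `σ = 0` carries the
potential vorticity `-∂₂u¹ + ∂₁u² - F∂₃u⁴`, and `𝒬` conserves its `L²` norm as well
(`tsum_pv_bilin`). Interactions of a slow and an oscillating mode do not reach the slow mode, being
nonresonant; two oscillating modes resonate with it only if `ω(k) = ω(n - k)`, which for `F ≠ 1`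
means that `k` and `n - k` have the same slope, and then the ordered pairs `(k, n - k)` and
`(n - k, k)` cancel (`rawVec_cancel`, `pv_triad_osc`); the slow-slow interactions transport the
potential vorticity by a stream function (`pv_triad_slow_add`, `transport_add`). Truncation
to a finite symmetric set of frequencies respects all this and gives a dissipative ordinary
differential equation (`exists_galerkin`).

*Compactness.* Each mode is Lipschitz in time uniformly in the truncation, so a subsequence converges
mode by mode (`exists_subseq_tendsto_of_lipschitz`). In the limit of the bilinear term at a fixed
`n`, the sum over `k` needs uniformly small tails (`exists_norm_redTerm_le`). Large `kₕ` are damped by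
the horizontal diffusion. A slow mode of large frequency is small, because its amplitude is that of
the potential vorticity divided by `|ň|_F`. The only remaining interactions, of three oscillating
modes with `kₕ` bounded and `|k₃|` large, are not resonant: there `ω(k)` and `ω(n - k)` tend to `1`,
so a resonance would need `ω(n) ∈ {0, 2}`; but `ω(n) > 0`, and `2` is excluded separately
(`omega_add_ne_two`, `eventually_not_resonant`). The production of slow modes by two oscillating ones,
which this argument does not cover, has sum zero and may be dropped (`tsum_redTerm`).

*Back to the torus.* The exponentials form a Hilbert basis of `L²(𝕋³)` (`torusBasis`). The coefficients
of `𝒬(U, U) - 𝔻U` grow at most like `|ň|²`, those of a test field decay faster than any power, so the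
mode-wise weak formulation can be summed (`isDistribSolution_synth`).
-/

namespace LimitPE

open scoped ComplexConjugate
open Filter Topology

/-! ### Amplitudes -/

/-- Componentwise complex conjugation on `ℂ⁴`. -/
noncomputable def conjV (z : C4) : C4 := WithLp.toLp 2 fun l => conj (z l)

@[simp] lemma conjV_apply (z : C4) (l : Fin 4) : conjV z l = conj (z l) := rfl

lemma inner_C4 (z w : C4) : inner ℂ z w =
    w 0 * conj (z 0) + w 1 * conj (z 1) + w 2 * conj (z 2) + w 3 * conj (z 3) := by
  simp [PiLp.inner_apply, Fin.sum_univ_four]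

lemma C4_ext {z w : C4} (h0 : z 0 = w 0) (h1 : z 1 = w 1) (h2 : z 2 = w 2) (h3 : z 3 = w 3) :
    z = w := by
  ext l; fin_cases l <;> assumption

lemma inner_conjV (z w : C4) : inner ℂ (conjV z) (conjV w) = conj (inner ℂ z w) := by
  simp [inner_C4]

lemma conjV_smul (c : ℂ) (z : C4) : conjV (c • z) = conj c • conjV z := by
  apply C4_ext <;> simp

lemma conjV_add (z w : C4) : conjV (z + w) = conjV z + conjV w := by
  apply C4_ext <;> simp

@[simp] lemma conjV_zero : conjV 0 = 0 := by
  apply C4_ext <;> simp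

lemma conjV_sum {ι : Type*} (s : Finset ι) (f : ι → C4) :
    conjV (∑ i ∈ s, f i) = ∑ i ∈ s, conjV (f i) := by
  classical
  induction s using Finset.induction_on with
  | empty => simp
  | insert i s hi ih => rw [Finset.sum_insert hi, Finset.sum_insert hi, conjV_add, ih]

@[simp] lemma norm_conjV (z : C4) : ‖conjV z‖ = ‖z‖ := by
  simp [EuclideanSpace.norm_eq]

lemma sum_signType {M : Type*} [AddCommMonoid M] (f : SignType → M) :
    ∑ σ, f σ = f 0 + f (-1) + f 1 := by
  have : (Finset.univ : Finset SignType) = {0, -1, 1} := rfl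
  rw [this, Finset.sum_insert (by decide), Finset.sum_insert (by decide), Finset.sum_singleton,
    add_assoc]

lemma sum_signType_neg {M : Type*} [AddCommMonoid M] (f : SignType → M) :
    ∑ σ, f (-σ) = ∑ σ, f σ :=
  Equiv.sum_comp (Equiv.neg SignType) f

/-! ### Frequencies -/

section Freq

variable (a : Fin 3 → ℝ)

@[simp] lemma freq_neg (n : Fin 3 → ℤ) (j : Fin 3) : freq a (-n) j = -freq a n j := by
  simp [freq, neg_div]

lemma freq_add (k m : Fin 3 → ℤ) (j : Fin 3) : freq a (k + m) j = freq a k j + freq a m j := by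
  simp [freq, add_div]

@[simp] lemma freq_zero (j : Fin 3) : freq a 0 j = 0 := by
  simp [freq]

@[simp] lemma normHsq_neg (n : Fin 3 → ℤ) : normHsq a (-n) = normHsq a n := by
  simp [normHsq]

@[simp] lemma normSq_neg (n : Fin 3 → ℤ) : normSq a (-n) = normSq a n := by
  simp [normSq]

lemma normHsq_nonneg (n : Fin 3 → ℤ) : 0 ≤ normHsq a n := by
  unfold normHsq; positivity

lemma normSq_nonneg (n : Fin 3 → ℤ) : 0 ≤ normSq a n := by
  have := normHsq_nonneg a n
  unfold normSq; positivity

variable (F : ℝ)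

@[simp] lemma normFsq_neg (n : Fin 3 → ℤ) : normFsq a F (-n) = normFsq a F n := by
  simp [normFsq]

lemma normFsq_nonneg (n : Fin 3 → ℤ) : 0 ≤ normFsq a F n := by
  have := normHsq_nonneg a n
  unfold normFsq; positivity

@[simp] lemma omega_neg (n : Fin 3 → ℤ) : omega a F (-n) = omega a F n := by
  simp [omega]

lemma omegaS_neg_neg (σ : SignType) (n : Fin 3 → ℤ) :
    omegaS a F (-σ) (-n) = -omegaS a F σ n := by
  simp [omegaS]

@[simp] lemma omegaS_zero (n : Fin 3 → ℤ) : omegaS a F 0 n = 0 := by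
  simp [omegaS]

variable [ha : ∀ i, Fact (0 < a i)]

lemma freq_eq_zero {n : Fin 3 → ℤ} {j : Fin 3} : freq a n j = 0 ↔ n j = 0 := by
  simp [freq, (ha j).out.ne']

lemma normHsq_eq_zero {n : Fin 3 → ℤ} : normHsq a n = 0 ↔ n 0 = 0 ∧ n 1 = 0 := by
  rw [normHsq, add_eq_zero_iff_of_nonneg (by positivity) (by positivity)]
  simp [freq_eq_zero]

lemma normSq_pos {n : Fin 3 → ℤ} (hn : n ≠ 0) : 0 < normSq a n := by
  refine lt_of_le_of_ne (normSq_nonneg a n) fun h => hn ?_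
  have h' := h.symm
  rw [normSq, add_eq_zero_iff_of_nonneg (normHsq_nonneg a n) (by positivity), normHsq_eq_zero,
    sq_eq_zero_iff, freq_eq_zero] at h'
  ext j; fin_cases j
  exacts [h'.1.1, h'.1.2, h'.2]

lemma normFsq_pos (hF : 0 < F) {n : Fin 3 → ℤ} (hn : n ≠ 0) : 0 < normFsq a F n := by
  refine lt_of_le_of_ne (normFsq_nonneg a F n) fun h => hn ?_
  have h' := h.symm
  rw [normFsq, add_eq_zero_iff_of_nonneg (normHsq_nonneg a n) (by positivity), normHsq_eq_zero,
    mul_eq_zero, sq_eq_zero_iff, sq_eq_zero_iff, freq_eq_zero] at h'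
  ext j; fin_cases j
  exacts [h'.1.1, h'.1.2, h'.2.resolve_left hF.ne']

lemma omega_pos (hF : 0 < F) {n : Fin 3 → ℤ} (hn : n ≠ 0) : 0 < omega a F n :=
  div_pos (Real.sqrt_pos.2 (normFsq_pos a F hF hn))
    (mul_pos hF (Real.sqrt_pos.2 (normSq_pos a hn)))

omit ha in
lemma omega_nonneg (hF : 0 < F) (n : Fin 3 → ℤ) : 0 ≤ omega a F n := by
  unfold omega; positivity

lemma omega_sq_mul (hF : 0 < F) {n : Fin 3 → ℤ} (hn : n ≠ 0) :
    omega a F n ^ 2 * (F ^ 2 * normSq a n) = normFsq a F n := by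
  have h := normSq_pos a hn
  rw [omega, div_pow, mul_pow, Real.sq_sqrt (normFsq_nonneg a F n), Real.sq_sqrt h.le]
  field_simp

end Freq

/-! ### Eigenmodes -/

section Modes

variable (a : Fin 3 → ℝ) (F : ℝ)

/-- The divergence symbol `ň · (z₁, z₂, z₃)`. -/
noncomputable def fdot (n : Fin 3 → ℤ) (z : C4) : ℂ := ∑ j : Fin 3, (freq a n j : ℂ) * z j.castSucc

lemma fdot_eq (n : Fin 3 → ℤ) (z : C4) :
    fdot a n z = freq a n 0 * z 0 + freq a n 1 * z 1 + freq a n 2 * z 2 := by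
  simp [fdot, Fin.sum_univ_three]

lemma fdot_smul (n : Fin 3 → ℤ) (c : ℂ) (z : C4) : fdot a n (c • z) = c * fdot a n z := by
  simp [fdot_eq]; ring

lemma fdot_add_left (k m : Fin 3 → ℤ) (z : C4) : fdot a (k + m) z = fdot a k z + fdot a m z := by
  simp [fdot_eq, freq_add]; ring

lemma fdot_neg_left (n : Fin 3 → ℤ) (z : C4) : fdot a (-n) z = -fdot a n z := by
  simp [fdot_eq]; ring

lemma fdot_conjV (n : Fin 3 → ℤ) (z : C4) : fdot a n (conjV z) = conj (fdot a n z) := by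
  simp [fdot_eq]

lemma rawVec_zero_sign (n : Fin 3 → ℤ) :
    rawVec a F 0 n = !₂[-(freq a n 1 : ℂ), (freq a n 0 : ℂ), 0, -(F : ℂ) * freq a n 2] := by
  simp [rawVec]

lemma rawVec_of_vert {σ : SignType} (hσ : σ ≠ 0) {n : Fin 3 → ℤ} (hn : n 0 = 0 ∧ n 1 = 0) :
    rawVec a F σ n = !₂[Complex.I * ((σ : ℝ) : ℂ), 1, 0, 0] := by
  simp [rawVec, hσ, hn]

lemma rawVec_of_horiz {σ : SignType} (hσ : σ ≠ 0) {n : Fin 3 → ℤ} (hn : ¬ (n 0 = 0 ∧ n 1 = 0)) :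
    rawVec a F σ n =
      !₂[-(F : ℂ) * freq a n 2 * (freq a n 1 - Complex.I * (omegaS a F σ n : ℂ) * freq a n 0),
        (F : ℂ) * freq a n 2 * (freq a n 0 + Complex.I * (omegaS a F σ n : ℂ) * freq a n 1),
        -(F : ℂ) * (Complex.I * (omegaS a F σ n : ℂ)) * normHsq a n, (normHsq a n : ℂ)] := by
  simp only [rawVec, hσ, hn, if_false]

lemma fdot_rawVec (σ : SignType) (n : Fin 3 → ℤ) : fdot a n (rawVec a F σ n) = 0 := by
  by_cases hσ : σ = 0
  · subst hσ
    simp [rawVec_zero_sign, fdot_eq]; ring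
  by_cases hn : n 0 = 0 ∧ n 1 = 0
  · simp [rawVec_of_vert a F hσ hn, fdot_eq, freq, hn.1, hn.2]
  · simp [rawVec_of_horiz a F hσ hn, fdot_eq, normHsq]; ring

lemma conjV_rawVec (σ : SignType) (n : Fin 3 → ℤ) :
    conjV (rawVec a F σ n) = (if σ = 0 then -1 else 1 : ℂ) • rawVec a F (-σ) (-n) := by
  by_cases hσ : σ = 0
  · subst hσ
    apply C4_ext <;> simp [rawVec_zero_sign]
  have hσ' : -σ ≠ 0 := by simpa using hσ
  by_cases hn : n 0 = 0 ∧ n 1 = 0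
  · have hn' : (-n) 0 = 0 ∧ (-n) 1 = 0 := by simpa using hn
    rw [rawVec_of_vert a F hσ hn, rawVec_of_vert a F hσ' hn', if_neg hσ, one_smul]
    apply C4_ext <;> simp
  · have hn' : ¬ ((-n) 0 = 0 ∧ (-n) 1 = 0) := by simpa using hn
    rw [rawVec_of_horiz a F hσ hn, rawVec_of_horiz a F hσ' hn', if_neg hσ, one_smul]
    apply C4_ext <;> simp [omegaS_neg_neg] <;> ring

lemma norm_rawVec_neg (σ : SignType) (n : Fin 3 → ℤ) :
    ‖rawVec a F (-σ) (-n)‖ = ‖rawVec a F σ n‖ := by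
  rw [← norm_conjV (rawVec a F σ n), conjV_rawVec, norm_smul]
  split_ifs <;> simp

lemma conjV_eigvec (σ : SignType) (n : Fin 3 → ℤ) :
    conjV (eigvec a F σ n) = (if σ = 0 then -1 else 1 : ℂ) • eigvec a F (-σ) (-n) := by
  by_cases hn : n = 0
  · simp [eigvec, hn]
  · have hn' : -n ≠ 0 := by simpa using hn
    rw [eigvec, eigvec, if_neg hn, if_neg hn', conjV_smul, conjV_rawVec,
      norm_rawVec_neg, smul_comm, Complex.conj_ofReal]

lemma conjV_modePart (σ : SignType) (n : Fin 3 → ℤ) (z : C4) :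
    conjV (modePart a F σ n z) = modePart a F (-σ) (-n) (conjV z) := by
  have h := conjV_eigvec a F σ n
  have h' : eigvec a F (-σ) (-n) = (if σ = 0 then -1 else 1 : ℂ) • conjV (eigvec a F σ n) := by
    rw [h, smul_smul]; split_ifs <;> simp
  rw [modePart, modePart, conjV_smul, h', inner_smul_left, inner_conjV, smul_smul]
  congr 1
  split_ifs <;> simp

lemma modePart_zero_freq (σ : SignType) (z : C4) : modePart a F σ 0 z = 0 := by
  simp [modePart, eigvec]

@[simp] lemma modePart_zero (σ : SignType) (n : Fin 3 → ℤ) : modePart a F σ n 0 = 0 := by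
  simp [modePart]

lemma modePart_smul (σ : SignType) (n : Fin 3 → ℤ) (c : ℂ) (z : C4) :
    modePart a F σ n (c • z) = c • modePart a F σ n z := by
  simp [modePart, smul_smul]

lemma fdot_eigvec (σ : SignType) (n : Fin 3 → ℤ) : fdot a n (eigvec a F σ n) = 0 := by
  unfold eigvec
  split_ifs
  · simp [fdot_eq]
  · rw [fdot_smul, fdot_rawVec, mul_zero]

lemma fdot_modePart (σ : SignType) (n : Fin 3 → ℤ) (z : C4) :
    fdot a n (modePart a F σ n z) = 0 := by
  rw [modePart, fdot_smul, fdot_eigvec, mul_zero]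

/-- The mode projections are self-adjoint. -/
lemma inner_modePart_comm (σ : SignType) (n : Fin 3 → ℤ) (z w : C4) :
    inner ℂ z (modePart a F σ n w) = inner ℂ (modePart a F σ n z) w := by
  rw [modePart, modePart, inner_smul_right, inner_smul_left, inner_conj_symm, mul_comm]

variable [ha : ∀ i, Fact (0 < a i)]

lemma normHsq_pos {n : Fin 3 → ℤ} (hn : ¬ (n 0 = 0 ∧ n 1 = 0)) : 0 < normHsq a n :=
  lt_of_le_of_ne (normHsq_nonneg a n) fun h => hn ((normHsq_eq_zero a).1 h.symm)

lemma rawVec_ne_zero (hF : 0 < F) (σ : SignType) {n : Fin 3 → ℤ} (hn : n ≠ 0) :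
    rawVec a F σ n ≠ 0 := by
  intro h
  by_cases hσ : σ = 0
  · subst hσ
    rw [rawVec_zero_sign] at h
    have h0 := congrArg (fun z : C4 => z 0) h
    have h1 := congrArg (fun z : C4 => z 1) h
    have h3 := congrArg (fun z : C4 => z 3) h
    simp [freq_eq_zero, hF.ne'] at h0 h1 h3
    exact hn (by ext j; fin_cases j <;> assumption)
  by_cases hv : n 0 = 0 ∧ n 1 = 0
  · rw [rawVec_of_vert a F hσ hv] at h
    have h1 := congrArg (fun z : C4 => z 1) h
    simp at h1
  · rw [rawVec_of_horiz a F hσ hv] at h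
    have h1 := congrArg (fun z : C4 => z 3) h
    simp [(normHsq_pos a hv).ne'] at h1

lemma norm_eigvec (hF : 0 < F) (σ : SignType) {n : Fin 3 → ℤ} (hn : n ≠ 0) :
    ‖eigvec a F σ n‖ = 1 := by
  rw [eigvec, if_neg hn, norm_smul, Complex.norm_real, norm_inv, norm_norm]
  exact inv_mul_cancel₀ (norm_ne_zero_iff.2 (rawVec_ne_zero a F hF σ hn))

lemma norm_eigvec_le (hF : 0 < F) (σ : SignType) (n : Fin 3 → ℤ) :
    ‖eigvec a F σ n‖ ≤ 1 := by
  by_cases hn : n = 0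
  · simp [eigvec, hn]
  · exact (norm_eigvec a F hF σ hn).le

lemma norm_modePart_le (hF : 0 < F) (σ : SignType) (n : Fin 3 → ℤ) (z : C4) :
    ‖modePart a F σ n z‖ ≤ ‖z‖ := by
  have h := norm_eigvec_le a F hF σ n
  rw [modePart, norm_smul]
  calc _ ≤ (‖eigvec a F σ n‖ * ‖z‖) * ‖eigvec a F σ n‖ := by gcongr; exact norm_inner_le_norm _ _
    _ ≤ (1 * ‖z‖) * 1 := by gcongr
    _ = ‖z‖ := by ring

omit ha in
lemma inner_rawVec_zero_sign {σ : SignType} (hσ : σ ≠ 0) (n : Fin 3 → ℤ) :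
    inner ℂ (rawVec a F 0 n) (rawVec a F σ n) = 0 := by
  by_cases hv : n 0 = 0 ∧ n 1 = 0
  · simp [rawVec_of_vert a F hσ hv, rawVec_zero_sign, inner_C4, freq, hv.1, hv.2]
  · simp [rawVec_of_horiz a F hσ hv, rawVec_zero_sign, inner_C4, normHsq]; ring

/-- The orthogonality of the two oscillating modes amounts to the eigenvalue identity
`ω² F² |ň|² = |ň|_F²`. -/
lemma inner_rawVec_opposite (hF : 0 < F) {n : Fin 3 → ℤ} (hn : n ≠ 0) :
    inner ℂ (rawVec a F (-1) n) (rawVec a F 1 n) = 0 := by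
  have h1 : (1 : SignType) ≠ 0 := by decide
  have h2 : (-1 : SignType) ≠ 0 := by decide
  by_cases hv : n 0 = 0 ∧ n 1 = 0
  · simp [rawVec_of_vert a F h1 hv, rawVec_of_vert a F h2 hv, inner_C4]
  · have hw := omega_sq_mul a F hF hn
    have hw' : (omega a F n : ℂ) ^ 2 * ((F : ℂ) ^ 2 * normSq a n) = normFsq a F n := by
      exact_mod_cast hw
    have hs : (normSq a n : ℂ) ≠ 0 := by exact_mod_cast (normSq_pos a hn).ne'
    have hI : Complex.I ^ 2 = -1 := Complex.I_sq
    simp [rawVec_of_horiz a F h1 hv, rawVec_of_horiz a F h2 hv, inner_C4, omegaS]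
    apply mul_left_cancel₀ hs
    simp only [normSq, normFsq, normHsq] at hw' ⊢
    push_cast at hw' ⊢
    linear_combination
      -(((freq a n 2 : ℂ)) ^ 2 + (freq a n 0 : ℂ) ^ 2 + (freq a n 1 : ℂ) ^ 2) *
          ((freq a n 0 : ℂ) ^ 2 + (freq a n 1 : ℂ) ^ 2) * hw' +
        ((freq a n 0 : ℂ) ^ 2 + (freq a n 1 : ℂ) ^ 2 + (freq a n 2 : ℂ) ^ 2) ^ 2 *
          (omega a F n : ℂ) ^ 2 * ((freq a n 0 : ℂ) ^ 2 + (freq a n 1 : ℂ) ^ 2) *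
          (F : ℂ) ^ 2 * hI

lemma inner_eigvec_of_ne (hF : 0 < F) {σ τ : SignType} (h : σ ≠ τ) (n : Fin 3 → ℤ) :
    inner ℂ (eigvec a F σ n) (eigvec a F τ n) = 0 := by
  by_cases hn : n = 0
  · simp [eigvec, hn]
  have key : ∀ {σ τ : SignType}, inner ℂ (rawVec a F σ n) (rawVec a F τ n) = 0 →
      inner ℂ (rawVec a F τ n) (rawVec a F σ n) = 0 := fun h => by
    rw [← inner_conj_symm, h, map_zero]
  have h0 := inner_rawVec_opposite a F hF hn
  have : inner ℂ (rawVec a F σ n) (rawVec a F τ n) = 0 := by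
    cases σ <;> cases τ
    all_goals first
      | exact absurd rfl h
      | exact inner_rawVec_zero_sign a F (by decide) n
      | exact key (inner_rawVec_zero_sign a F (by decide) n)
      | exact h0
      | exact key h0
  simp only [eigvec, if_neg hn, inner_smul_left, inner_smul_right, this, mul_zero]

lemma modePart_modePart_self (hF : 0 < F) (σ : SignType) (n : Fin 3 → ℤ) (z : C4) :
    modePart a F σ n (modePart a F σ n z) = modePart a F σ n z := by
  by_cases hn : n = 0
  · simp [hn, modePart_zero_freq]
  conv_lhs => rw [modePart, modePart, inner_smul_right, inner_self_eq_norm_sq_to_K,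
    norm_eigvec a F hF σ hn]
  simp [modePart]

/-- The three modes span the divergence-free amplitudes, because together with `ň` they are four
orthogonal vectors of `ℂ⁴`. -/
lemma sum_modePart (hF : 0 < F) {n : Fin 3 → ℤ} (hn : n ≠ 0) {z : C4} (hz : fdot a n z = 0) :
    ∑ σ, modePart a F σ n z = z := by
  set y : C4 := z - ∑ σ, modePart a F σ n z with hy
  set w : C4 := !₂[(freq a n 0 : ℂ), (freq a n 1 : ℂ), (freq a n 2 : ℂ), 0] with hw
  have hwdot : ∀ v : C4, inner ℂ w v = fdot a n v := by
    intro v; simp [hw, inner_C4, fdot_eq]; ring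
  by_contra hne
  have hy0 : y ≠ 0 := fun h => hne (sub_eq_zero.1 h).symm
  have hw0 : w ≠ 0 := by
    intro h
    have h0 := congrArg (fun z : C4 => z 0) h
    have h1 := congrArg (fun z : C4 => z 1) h
    have h2 := congrArg (fun z : C4 => z 2) h
    simp [hw, freq_eq_zero] at h0 h1 h2
    exact hn (by ext j; fin_cases j <;> assumption)
  have hye : ∀ σ, inner ℂ (eigvec a F σ n) y = 0 := by
    intro σ
    rw [hy, inner_sub_right, inner_sum, Finset.sum_eq_single σ]
    · rw [modePart, inner_smul_right, inner_self_eq_norm_sq_to_K, norm_eigvec a F hF σ hn]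
      simp
    · intro τ _ hτ
      rw [modePart, inner_smul_right, inner_eigvec_of_ne a F hF hτ.symm, mul_zero]
    · simp
  have hwy : inner ℂ w y = 0 := by
    rw [hy, inner_sub_right, inner_sum, hwdot, hz]
    simp [hwdot, fdot_modePart]
  let f : Option (Option SignType) → C4 := fun o => match o with
    | none => w
    | some none => y
    | some (some σ) => eigvec a F σ n
  have hsymm : ∀ {u v : C4}, inner ℂ u v = 0 → inner ℂ v u = 0 := fun h => by
    rw [← inner_conj_symm, h, map_zero]
  have hli : LinearIndependent ℂ f := by
    apply linearIndependent_of_ne_zero_of_inner_eq_zero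
    · rintro (_ | _ | σ)
      · exact hw0
      · exact hy0
      · exact norm_ne_zero_iff.1 (by rw [norm_eigvec a F hF σ hn]; exact one_ne_zero)
    · rintro (_ | _ | σ) (_ | _ | τ) hij
      · exact absurd rfl hij
      · exact hwy
      · exact (hwdot _).trans (fdot_eigvec a F τ n)
      · exact hsymm hwy
      · exact absurd rfl hij
      · exact hsymm (hye τ)
      · exact hsymm ((hwdot _).trans (fdot_eigvec a F σ n))
      · exact hye σ
      · exact inner_eigvec_of_ne a F hF (fun h => hij (by rw [h])) n
  have := hli.fintype_card_le_finrank
  simp at this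
  have h3 : Fintype.card SignType = 3 := rfl
  omega

/-- Pythagoras in the basis of modes. -/
lemma norm_sq_eq_sum_modePart (hF : 0 < F) {n : Fin 3 → ℤ} (hn : n ≠ 0) {z : C4}
    (hz : fdot a n z = 0) : ‖z‖ ^ 2 = ∑ σ, ‖modePart a F σ n z‖ ^ 2 := by
  have h1 : ((‖z‖ ^ 2 : ℝ) : ℂ) = ((∑ σ, ‖modePart a F σ n z‖ ^ 2 : ℝ) : ℂ) := by
    have : inner ℂ z z = inner ℂ z (∑ σ, modePart a F σ n z) := by rw [sum_modePart a F hF hn hz]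
    rw [inner_self_eq_norm_sq_to_K, inner_sum] at this
    push_cast
    refine this.trans (Finset.sum_congr rfl fun σ _ => ?_)
    rw [← modePart_modePart_self a F hF, inner_modePart_comm, inner_self_eq_norm_sq_to_K,
      modePart_modePart_self a F hF]
    rfl
  exact_mod_cast h1

/-! ### The limit diffusion -/

lemma omegaS_injective (hF : 0 < F) {n : Fin 3 → ℤ} (hn : n ≠ 0) {σ τ : SignType} :
    omegaS a F σ n = omegaS a F τ n ↔ σ = τ := by
  refine ⟨fun h => ?_, fun h => by rw [h]⟩
  have := mul_right_cancel₀ (omega_pos a F hF hn).ne' h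
  cases σ <;> cases τ <;> simp at this ⊢ <;> norm_num at this

/-- Away from `n = 0` the eigenvalues are simple, so that the limit diffusion acts on each mode
separately. -/
lemma limitDiffusion_eq (hF : 0 < F) (ν ν' : ℝ) (u : (Fin 3 → ℤ) → C4) (n : Fin 3 → ℤ) :
    limitDiffusion a F ν ν' u n =
      ∑ σ, modePart a F σ n (diffusion a ν ν' n (modePart a F σ n (u n))) := by
  by_cases hn : n = 0
  · simp [limitDiffusion, hn, modePart_zero_freq]
  · simp [limitDiffusion, omegaS_injective a F hF hn]

omit ha in
lemma re_inner_diffusion_le (ν ν' : ℝ) (n : Fin 3 → ℤ) (z : C4) :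
    (inner ℂ z (diffusion a ν ν' n z)).re ≤ -(min ν ν' * normHsq a n * ‖z‖ ^ 2) := by
  have h1 : min ν ν' ≤ ν := min_le_left _ _
  have h2 : min ν ν' ≤ ν' := min_le_right _ _
  have hh := normHsq_nonneg a n
  have key : inner ℂ z (diffusion a ν ν' n z) =
      ((-(normHsq a n * (ν * (‖z 0‖ ^ 2 + ‖z 1‖ ^ 2 + ‖z 2‖ ^ 2) + ν' * ‖z 3‖ ^ 2)) : ℝ) : ℂ) := by
    push_cast
    simp only [← Complex.mul_conj']
    simp [inner_C4, diffusion]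
    ring
  rw [key, Complex.ofReal_re, EuclideanSpace.norm_sq_eq, Fin.sum_univ_four, neg_le_neg_iff]
  have : min ν ν' * (‖z 0‖ ^ 2 + ‖z 1‖ ^ 2 + ‖z 2‖ ^ 2 + ‖z 3‖ ^ 2) ≤
      ν * (‖z 0‖ ^ 2 + ‖z 1‖ ^ 2 + ‖z 2‖ ^ 2) + ν' * ‖z 3‖ ^ 2 := by
    have := mul_le_mul_of_nonneg_right h1 (by positivity : 0 ≤ ‖z 0‖ ^ 2 + ‖z 1‖ ^ 2 + ‖z 2‖ ^ 2)
    have := mul_le_mul_of_nonneg_right h2 (by positivity : 0 ≤ ‖z 3‖ ^ 2)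
    linarith
  calc _ = normHsq a n * (min ν ν' * (‖z 0‖ ^ 2 + ‖z 1‖ ^ 2 + ‖z 2‖ ^ 2 + ‖z 3‖ ^ 2)) := by ring
    _ ≤ _ := by gcongr

/-- The limit diffusion dissipates energy at the rate of the smaller viscosity, in the horizontal
frequencies only. -/
lemma re_inner_limitDiffusion_le (hF : 0 < F) (ν ν' : ℝ) (u : (Fin 3 → ℤ) → C4) {n : Fin 3 → ℤ}
    (hn : n ≠ 0) (hu : fdot a n (u n) = 0) :
    (inner ℂ (u n) (limitDiffusion a F ν ν' u n)).re ≤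
      -(min ν ν' * normHsq a n * ‖u n‖ ^ 2) := by
  rw [limitDiffusion_eq a F hF, inner_sum, Complex.re_sum, norm_sq_eq_sum_modePart a F hF hn hu,
    Finset.mul_sum, ← Finset.sum_neg_distrib]
  refine Finset.sum_le_sum fun σ _ => ?_
  rw [inner_modePart_comm]
  exact re_inner_diffusion_le a ν ν' n _

/-! ### The potential vorticity -/

/-- The potential vorticity amplitude: `i` times it is the Fourier coefficient of
`-∂₂ u¹ + ∂₁ u² - F ∂₃ u⁴`. -/
noncomputable def pv (n : Fin 3 → ℤ) (z : C4) : ℂ := inner ℂ (rawVec a F 0 n) z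

omit ha in
lemma pv_eq (n : Fin 3 → ℤ) (z : C4) :
    pv a F n z = -freq a n 1 * z 0 + freq a n 0 * z 1 - F * freq a n 2 * z 3 := by
  simp [pv, rawVec_zero_sign, inner_C4]; ring

omit ha in
lemma norm_rawVec_zero_sq (n : Fin 3 → ℤ) : ‖rawVec a F 0 n‖ ^ 2 = normFsq a F n := by
  rw [EuclideanSpace.norm_sq_eq, rawVec_zero_sign]
  simp [Fin.sum_univ_four, normFsq, normHsq, mul_pow]
  ring

omit ha in
lemma pv_smul (n : Fin 3 → ℤ) (c : ℂ) (z : C4) : pv a F n (c • z) = c * pv a F n z := by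
  simp [pv]

omit ha in
lemma pv_modePart_of_ne {σ : SignType} (hσ : σ ≠ 0) (n : Fin 3 → ℤ) (z : C4) :
    pv a F n (modePart a F σ n z) = 0 := by
  by_cases hn : n = 0
  · simp [hn, modePart_zero_freq, pv]
  · rw [modePart, pv_smul, eigvec, if_neg hn, pv_smul, pv, inner_rawVec_zero_sign a F hσ]; simp

lemma modePart_zero_eq (hF : 0 < F) (n : Fin 3 → ℤ) (z : C4) :
    modePart a F 0 n z = (pv a F n z * ((normFsq a F n : ℂ))⁻¹) • rawVec a F 0 n := by
  by_cases hn : n = 0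
  · subst hn
    rw [modePart_zero_freq]
    simp [normFsq, normHsq]
  · rw [modePart, eigvec, if_neg hn, inner_smul_left, smul_smul, ← norm_rawVec_zero_sq, pv]
    congr 1
    have := rawVec_ne_zero a F hF 0 hn
    push_cast
    rw [map_inv₀, Complex.conj_ofReal]
    ring

lemma pv_modePart_zero (hF : 0 < F) (n : Fin 3 → ℤ) (z : C4) :
    pv a F n (modePart a F 0 n z) = pv a F n z := by
  by_cases hn : n = 0
  · subst hn
    simp [pv_eq]
  rw [modePart_zero_eq a F hF, pv_smul]
  have h : (normFsq a F n : ℂ) ≠ 0 := by exact_mod_cast (normFsq_pos a F hF hn).ne'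
  rw [pv, pv, inner_self_eq_norm_sq_to_K]
  have : ((‖rawVec a F 0 n‖ : ℝ) : ℂ) ^ 2 = normFsq a F n := by
    exact_mod_cast norm_rawVec_zero_sq a F n
  erw [this]
  field_simp

/-- The slow mode gains one derivative with respect to the potential vorticity. At `n = 0` both sides
vanish, the right one by `x / 0 = 0`. -/
lemma norm_modePart_zero (hF : 0 < F) (n : Fin 3 → ℤ) (z : C4) :
    ‖modePart a F 0 n z‖ = ‖pv a F n z‖ / √(normFsq a F n) := by
  have h : ‖rawVec a F 0 n‖ = √(normFsq a F n) := by
    rw [← norm_rawVec_zero_sq, Real.sqrt_sq (norm_nonneg _)]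
  have h2 := Real.mul_self_sqrt (normFsq_nonneg a F n)
  rw [modePart_zero_eq a F hF, norm_smul, norm_mul, norm_inv, Complex.norm_real, h,
    Real.norm_of_nonneg (normFsq_nonneg a F n)]
  by_cases h0 : √(normFsq a F n) = 0
  · simp [h0]
  · nth_rewrite 1 [← h2]
    field_simp

/-- The limit diffusion does not increase the potential enstrophy: it acts on the slow mode
separately, and there the potential enstrophy is `|ň|_F²` times the energy. -/
lemma re_pv_limitDiffusion_le (hF : 0 < F) {ν ν' : ℝ} (hν : 0 ≤ ν) (hν' : 0 ≤ ν')
    (u : (Fin 3 → ℤ) → C4) (n : Fin 3 → ℤ) :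
    (conj (pv a F n (u n)) * pv a F n (limitDiffusion a F ν ν' u n)).re ≤ 0 := by
  have h1 : pv a F n (limitDiffusion a F ν ν' u n) =
      pv a F n (diffusion a ν ν' n (modePart a F 0 n (u n))) := by
    rw [limitDiffusion_eq a F hF, pv, inner_sum, Finset.sum_eq_single 0]
    · exact pv_modePart_zero a F hF n _
    · exact fun σ _ hσ => pv_modePart_of_ne a F hσ n _
    · simp
  have h2 : conj (pv a F n (u n)) * pv a F n (diffusion a ν ν' n (modePart a F 0 n (u n))) =
      (normFsq a F n : ℂ) * inner ℂ (modePart a F 0 n (u n))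
        (diffusion a ν ν' n (modePart a F 0 n (u n))) := by
    by_cases hn : n = 0
    · subst hn
      simp [pv_eq, normFsq, normHsq]
    have h : (normFsq a F n : ℂ) ≠ 0 := by exact_mod_cast (normFsq_pos a F hF hn).ne'
    generalize diffusion a ν ν' n (modePart a F 0 n (u n)) = d
    rw [modePart_zero_eq a F hF, inner_smul_left, pv, pv, map_mul, map_inv₀, Complex.conj_ofReal]
    field_simp
  rw [h1, h2, Complex.re_ofReal_mul]
  have := re_inner_diffusion_le a ν ν' n (modePart a F 0 n (u n))
  have h3 : 0 ≤ min ν ν' * normHsq a n * ‖modePart a F 0 n (u n)‖ ^ 2 :=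
    mul_nonneg (mul_nonneg (le_min hν hν') (normHsq_nonneg a n)) (by positivity)
  exact mul_nonpos_of_nonneg_of_nonpos (normFsq_nonneg a F n) (by linarith)

end Modes

/-! ### Resonant triads and the exchange of energy -/

section Triads

variable (a : Fin 3 → ℝ) (F : ℝ)

lemma modePart_sum {ι : Type*} (s : Finset ι) (σ : SignType) (n : Fin 3 → ℤ) (f : ι → C4) :
    modePart a F σ n (∑ i ∈ s, f i) = ∑ i ∈ s, modePart a F σ n (f i) := by
  simp [modePart, Finset.sum_smul]

open Classical in
/-- The contribution of the triad `(k, σ), (n - k, τ), (n, ρ)` to the limit bilinear form. -/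
noncomputable def triad (u : (Fin 3 → ℤ) → C4) (σ τ ρ : SignType) (n k : Fin 3 → ℤ) : C4 :=
  if omegaS a F σ k + omegaS a F τ (n - k) = omegaS a F ρ n then
    (Complex.I * fdot a n (modePart a F σ k (u k))) •
      modePart a F ρ n (modePart a F τ (n - k) (u (n - k)))
  else 0

/-- By incompressibility, `n - k` may be replaced with `n` in the symbol of `U · ∇`. -/
lemma fdot_sub_modePart (σ : SignType) (n k : Fin 3 → ℤ) (z : C4) :
    fdot a (n - k) (modePart a F σ k z) = fdot a n (modePart a F σ k z) := by
  rw [sub_eq_add_neg, fdot_add_left, fdot_neg_left, fdot_modePart, neg_zero, add_zero]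

lemma bilinTerm_eq (u : (Fin 3 → ℤ) → C4) (n k : Fin 3 → ℤ) :
    bilinTerm a F u u n k = ∑ σ, ∑ τ, ∑ ρ, triad a F u σ τ ρ n k := by
  unfold bilinTerm triad
  refine Finset.sum_congr rfl fun σ _ => Finset.sum_congr rfl fun τ _ =>
    Finset.sum_congr rfl fun ρ _ => ?_
  have : (∑ j : Fin 3, Complex.I * (freq a (n - k) j : ℂ) *
      modePart a F σ k (u k) j.castSucc) = Complex.I * fdot a n (modePart a F σ k (u k)) := by
    rw [← fdot_sub_modePart, fdot, Finset.mul_sum]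
    exact Finset.sum_congr rfl fun j _ => by ring
  rw [this, modePart_smul]

lemma triad_zero_left (u : (Fin 3 → ℤ) → C4) (σ τ ρ : SignType) (n : Fin 3 → ℤ) :
    triad a F u σ τ ρ n 0 = 0 := by
  simp [triad, modePart_zero_freq, fdot_eq]

lemma triad_zero_right (u : (Fin 3 → ℤ) → C4) (σ τ ρ : SignType) {n k : Fin 3 → ℤ}
    (h : n - k = 0) : triad a F u σ τ ρ n k = 0 := by
  simp [triad, h, modePart_zero_freq]

lemma triad_zero_out (u : (Fin 3 → ℤ) → C4) (σ τ ρ : SignType) (k : Fin 3 → ℤ) :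
    triad a F u σ τ ρ 0 k = 0 := by
  simp [triad, modePart_zero_freq]

lemma triad_of_left_eq_zero {u : (Fin 3 → ℤ) → C4} (σ τ ρ : SignType) (n : Fin 3 → ℤ)
    {k : Fin 3 → ℤ} (h : u k = 0) : triad a F u σ τ ρ n k = 0 := by
  simp [triad, h, fdot_eq]

lemma triad_of_right_eq_zero {u : (Fin 3 → ℤ) → C4} (σ τ ρ : SignType) {n k : Fin 3 → ℤ}
    (h : u (n - k) = 0) : triad a F u σ τ ρ n k = 0 := by
  simp [triad, h]

lemma norm_fdot_le (n : Fin 3 → ℤ) (z : C4) : ‖fdot a n z‖ ≤ √(normSq a n) * ‖z‖ := by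
  set w : C4 := !₂[(freq a n 0 : ℂ), (freq a n 1 : ℂ), (freq a n 2 : ℂ), 0] with hw
  have h1 : fdot a n z = inner ℂ w z := by
    simp [hw, inner_C4, fdot_eq]; ring
  have h2 : ‖w‖ = √(normSq a n) := by
    rw [EuclideanSpace.norm_eq]
    congr 1
    simp [hw, Fin.sum_univ_four, normSq, normHsq]
  rw [h1, ← h2]
  exact norm_inner_le_norm _ _

/-- The triads vary continuously with the two amplitudes they involve. -/
lemma continuous_triad {X : Type*} [TopologicalSpace X] {u : X → (Fin 3 → ℤ) → C4}
    (hu : ∀ n, Continuous fun t => u t n) (σ τ ρ : SignType) (n k : Fin 3 → ℤ) :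
    Continuous fun t => triad a F (u t) σ τ ρ n k := by
  unfold triad
  split_ifs
  · have h : ∀ σ m, Continuous fun t => modePart a F σ m (u t m) := fun σ m => by
      have := hu m
      unfold modePart
      fun_prop
    have h' : Continuous fun t => modePart a F ρ n (modePart a F τ (n - k) (u t (n - k))) := by
      have := h τ (n - k)
      unfold modePart at this ⊢
      fun_prop
    have hf : Continuous fun t => fdot a n (modePart a F σ k (u t k)) := by
      unfold fdot
      refine continuous_finsetSum _ fun j _ => continuous_const.mul ?_
      exact (EuclideanSpace.proj (𝕜 := ℂ) (j.castSucc : Fin 4)).continuous.comp (h σ k)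
    fun_prop
  · exact continuous_const

variable [ha : ∀ i, Fact (0 < a i)]

lemma norm_triad_le (hF : 0 < F) (u : (Fin 3 → ℤ) → C4) (σ τ ρ : SignType) (n k : Fin 3 → ℤ) :
    ‖triad a F u σ τ ρ n k‖ ≤ √(normSq a n) *
      (‖modePart a F σ k (u k)‖ * ‖modePart a F τ (n - k) (u (n - k))‖) := by
  unfold triad
  split_ifs
  · rw [norm_smul, norm_mul, Complex.norm_I, one_mul]
    calc _ ≤ (√(normSq a n) * ‖modePart a F σ k (u k)‖) *
          ‖modePart a F τ (n - k) (u (n - k))‖ := by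
          gcongr
          · exact norm_fdot_le a n _
          · exact norm_modePart_le a F hF ρ n _
      _ = _ := by ring
  · rw [norm_zero]; positivity

lemma norm_triad_le' (hF : 0 < F) (u : (Fin 3 → ℤ) → C4) (σ τ ρ : SignType) (n k : Fin 3 → ℤ) :
    ‖triad a F u σ τ ρ n k‖ ≤ √(normSq a n) * (‖u k‖ * ‖u (n - k)‖) := by
  refine (norm_triad_le a F hF u σ τ ρ n k).trans ?_
  gcongr <;> exact norm_modePart_le a F hF _ _ _

lemma norm_bilinTerm_le (hF : 0 < F) (u : (Fin 3 → ℤ) → C4) (n k : Fin 3 → ℤ) :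
    ‖bilinTerm a F u u n k‖ ≤ 27 * √(normSq a n) * (‖u k‖ * ‖u (n - k)‖) := by
  have h3 : Fintype.card SignType = 3 := rfl
  rw [bilinTerm_eq]
  calc _ ≤ ∑ σ : SignType, ∑ τ : SignType, ∑ ρ : SignType,
        √(normSq a n) * (‖u k‖ * ‖u (n - k)‖) :=
        norm_sum_le_of_le _ fun σ _ => norm_sum_le_of_le _ fun τ _ => norm_sum_le_of_le _ fun ρ _ =>
          norm_triad_le' a F hF u σ τ ρ n k
    _ = _ := by simp [h3]; ring

omit ha in
lemma fdot_sum {ι : Type*} (s : Finset ι) (n : Fin 3 → ℤ) (f : ι → C4) :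
    fdot a n (∑ i ∈ s, f i) = ∑ i ∈ s, fdot a n (f i) := by
  classical
  induction s using Finset.induction_on with
  | empty => simp [fdot_eq]
  | insert i s hi ih =>
    rw [Finset.sum_insert hi, Finset.sum_insert hi, ← ih]
    simp [fdot_eq]; ring

omit ha in
lemma fdot_triad (u : (Fin 3 → ℤ) → C4) (σ τ ρ : SignType) (n k : Fin 3 → ℤ) :
    fdot a n (triad a F u σ τ ρ n k) = 0 := by
  unfold triad
  split_ifs
  · rw [fdot_smul, fdot_modePart, mul_zero]
  · simp [fdot_eq]

omit ha in
lemma fdot_bilinTerm (u : (Fin 3 → ℤ) → C4) (n k : Fin 3 → ℤ) :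
    fdot a n (bilinTerm a F u u n k) = 0 := by
  simp [bilinTerm_eq, fdot_sum, fdot_triad]

omit ha in
lemma conjV_triad {u : (Fin 3 → ℤ) → C4} (hu : ∀ n, u (-n) = conjV (u n)) (σ τ ρ : SignType)
    (n k : Fin 3 → ℤ) :
    triad a F u (-σ) (-τ) (-ρ) (-n) (-k) = conjV (triad a F u σ τ ρ n k) := by
  have h1 : -n - -k = -(n - k) := by abel
  have h2 : (omegaS a F (-σ) (-k) + omegaS a F (-τ) (-(n - k)) = omegaS a F (-ρ) (-n)) ↔
      (omegaS a F σ k + omegaS a F τ (n - k) = omegaS a F ρ n) := by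
    rw [omegaS_neg_neg, omegaS_neg_neg, omegaS_neg_neg, ← neg_add, neg_inj]
  unfold triad
  rw [h1]
  simp only [h2]
  split_ifs
  · rw [hu, hu, ← conjV_modePart, ← conjV_modePart, ← conjV_modePart, conjV_smul,
      fdot_neg_left, fdot_conjV, map_mul, Complex.conj_I]
    congr 1; ring
  · simp

omit ha in
/-- The limit bilinear form maps real fields to real fields. -/
lemma conjV_bilinTerm {u : (Fin 3 → ℤ) → C4} (hu : ∀ n, u (-n) = conjV (u n)) (n k : Fin 3 → ℤ) :
    bilinTerm a F u u (-n) (-k) = conjV (bilinTerm a F u u n k) := by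
  rw [bilinTerm_eq, bilinTerm_eq, conjV_sum, ← sum_signType_neg]
  refine Finset.sum_congr rfl fun σ _ => ?_
  rw [conjV_sum, ← sum_signType_neg]
  refine Finset.sum_congr rfl fun τ _ => ?_
  rw [conjV_sum, ← sum_signType_neg]
  exact Finset.sum_congr rfl fun ρ _ => conjV_triad a F hu σ τ ρ n k

omit ha in
/-- The exchange of `(n - k, τ)` with `(-n, -ρ)` preserves resonances, and changes the sign of the
energy transfer, by incompressibility. -/
lemma inner_triad_add {u : (Fin 3 → ℤ) → C4} (hu : ∀ n, u (-n) = conjV (u n)) (σ τ ρ : SignType)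
    (n k : Fin 3 → ℤ) :
    inner ℂ (u n) (triad a F u σ τ ρ n k) +
      inner ℂ (u (k - n)) (triad a F u σ (-ρ) (-τ) (k - n) k) = 0 := by
  have h1 : k - n - k = -n := by abel
  have h2 : k - n = -(n - k) := by abel
  have h3 : (omegaS a F σ k + omegaS a F (-ρ) (-n) = omegaS a F (-τ) (-(n - k))) ↔
      (omegaS a F σ k + omegaS a F τ (n - k) = omegaS a F ρ n) := by
    rw [omegaS_neg_neg, omegaS_neg_neg]
    constructor <;> intro h <;> linarith
  unfold triad
  rw [h1, h2]
  simp only [h3]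
  split_ifs
  · rw [inner_smul_right, inner_smul_right, inner_modePart_comm, inner_modePart_comm, hu, hu,
      ← conjV_modePart, ← conjV_modePart, inner_conjV, inner_conj_symm, fdot_neg_left,
      fdot_sub_modePart]
    ring
  · simp

omit ha in
/-- The energy transfers of `(n, k)` and of its image under the exchange of `n - k` and `-n` cancel. -/
lemma inner_bilinTerm_add {u : (Fin 3 → ℤ) → C4} (hu : ∀ n, u (-n) = conjV (u n))
    (n k : Fin 3 → ℤ) :
    inner ℂ (u n) (bilinTerm a F u u n k) + inner ℂ (u (k - n)) (bilinTerm a F u u (k - n) k) = 0 := by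
  have h : ∑ σ, ∑ τ, ∑ ρ, triad a F u σ τ ρ (k - n) k =
      ∑ σ, ∑ τ, ∑ ρ, triad a F u σ (-ρ) (-τ) (k - n) k := by
    refine Finset.sum_congr rfl fun σ _ => ?_
    rw [Finset.sum_comm, ← sum_signType_neg]
    exact Finset.sum_congr rfl fun τ _ => (sum_signType_neg _).symm
  rw [bilinTerm_eq, bilinTerm_eq, h]
  simp only [inner_sum]
  simp only [← Finset.sum_add_distrib, inner_triad_add a F hu, Finset.sum_const_zero]

end Triads

/-! ### Interactions that reach the slow mode -/

section Oscillations

variable (a : Fin 3 → ℝ) (F : ℝ) [ha : ∀ i, Fact (0 < a i)]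

/-- The part of the bilinear form by which two oscillating modes could feed the slow mode. -/
noncomputable def oscTerm (u : (Fin 3 → ℤ) → C4) (n k : Fin 3 → ℤ) : C4 :=
  ∑ σ ∈ ({0}ᶜ : Finset SignType), ∑ τ ∈ ({0}ᶜ : Finset SignType), triad a F u σ τ 0 n k

/-- For `F ≠ 1` the frequency `ω(k)` determines the slope of `k`, that is, the ratio of `|ǩₕ|²` and
`ǩ₃²`. -/
lemma normHsq_mul_of_omega_eq (hF : 0 < F) (hF1 : F ≠ 1) {k m : Fin 3 → ℤ} (hk : k ≠ 0)
    (hm : m ≠ 0) (h : omega a F k = omega a F m) :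
    normHsq a k * freq a m 2 ^ 2 = normHsq a m * freq a k 2 ^ 2 := by
  have h1 := omega_sq_mul a F hF hk
  have h2 := omega_sq_mul a F hF hm
  rw [h] at h1
  have h3 : F ^ 2 - 1 ≠ 0 := by
    intro h0
    have : (F - 1) * (F + 1) = 0 := by linarith
    rcases mul_eq_zero.1 this with h4 | h4
    · exact hF1 (by linarith)
    · linarith
  apply mul_left_cancel₀ h3
  have h4 : normFsq a F k * normSq a m = normFsq a F m * normSq a k := by
    rw [← h1, ← h2]; ring
  simp only [normFsq, normSq] at h4
  linarith

/-- Two opposite oscillating modes with the same `ω` produce no potential vorticity: the contributions of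
the two orders of the factors cancel, since the slopes are equal. -/
lemma rawVec_cancel (hF : 0 < F) (hF1 : F ≠ 1) {k m : Fin 3 → ℤ} (hk : k ≠ 0)
    (hm : m ≠ 0) (h : omega a F k = omega a F m) {σ : SignType} (hσ : σ ≠ 0) :
    fdot a (k + m) (rawVec a F σ k) * pv a F (k + m) (rawVec a F (-σ) m) +
      fdot a (k + m) (rawVec a F (-σ) m) * pv a F (k + m) (rawVec a F σ k) = 0 := by
  have hσ' : -σ ≠ 0 := by simpa using hσ
  have hkm := normHsq_mul_of_omega_eq a F hF hF1 hk hm h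
  have hiff : (k 0 = 0 ∧ k 1 = 0) ↔ (m 0 = 0 ∧ m 1 = 0) := by
    have key : ∀ {k m : Fin 3 → ℤ}, k ≠ 0 →
        normHsq a k * freq a m 2 ^ 2 = normHsq a m * freq a k 2 ^ 2 →
        (k 0 = 0 ∧ k 1 = 0) → (m 0 = 0 ∧ m 1 = 0) := by
      intro k m hk h hv
      rw [(normHsq_eq_zero a).2 hv, zero_mul, eq_comm, mul_eq_zero, normHsq_eq_zero] at h
      refine h.resolve_right fun h2 => hk ?_
      rw [sq_eq_zero_iff, freq_eq_zero] at h2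
      ext j; fin_cases j
      exacts [hv.1, hv.2, h2]
    exact ⟨key hk hkm, key hm hkm.symm⟩
  by_cases hv : k 0 = 0 ∧ k 1 = 0
  · have hv' := hiff.1 hv
    simp [rawVec_of_vert a F hσ hv, rawVec_of_vert a F hσ' hv', pv_eq, freq, hv.1, hv.2, hv'.1,
      hv'.2]
  · have hv' := fun h => hv (hiff.2 h)
    have hw : omegaS a F (-σ) m = -omegaS a F σ k := by simp [omegaS, h]
    rw [rawVec_of_horiz a F hσ hv, rawVec_of_horiz a F hσ' hv', hw]
    generalize omegaS a F σ k = w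
    have hkm' : (normHsq a k : ℂ) * (freq a m 2 : ℂ) ^ 2 = normHsq a m * (freq a k 2 : ℂ) ^ 2 := by
      exact_mod_cast hkm
    simp [pv_eq, fdot_eq, freq_add]
    simp only [normHsq] at hkm' ⊢
    push_cast at hkm' ⊢
    linear_combination (F : ℂ) ^ 2 *
      ((freq a k 0 : ℂ) * freq a m 1 - (freq a k 1 : ℂ) * freq a m 0) *
      (1 + (Complex.I * w) ^ 2) * hkm'

omit ha in
lemma modePart_eq_rawVec (σ : SignType) (n : Fin 3 → ℤ) (z : C4) :
    ∃ c : ℂ, modePart a F σ n z = c • rawVec a F σ n := by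
  by_cases hn : n = 0
  · exact ⟨0, by simp [hn, modePart_zero_freq]⟩
  · exact ⟨_, by rw [modePart, eigvec, if_neg hn, smul_smul]⟩

lemma pv_triad_zero (hF : 0 < F) (u : (Fin 3 → ℤ) → C4) (σ τ : SignType) (n k : Fin 3 → ℤ)
    [Decidable (omegaS a F σ k + omegaS a F τ (n - k) = 0)] :
    pv a F n (triad a F u σ τ 0 n k) =
      if omegaS a F σ k + omegaS a F τ (n - k) = 0 then
        Complex.I * fdot a n (modePart a F σ k (u k)) *
          pv a F n (modePart a F τ (n - k) (u (n - k)))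
      else 0 := by
  unfold triad
  rw [omegaS_zero]
  split_ifs
  · rw [pv_smul, pv_modePart_zero a F hF]
  · simp [pv]

/-- Two oscillating modes are resonant with the slow mode only if they have opposite signs and the
same `ω`. -/
lemma omegaS_add_eq_zero (hF : 0 < F) {σ τ : SignType} (hσ : σ ≠ 0) {k m : Fin 3 → ℤ}
    (hk : k ≠ 0) (hm : m ≠ 0) (h : omegaS a F σ k + omegaS a F τ m = 0) :
    τ = -σ ∧ omega a F k = omega a F m := by
  have h1 := omega_pos a F hF hk
  have h2 := omega_pos a F hF hm
  unfold omegaS at h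
  cases σ <;> cases τ <;> simp at h hσ ⊢ <;> linarith

/-- Two oscillating modes do not create potential vorticity: the resonance condition forces
`k` and `n - k` to have the same slope, and then the contributions of the ordered pairs
`(k, n - k)` and `(n - k, k)` cancel. This uses `F ≠ 1`. -/
lemma pv_triad_osc (hF : 0 < F) (hF1 : F ≠ 1) (u : (Fin 3 → ℤ) → C4) {σ τ : SignType} (hσ : σ ≠ 0)
    (n k : Fin 3 → ℤ) :
    pv a F n (triad a F u σ τ 0 n k) + pv a F n (triad a F u τ σ 0 n (n - k)) = 0 := by
  classical
  have hkk : n - (n - k) = k := by abel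
  by_cases hk : k = 0
  · rw [hk, triad_zero_left, triad_zero_right a F u τ σ 0 (by simp)]; simp [pv]
  by_cases hm : n - k = 0
  · rw [hm, triad_zero_left, triad_zero_right a F u σ τ 0 hm]; simp [pv]
  rw [pv_triad_zero a F hF, pv_triad_zero a F hF, hkk, add_comm (omegaS a F τ _)]
  split_ifs with h
  · obtain ⟨rfl, hω⟩ := omegaS_add_eq_zero a F hF hσ hk hm h
    obtain ⟨c, hc⟩ := modePart_eq_rawVec a F σ k (u k)
    obtain ⟨d, hd⟩ := modePart_eq_rawVec a F (-σ) (n - k) (u (n - k))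
    have := rawVec_cancel a F hF hF1 hk hm hω hσ
    rw [add_sub_cancel] at this
    rw [hc, hd, fdot_smul, fdot_smul, pv_smul, pv_smul]
    linear_combination Complex.I * c * d * this
  · simp

omit ha in
lemma pv_sum {ι : Type*} (s : Finset ι) (n : Fin 3 → ℤ) (f : ι → C4) :
    pv a F n (∑ i ∈ s, f i) = ∑ i ∈ s, pv a F n (f i) := by
  simp [pv]

lemma pv_oscTerm_add (hF : 0 < F) (hF1 : F ≠ 1) (u : (Fin 3 → ℤ) → C4) (n k : Fin 3 → ℤ) :
    pv a F n (oscTerm a F u n k) + pv a F n (oscTerm a F u n (n - k)) = 0 := by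
  simp only [oscTerm, pv_sum]
  conv_lhs => rw [add_comm, Finset.sum_comm, add_comm]
  simp only [← Finset.sum_add_distrib]
  refine Finset.sum_eq_zero fun σ hσ => Finset.sum_eq_zero fun τ hτ => ?_
  exact pv_triad_osc a F hF hF1 u (by simpa using hσ) n k

/-- The production of the slow mode by two oscillating ones is odd under `k ↦ n - k`. -/
lemma oscTerm_add (hF : 0 < F) (hF1 : F ≠ 1) (u : (Fin 3 → ℤ) → C4) (n k : Fin 3 → ℤ) :
    oscTerm a F u n k + oscTerm a F u n (n - k) = 0 := by
  have h : ∀ k, modePart a F 0 n (oscTerm a F u n k) = oscTerm a F u n k := by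
    intro k
    simp only [oscTerm, modePart_sum]
    refine Finset.sum_congr rfl fun σ _ => Finset.sum_congr rfl fun τ _ => ?_
    unfold triad
    split_ifs
    · rw [modePart_smul, modePart_modePart_self a F hF]
    · simp
  rw [← h k, ← h (n - k), modePart_zero_eq a F hF, modePart_zero_eq a F hF, ← add_smul, ← add_mul,
    pv_oscTerm_add a F hF hF1, zero_mul, zero_smul]

/-- The potential vorticity created by the bilinear form comes from the slow modes only, up to
the contributions `oscTerm`. -/
lemma pv_bilinTerm (hF : 0 < F) (u : (Fin 3 → ℤ) → C4) (n k : Fin 3 → ℤ) :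
    pv a F n (bilinTerm a F u u n k) =
      pv a F n (oscTerm a F u n k) + pv a F n (triad a F u 0 0 0 n k) := by
  have h1 : ∀ σ τ ρ, ρ ≠ 0 → pv a F n (triad a F u σ τ ρ n k) = 0 := by
    intro σ τ ρ hρ
    unfold triad
    split_ifs
    · rw [pv_smul, pv_modePart_of_ne a F hρ, mul_zero]
    · simp [pv]
  have h2 : ∀ σ τ, ¬ (σ = 0 ↔ τ = 0) → triad a F u σ τ 0 n k = 0 := by
    intro σ τ hne
    by_cases hk : k = 0
    · rw [hk, triad_zero_left]
    by_cases hm : n - k = 0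
    · rw [triad_zero_right a F u σ τ 0 hm]
    rw [triad, if_neg]
    rw [omegaS_zero]
    intro h
    have h1 := (omega_pos a F hF hk).ne'
    have h2 := (omega_pos a F hF hm).ne'
    unfold omegaS at h
    cases σ <;> cases τ <;> simp_all
  have hc : ({0}ᶜ : Finset SignType) = {-1, 1} := rfl
  have h3 : (-1 : SignType) ≠ 1 := by decide
  rw [bilinTerm_eq, oscTerm]
  simp only [pv_sum]
  simp only [sum_signType, hc, Finset.sum_pair h3]
  have e1 := h2 0 (-1) (by decide)
  have e2 := h2 0 1 (by decide)
  have e3 := h2 (-1) 0 (by decide)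
  have e4 := h2 1 0 (by decide)
  have h0 : pv a F n 0 = 0 := by simp [pv]
  simp only [h1 _ _ (-1) (by decide), h1 _ _ 1 (by decide), e1, e2, e3, e4, h0]
  ring

/-- The transport of the potential vorticity of frequency `n - k` by the stream function of
frequency `k`. -/
noncomputable def transport (u : (Fin 3 → ℤ) → C4) (n k : Fin 3 → ℤ) : ℂ :=
  Complex.I * ((freq a k 0 * freq a n 1 - freq a k 1 * freq a n 0 : ℝ) : ℂ) *
    (((normFsq a F k)⁻¹ : ℝ) : ℂ) * pv a F k (u k) * pv a F (n - k) (u (n - k))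

omit ha in
lemma freq_sub (n k : Fin 3 → ℤ) (j : Fin 3) : freq a (n - k) j = freq a n j - freq a k j := by
  simp [freq, sub_div]

/-- Symmetrized in `k` and `n - k`, the interaction of two slow modes is the transport of the potential
vorticity by the stream function. -/
lemma pv_triad_slow_add (hF : 0 < F) (u : (Fin 3 → ℤ) → C4) (n k : Fin 3 → ℤ) :
    pv a F n (triad a F u 0 0 0 n k) + pv a F n (triad a F u 0 0 0 n (n - k)) =
      transport a F u n k + transport a F u n (n - k) := by
  classical
  have hkk : n - (n - k) = k := by abel
  have p0 : ∀ z, pv a F 0 z = 0 := by simp [pv_eq]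
  have t0 : pv a F n 0 = 0 := by simp [pv]
  by_cases hk : k = 0
  · rw [hk, triad_zero_left, triad_zero_right a F u 0 0 0 (by simp)]
    simp [transport, p0, t0]
  by_cases hm : n - k = 0
  · rw [hm, triad_zero_left, triad_zero_right a F u 0 0 0 hm]
    simp [transport, p0, t0, hm]
  have e1 : (normFsq a F k : ℂ) ≠ 0 := by exact_mod_cast (normFsq_pos a F hF hk).ne'
  have e2 : (normFsq a F (n - k) : ℂ) ≠ 0 := by exact_mod_cast (normFsq_pos a F hF hm).ne'
  rw [pv_triad_zero a F hF, pv_triad_zero a F hF, hkk, omegaS_zero, omegaS_zero, add_zero,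
    if_pos rfl]
  unfold transport
  rw [hkk, modePart_zero_eq a F hF, modePart_zero_eq a F hF, fdot_smul, fdot_smul, pv_smul, pv_smul]
  generalize pv a F k (u k) = c
  generalize pv a F (n - k) (u (n - k)) = d
  have hP := inv_mul_cancel₀ e1
  have hQ := inv_mul_cancel₀ e2
  rw [Complex.ofReal_inv, Complex.ofReal_inv]
  generalize ((normFsq a F k : ℂ))⁻¹ = P at hP ⊢
  generalize ((normFsq a F (n - k) : ℂ))⁻¹ = Q at hQ ⊢
  simp only [normFsq, normHsq, pv_eq, fdot_eq, rawVec_zero_sign, freq_sub] at hP hQ ⊢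
  simp at hP hQ ⊢
  linear_combination Complex.I * c * d * (freq a k 0 * freq a n 1 - freq a k 1 * freq a n 0) *
    (P * hQ - Q * hP)

omit ha in
lemma pv_neg_conjV (n : Fin 3 → ℤ) (z : C4) : pv a F (-n) (conjV z) = -conj (pv a F n z) := by
  simp [pv_eq]; ring

omit ha in
/-- The transport is antisymmetric, because the velocity given by a stream function is
divergence-free. -/
lemma transport_add {u : (Fin 3 → ℤ) → C4} (hu : ∀ n, u (-n) = conjV (u n)) (n k : Fin 3 → ℤ) :
    conj (pv a F n (u n)) * transport a F u n k +
      conj (pv a F (k - n) (u (k - n))) * transport a F u (k - n) k = 0 := by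
  have h1 : k - n - k = -n := by abel
  have h2 : k - n = -(n - k) := by abel
  unfold transport
  rw [h1, h2, hu, hu, pv_neg_conjV, pv_neg_conjV]
  simp [freq_sub]
  ring

end Oscillations

/-! ### Conservation of energy and potential enstrophy -/

section Conservation

variable (a : Fin 3 → ℝ) (F : ℝ)

lemma bilinTerm_of_left_eq_zero {u : (Fin 3 → ℤ) → C4} (n : Fin 3 → ℤ) {k : Fin 3 → ℤ}
    (h : u k = 0) : bilinTerm a F u u n k = 0 := by
  simp [bilinTerm_eq, triad_of_left_eq_zero a F _ _ _ n h]

lemma bilinTerm_of_right_eq_zero {u : (Fin 3 → ℤ) → C4} {n k : Fin 3 → ℤ}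
    (h : u (n - k) = 0) : bilinTerm a F u u n k = 0 := by
  simp [bilinTerm_eq, triad_of_right_eq_zero a F _ _ _ h]

/-- A finitely supported array that changes sign under the involution `n ↦ k - n` of each column
has zero total sum. -/
lemma tsum_tsum_eq_zero_of_antisymm {G : Type*} [AddCommGroup G] {f : G → G → ℂ} (S : Finset G)
    (hl : ∀ n k, k ∉ S → f n k = 0) (hr : ∀ n k, n - k ∉ S → f n k = 0)
    (h : ∀ n k, f n k + f (k - n) k = 0) : ∑' n, ∑' k, f n k = 0 := by
  classical
  have hs : Summable (Function.uncurry f) := by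
    apply summable_of_hasFiniteSupport
    refine ((S ×ˢ S).image fun p => (p.1 + p.2, p.1)).finite_toSet.subset ?_
    rintro ⟨n, k⟩ hnk
    have hk : k ∈ S := by
      by_contra hk; exact hnk (hl n k hk)
    have hm : n - k ∈ S := by
      by_contra hk; exact hnk (hr n k hk)
    simp only [Finset.coe_image, Set.mem_image, Finset.mem_coe, Finset.mem_product]
    exact ⟨(k, n - k), ⟨hk, hm⟩, by simp⟩
  rw [← hs.tsum_comm]
  refine (tsum_congr fun k => ?_).trans tsum_zero
  have h1 : ∑' n, f n k = -∑' n, f n k := by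
    conv_lhs => rw [← (Equiv.subLeft k).tsum_eq]
    rw [← tsum_neg]
    exact tsum_congr fun n => eq_neg_of_add_eq_zero_right (h n k)
  exact self_eq_neg.1 h1

/-- The limit bilinear form conserves the energy. -/
lemma tsum_inner_bilin {u : (Fin 3 → ℤ) → C4} (hu : ∀ n, u (-n) = conjV (u n))
    (S : Finset (Fin 3 → ℤ)) (hS : ∀ n, n ∉ S → u n = 0) :
    ∑' n, inner ℂ (u n) (bilin a F u u n) = 0 := by
  have h1 : ∀ n, inner ℂ (u n) (bilin a F u u n) =
      ∑' k, inner ℂ (u n) (bilinTerm a F u u n k) := by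
    intro n
    rw [bilin, tsum_eq_sum (s := S), tsum_eq_sum (s := S), inner_sum]
    · intro k hk
      rw [bilinTerm_of_left_eq_zero a F n (hS k hk), inner_zero_right]
    · exact fun k hk => bilinTerm_of_left_eq_zero a F n (hS k hk)
  simp only [h1]
  refine tsum_tsum_eq_zero_of_antisymm S ?_ ?_ (inner_bilinTerm_add a F hu)
  · intro n k hk
    rw [bilinTerm_of_left_eq_zero a F n (hS k hk), inner_zero_right]
  · intro n k hk
    rw [bilinTerm_of_right_eq_zero a F (hS _ hk), inner_zero_right]

variable [ha : ∀ i, Fact (0 < a i)]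

/-- The limit bilinear form conserves the potential enstrophy. -/
lemma tsum_pv_bilin (hF : 0 < F) (hF1 : F ≠ 1) {u : (Fin 3 → ℤ) → C4}
    (hu : ∀ n, u (-n) = conjV (u n)) (S : Finset (Fin 3 → ℤ)) (hS : ∀ n, n ∉ S → u n = 0) :
    ∑' n, conj (pv a F n (u n)) * pv a F n (bilin a F u u n) = 0 := by
  have p0 : ∀ n, pv a F n 0 = 0 := fun n => by simp [pv]
  have hT : ∀ n k, k ∉ S → transport a F u n k = 0 := by
    intro n k hk
    simp [transport, hS k hk, p0]
  have hT' : ∀ n k, n - k ∉ S → transport a F u n k = 0 := by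
    intro n k hk
    simp [transport, hS _ hk, p0]
  have hB : ∀ n k, k ∉ S → bilinTerm a F u u n k = 0 :=
    fun n k hk => bilinTerm_of_left_eq_zero a F n (hS k hk)
  have hpv : ∀ n k, pv a F n (bilinTerm a F u u n k) +
      pv a F n (bilinTerm a F u u n (n - k)) =
      transport a F u n k + transport a F u n (n - k) := by
    intro n k
    have h1 := pv_oscTerm_add a F hF hF1 u n k
    have h2 := pv_triad_slow_add a F hF u n k
    rw [pv_bilinTerm a F hF, pv_bilinTerm a F hF]
    linear_combination h1 + h2
  have h1 : ∀ n, pv a F n (bilin a F u u n) = ∑' k, transport a F u n k := by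
    intro n
    have e0 : pv a F n (bilin a F u u n) = ∑' k, pv a F n (bilinTerm a F u u n k) := by
      rw [bilin, tsum_eq_sum (s := S) (hB n), tsum_eq_sum (s := S), pv_sum]
      intro k hk
      rw [hB n k hk, p0]
    have s1 : Summable fun k => pv a F n (bilinTerm a F u u n k) :=
      summable_of_ne_finset_zero (s := S) fun k hk => by rw [hB n k hk, p0]
    have s2 : Summable fun k => transport a F u n k :=
      summable_of_ne_finset_zero (s := S) fun k hk => hT n k hk
    have e1 := (Equiv.subLeft n).tsum_eq fun k => pv a F n (bilinTerm a F u u n k)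
    have e2 := (Equiv.subLeft n).tsum_eq fun k => transport a F u n k
    have s1' := (Equiv.subLeft n).summable_iff.2 s1
    have s2' := (Equiv.subLeft n).summable_iff.2 s2
    have e3 := s1.tsum_add s1'
    have e4 := s2.tsum_add s2'
    simp only [Function.comp_def, Equiv.subLeft_apply] at e1 e2 e3 e4
    simp only [hpv] at e3
    rw [e0]
    linear_combination (1 / 2 : ℂ) * (e4 - e3 + e2 - e1)
  simp only [h1, ← tsum_mul_left]
  refine tsum_tsum_eq_zero_of_antisymm S ?_ ?_ (transport_add a F hu)
  · intro n k hk
    rw [hT n k hk, mul_zero]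
  · intro n k hk
    rw [hT' n k hk, mul_zero]

end Conservation

/-! ### Convolution bounds -/

section Summability

variable (a : Fin 3 → ℝ) (F : ℝ) [ha : ∀ i, Fact (0 < a i)]

omit ha in
lemma summable_norm_mul_norm_sub {u : (Fin 3 → ℤ) → C4} (hu : Summable fun n => ‖u n‖ ^ 2)
    (n : Fin 3 → ℤ) : Summable fun k => ‖u k‖ * ‖u (n - k)‖ := by
  have h2 : Summable fun k => ‖u (n - k)‖ ^ 2 := (Equiv.subLeft n).summable_iff.2 hu
  refine Summable.of_nonneg_of_le (fun k => by positivity) (fun k => ?_) (hu.add h2)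
  nlinarith [sq_nonneg (‖u k‖ - ‖u (n - k)‖), norm_nonneg (u k), norm_nonneg (u (n - k))]

omit ha in
lemma tsum_norm_mul_norm_sub_le {u : (Fin 3 → ℤ) → C4} (hu : Summable fun n => ‖u n‖ ^ 2)
    (n : Fin 3 → ℤ) : ∑' k, ‖u k‖ * ‖u (n - k)‖ ≤ ∑' k, ‖u k‖ ^ 2 := by
  have h2 : Summable fun k => ‖u (n - k)‖ ^ 2 := (Equiv.subLeft n).summable_iff.2 hu
  have e2 : ∑' k, ‖u (n - k)‖ ^ 2 = ∑' k, ‖u k‖ ^ 2 :=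
    (Equiv.subLeft n).tsum_eq fun k => ‖u k‖ ^ 2
  calc _ ≤ ∑' k, (1 / 2) * (‖u k‖ ^ 2 + ‖u (n - k)‖ ^ 2) := by
        refine (summable_norm_mul_norm_sub hu n).tsum_le_tsum (fun k => ?_)
          ((hu.add h2).mul_left _)
        nlinarith [sq_nonneg (‖u k‖ - ‖u (n - k)‖)]
    _ = _ := by rw [tsum_mul_left, hu.tsum_add h2, e2]; ring

lemma summable_norm_bilinTerm (hF : 0 < F) {u : (Fin 3 → ℤ) → C4}
    (hu : Summable fun n => ‖u n‖ ^ 2) (n : Fin 3 → ℤ) :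
    Summable fun k => ‖bilinTerm a F u u n k‖ :=
  Summable.of_nonneg_of_le (fun _ => norm_nonneg _) (norm_bilinTerm_le a F hF u n)
    ((summable_norm_mul_norm_sub hu n).mul_left _)

/-- `𝒬` loses one derivative, in the sense that its coefficients grow at most like `|ň|`. -/
lemma norm_bilin_le (hF : 0 < F) {u : (Fin 3 → ℤ) → C4}
    (hu : Summable fun n => ‖u n‖ ^ 2) (n : Fin 3 → ℤ) :
    ‖bilin a F u u n‖ ≤ 27 * √(normSq a n) * ∑' k, ‖u k‖ ^ 2 := by
  have hs := summable_norm_mul_norm_sub hu n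
  calc _ ≤ ∑' k, ‖bilinTerm a F u u n k‖ := norm_tsum_le_tsum_norm (summable_norm_bilinTerm a F hF hu n)
    _ ≤ ∑' k, 27 * √(normSq a n) * (‖u k‖ * ‖u (n - k)‖) :=
        (summable_norm_bilinTerm a F hF hu n).tsum_le_tsum (norm_bilinTerm_le a F hF u n)
          (hs.mul_left _)
    _ ≤ _ := by
        rw [tsum_mul_left]
        exact mul_le_mul_of_nonneg_left (tsum_norm_mul_norm_sub_le hu n) (by positivity)

end Summability

/-! ### Non-resonance and the tails of the bilinear form -/

section Tails

variable (a : Fin 3 → ℝ) (F : ℝ)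

/-- `bilinTerm` without the contributions of two oscillating modes to the slow mode. -/
noncomputable def redTerm (u : (Fin 3 → ℤ) → C4) (n k : Fin 3 → ℤ) : C4 :=
  ∑ σ, ∑ τ, ∑ ρ, if σ ≠ 0 ∧ τ ≠ 0 ∧ ρ = 0 then 0 else triad a F u σ τ ρ n k

lemma redTerm_add_oscTerm (u : (Fin 3 → ℤ) → C4) (n k : Fin 3 → ℤ) :
    redTerm a F u n k + oscTerm a F u n k = bilinTerm a F u u n k := by
  have hc : ({0}ᶜ : Finset SignType) = {-1, 1} := rfl
  have h3 : (-1 : SignType) ≠ 1 := by decide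
  rw [bilinTerm_eq, redTerm, oscTerm]
  simp only [sum_signType, hc, Finset.sum_pair h3]
  simp
  abel

lemma continuous_redTerm {X : Type*} [TopologicalSpace X] {u : X → (Fin 3 → ℤ) → C4}
    (hu : ∀ n, Continuous fun t => u t n) (n k : Fin 3 → ℤ) :
    Continuous fun t => redTerm a F (u t) n k := by
  unfold redTerm
  refine continuous_finsetSum _ fun σ _ => continuous_finsetSum _ fun τ _ =>
    continuous_finsetSum _ fun ρ _ => ?_
  split_ifs
  · exact continuous_const
  · exact continuous_triad a F hu σ τ ρ n k

lemma continuous_bilinTerm {X : Type*} [TopologicalSpace X] {u : X → (Fin 3 → ℤ) → C4}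
    (hu : ∀ n, Continuous fun t => u t n) (n k : Fin 3 → ℤ) :
    Continuous fun t => bilinTerm a F (u t) (u t) n k := by
  simp only [bilinTerm_eq]
  exact continuous_finsetSum _ fun σ _ => continuous_finsetSum _ fun τ _ =>
    continuous_finsetSum _ fun ρ _ => continuous_triad a F hu σ τ ρ n k

variable [ha : ∀ i, Fact (0 < a i)]

lemma norm_redTerm_le (hF : 0 < F) (u : (Fin 3 → ℤ) → C4) (n k : Fin 3 → ℤ) :
    ‖redTerm a F u n k‖ ≤ 27 * √(normSq a n) * (‖u k‖ * ‖u (n - k)‖) := by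
  have h3 : Fintype.card SignType = 3 := rfl
  calc _ ≤ ∑ σ : SignType, ∑ τ : SignType, ∑ ρ : SignType,
        √(normSq a n) * (‖u k‖ * ‖u (n - k)‖) := by
        refine norm_sum_le_of_le _ fun σ _ => norm_sum_le_of_le _ fun τ _ =>
          norm_sum_le_of_le _ fun ρ _ => ?_
        split_ifs
        · rw [norm_zero]; positivity
        · exact norm_triad_le' a F hF u σ τ ρ n k
    _ = _ := by simp [h3]; ring

lemma summable_norm_redTerm (hF : 0 < F) {u : (Fin 3 → ℤ) → C4}
    (hu : Summable fun n => ‖u n‖ ^ 2) (n : Fin 3 → ℤ) :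
    Summable fun k => ‖redTerm a F u n k‖ :=
  Summable.of_nonneg_of_le (fun _ => norm_nonneg _) (norm_redTerm_le a F hF u n)
    ((summable_norm_mul_norm_sub hu n).mul_left _)

/-- The production of slow modes by oscillating ones is zero after summation. -/
lemma tsum_redTerm (hF : 0 < F) (hF1 : F ≠ 1) {u : (Fin 3 → ℤ) → C4}
    (hu : Summable fun n => ‖u n‖ ^ 2) (n : Fin 3 → ℤ) :
    ∑' k, redTerm a F u n k = bilin a F u u n := by
  have s1 := (summable_norm_redTerm a F hF hu n).of_norm
  have s2 := (summable_norm_bilinTerm a F hF hu n).of_norm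
  have s3 : Summable fun k => oscTerm a F u n k := by
    simpa only [← redTerm_add_oscTerm, add_sub_cancel_left] using s2.sub s1
  have e1 := (Equiv.subLeft n).tsum_eq fun k => oscTerm a F u n k
  have e2 : ∑' k, oscTerm a F u n (n - k) = -∑' k, oscTerm a F u n k := by
    rw [← tsum_neg]
    exact tsum_congr fun k => eq_neg_of_add_eq_zero_right (oscTerm_add a F hF hF1 u n k)
  simp only [Equiv.subLeft_apply] at e1
  have e3 : ∑' k, oscTerm a F u n k = 0 := by
    have h : (2 : ℂ) • ∑' k, oscTerm a F u n k = 0 := by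
      rw [two_smul]
      exact add_eq_zero_iff_eq_neg.2 (e1.symm.trans e2)
    simpa using h
  rw [bilin]
  simp only [← redTerm_add_oscTerm]
  rw [s1.tsum_add s3, e3, add_zero]

lemma finite_normSq_le (M : ℝ) : {k : Fin 3 → ℤ | normSq a k ≤ M}.Finite := by
  refine (Set.finite_Icc (fun j => -⌈a j * √M⌉) (fun j => ⌈a j * √M⌉)).subset fun k hk => ?_
  have h : ∀ j, |(k j : ℝ)| ≤ ⌈a j * √M⌉ := by
    intro j
    have hj : freq a k j ^ 2 ≤ normSq a k := by
      unfold normSq normHsq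
      fin_cases j <;> simp <;> nlinarith [sq_nonneg (freq a k 0), sq_nonneg (freq a k 1),
        sq_nonneg (freq a k 2)]
    have h1 : |freq a k j| ≤ √M := by
      rw [← Real.sqrt_sq_eq_abs]
      exact Real.sqrt_le_sqrt (hj.trans hk)
    have haj := (ha j).out
    rw [freq, abs_div, abs_of_pos haj, div_le_iff₀ haj] at h1
    exact (h1.trans_eq (mul_comm _ _)).trans (Int.le_ceil _)
  rw [Set.mem_Icc, Pi.le_def, Pi.le_def]
  constructor
  · intro j
    have := (abs_le.1 (h j)).1
    exact_mod_cast this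
  · intro j
    have := (abs_le.1 (h j)).2
    exact_mod_cast this

lemma finite_normFsq_le (hF : 0 < F) (M : ℝ) : {k : Fin 3 → ℤ | normFsq a F k ≤ M}.Finite := by
  refine (finite_normSq_le a (M + M / F ^ 2)).subset fun k hk => ?_
  have hk' : normFsq a F k ≤ M := hk
  have h1 := normHsq_nonneg a k
  have hF2 : 0 < F ^ 2 := by positivity
  have h2 : 0 ≤ F ^ 2 * freq a k 2 ^ 2 := by positivity
  unfold normFsq at hk'
  have h3 : freq a k 2 ^ 2 ≤ M / F ^ 2 := by rw [le_div_iff₀ hF2]; linarith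
  change normHsq a k + freq a k 2 ^ 2 ≤ _
  linarith

lemma tendsto_normSq : Tendsto (normSq a) cofinite atTop := by
  refine tendsto_atTop.2 fun M => ?_
  filter_upwards [(finite_normSq_le a M).compl_mem_cofinite] with k hk
  exact (not_le.1 fun h => hk h).le

/-- `ω² - 1` is of the order of `|ǩₕ|² / |ǩ|²`, with the sign of `1 - F`. -/
lemma omega_sq_sub_one (hF : 0 < F) {k : Fin 3 → ℤ} (hk : k ≠ 0) :
    omega a F k ^ 2 - 1 = normHsq a k * (1 - F ^ 2) / F ^ 2 * (normSq a k)⁻¹ := by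
  have h := omega_sq_mul a F hF hk
  have hs := (normSq_pos a hk).ne'
  field_simp
  unfold normFsq at h
  have : normSq a k = normHsq a k + freq a k 2 ^ 2 := rfl
  linear_combination h + F ^ 2 * (-this)

/-- The frequencies of the oscillating modes tend to `±1` when `|k₃| → ∞` with `kₕ` bounded. -/
lemma tendsto_omega (hF : 0 < F) (R : ℝ) :
    Tendsto (omega a F) (cofinite ⊓ 𝓟 {k | normHsq a k ≤ R}) (𝓝 1) := by
  have h1 : Tendsto (fun k => omega a F k ^ 2 - 1) (cofinite ⊓ 𝓟 {k | normHsq a k ≤ R}) (𝓝 0) := by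
    have h2 : Tendsto (fun k => R * |1 - F ^ 2| / F ^ 2 * (normSq a k)⁻¹)
        (cofinite ⊓ 𝓟 {k | normHsq a k ≤ R}) (𝓝 0) := by
      have := (tendsto_inv_atTop_zero.comp (tendsto_normSq a)).const_mul (R * |1 - F ^ 2| / F ^ 2)
      rw [mul_zero] at this
      exact this.mono_left inf_le_left
    refine squeeze_zero_norm' ?_ h2
    have h0 : ∀ᶠ k in cofinite ⊓ 𝓟 {k | normHsq a k ≤ R}, k ≠ (0 : Fin 3 → ℤ) :=
      Filter.Eventually.filter_mono inf_le_left (eventually_cofinite_ne 0)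
    have h3 : ∀ᶠ k in cofinite ⊓ 𝓟 {k | normHsq a k ≤ R}, normHsq a k ≤ R :=
      Filter.Eventually.filter_mono inf_le_right (mem_principal_self _)
    filter_upwards [h0, h3] with k hk hR
    rw [omega_sq_sub_one a F hF hk, norm_mul, norm_div, norm_mul, Real.norm_eq_abs,
      Real.norm_eq_abs, Real.norm_eq_abs, Real.norm_eq_abs, abs_of_nonneg (normHsq_nonneg a k),
      abs_of_nonneg (sq_nonneg F), abs_of_nonneg (inv_nonneg.2 (normSq_nonneg a k))]
    have := normSq_nonneg a k
    gcongr
  have h4 : Tendsto (fun k => √(omega a F k ^ 2)) (cofinite ⊓ 𝓟 {k | normHsq a k ≤ R})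
      (𝓝 (√1)) := by
    refine (Real.continuous_sqrt.tendsto 1).comp ?_
    simpa using h1.add_const 1
  simpa only [Real.sqrt_sq (omega_nonneg a F hF _), Real.sqrt_one] using h4

lemma one_le_omega (hF : 0 < F) (hF1 : F < 1) {k : Fin 3 → ℤ} (hk : k ≠ 0) :
    1 ≤ omega a F k := by
  have h := omega_sq_sub_one a F hF hk
  have h1 := normHsq_nonneg a k
  have h2 := normSq_pos a hk
  have h3 : 0 < 1 - F ^ 2 := by nlinarith
  have : 0 ≤ omega a F k ^ 2 - 1 := by rw [h]; positivity
  nlinarith [omega_nonneg a F hF k]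

lemma normHsq_eq_zero_of_omega (hF : 0 < F) (hF1 : F < 1) {k : Fin 3 → ℤ} (hk : k ≠ 0)
    (h1 : omega a F k = 1) : normHsq a k = 0 := by
  have h := omega_sq_sub_one a F hF hk
  have h2 := normSq_pos a hk
  have h3 : 0 < 1 - F ^ 2 := by nlinarith
  rw [h1] at h
  by_contra h4
  have h5 : 0 < normHsq a k := lt_of_le_of_ne (normHsq_nonneg a k) (Ne.symm h4)
  have : 0 < normHsq a k * (1 - F ^ 2) / F ^ 2 * (normSq a k)⁻¹ := by positivity
  linarith

/-- A resonance `ω(k) + ω(m) = ω(k + m)` with `ω(k + m) = 2` would force `F < 1` and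
`kₕ = mₕ = 0`, hence `ω(k + m) = 1`. -/
lemma omega_add_ne_two (hF : 0 < F) {k m : Fin 3 → ℤ} (hk : k ≠ 0) (hm : m ≠ 0)
    (h : omega a F (k + m) = 2) : omega a F k + omega a F m ≠ 2 := by
  intro h2
  have hn : k + m ≠ 0 := by
    rintro h0
    rw [h0] at h
    simp [omega, normSq, normHsq] at h
  have hF1 : F < 1 := by
    have h3 := omega_sq_sub_one a F hF hn
    rw [h] at h3
    by_contra hF1
    have h4 : 1 - F ^ 2 ≤ 0 := by nlinarith
    have h5 := normHsq_nonneg a (k + m)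
    have h6 := normSq_pos a hn
    have : normHsq a (k + m) * (1 - F ^ 2) / F ^ 2 * (normSq a (k + m))⁻¹ ≤ 0 := by
      refine mul_nonpos_of_nonpos_of_nonneg (div_nonpos_of_nonpos_of_nonneg ?_ (by positivity))
        (by positivity)
      exact mul_nonpos_of_nonneg_of_nonpos h5 h4
    linarith
  have h3 := one_le_omega a F hF hF1 hk
  have h4 := one_le_omega a F hF hF1 hm
  have h5 := (normHsq_eq_zero a).1 (normHsq_eq_zero_of_omega a F hF hF1 hk (by linarith))
  have h6 := (normHsq_eq_zero a).1 (normHsq_eq_zero_of_omega a F hF hF1 hm (by linarith))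
  have h7 : normHsq a (k + m) = 0 := (normHsq_eq_zero a).2 (by simp [h5, h6])
  have h8 := omega_sq_sub_one a F hF hn
  rw [h, h7] at h8
  norm_num at h8

/-- For fixed `n`, only finitely many `k` with bounded `kₕ` are resonant with three oscillating
modes. -/
lemma eventually_not_resonant (hF : 0 < F) {n : Fin 3 → ℤ} (hn : n ≠ 0) (R : ℝ)
    {σ τ ρ : SignType} (hσ : σ ≠ 0) (hτ : τ ≠ 0) (hρ : ρ ≠ 0) :
    ∀ᶠ k in cofinite ⊓ 𝓟 {k | normHsq a k ≤ R},
      omegaS a F σ k + omegaS a F τ (n - k) ≠ omegaS a F ρ n := by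
  have h1 := tendsto_omega a F hF R
  have h2 : Tendsto (fun k => omega a F (n - k)) (cofinite ⊓ 𝓟 {k | normHsq a k ≤ R}) (𝓝 1) := by
    refine (tendsto_omega a F hF (2 * normHsq a n + 2 * R)).comp ?_
    refine tendsto_inf.2 ⟨?_, ?_⟩
    · exact ((Equiv.subLeft n).injective.tendsto_cofinite).mono_left inf_le_left
    · refine tendsto_principal.2 ?_
      have h3 : ∀ᶠ k in cofinite ⊓ 𝓟 {k | normHsq a k ≤ R}, normHsq a k ≤ R :=
        Filter.Eventually.filter_mono inf_le_right (mem_principal_self _)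
      filter_upwards [h3] with k hk
      simp only [normHsq, freq_sub] at hk ⊢
      nlinarith [sq_nonneg (freq a n 0 + freq a k 0), sq_nonneg (freq a n 1 + freq a k 1)]
  have h3 : Tendsto (fun k => omegaS a F σ k + omegaS a F τ (n - k))
      (cofinite ⊓ 𝓟 {k | normHsq a k ≤ R}) (𝓝 ((σ : ℝ) * 1 + (τ : ℝ) * 1)) :=
    (h1.const_mul _).add (h2.const_mul _)
  by_cases hlim : (σ : ℝ) * 1 + (τ : ℝ) * 1 = omegaS a F ρ n
  swap
  · exact h3.eventually_ne hlim
  -- the limit is `-2`, `0` or `2`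
  have hω := omega_pos a F hF hn
  have key : omega a F n = 2 ∧ σ = ρ ∧ τ = ρ := by
    unfold omegaS at hlim
    cases σ <;> cases τ <;> cases ρ <;> simp at hσ hτ hρ hlim ⊢ <;> linarith
  obtain ⟨hω2, rfl, rfl⟩ := key
  have e1 : ∀ᶠ k in cofinite ⊓ 𝓟 {k | normHsq a k ≤ R}, k ≠ (0 : Fin 3 → ℤ) :=
    Filter.Eventually.filter_mono inf_le_left (eventually_cofinite_ne 0)
  have e2 : ∀ᶠ k in cofinite ⊓ 𝓟 {k | normHsq a k ≤ R}, k ≠ n :=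
    Filter.Eventually.filter_mono inf_le_left (eventually_cofinite_ne n)
  filter_upwards [e1, e2] with k hk hkn h
  have := omega_add_ne_two a F hF hk (sub_ne_zero.2 hkn.symm) (by rwa [add_sub_cancel])
  unfold omegaS at h
  rw [← mul_add, hω2] at h
  exact this (mul_left_cancel₀ (by cases τ <;> simp at hσ ⊢) h)

/-- The quadratic density that controls the tails of the bilinear form. -/
noncomputable def tailDensity (u : (Fin 3 → ℤ) → C4) (n k : Fin 3 → ℤ) : ℝ :=
  normHsq a k * ‖u k‖ ^ 2 + ‖u k‖ ^ 2 + 2 * ‖u (n - k)‖ ^ 2 + ‖pv a F k (u k)‖ ^ 2 +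
    ‖pv a F (n - k) (u (n - k))‖ ^ 2

/-- The tails of the bilinear form are small: high horizontal frequencies are damped by the
diffusion, slow modes by the potential enstrophy, and three oscillating modes are not resonant when
`|k₃|` is large and `kₕ` bounded. -/
lemma exists_norm_redTerm_le (hF : 0 < F) (n : Fin 3 → ℤ) {δ : ℝ} (hδ : 0 < δ) :
    ∃ T : Finset (Fin 3 → ℤ), ∀ k ∉ T, ∀ u : (Fin 3 → ℤ) → C4,
      ‖redTerm a F u n k‖ ≤ 27 * √(normSq a n) * δ * tailDensity a F u n k := by
  classical
  by_cases hn : n = 0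
  · subst hn
    refine ⟨∅, fun k _ u => ?_⟩
    simp [redTerm, triad_zero_out, normSq, normHsq]
  have hres : ∀ᶠ k in cofinite ⊓ 𝓟 {k | normHsq a k ≤ (δ ^ 2)⁻¹}, ∀ σ τ ρ : SignType,
      σ ≠ 0 → τ ≠ 0 → ρ ≠ 0 → omegaS a F σ k + omegaS a F τ (n - k) ≠ omegaS a F ρ n := by
    refine eventually_all.2 fun σ => eventually_all.2 fun τ => eventually_all.2 fun ρ => ?_
    by_cases h : σ ≠ 0 ∧ τ ≠ 0 ∧ ρ ≠ 0
    · filter_upwards [eventually_not_resonant a F hF hn (δ ^ 2)⁻¹ h.1 h.2.1 h.2.2] with k hk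
      exact fun _ _ _ => hk
    · exact Eventually.of_forall fun k h1 h2 h3 => absurd ⟨h1, h2, h3⟩ h
  rw [eventually_inf_principal, Filter.eventually_cofinite] at hres
  have hfin := finite_normFsq_le a F hF (δ ^ 2)⁻¹
  refine ⟨hres.toFinset ∪ hfin.toFinset ∪ hfin.toFinset.image (fun m => n - m), ?_⟩
  intro k hk u
  simp only [Finset.mem_union, Set.Finite.mem_toFinset, Set.mem_ofPred_eq, not_or, not_not,
    Finset.mem_image, not_exists, not_and] at hk
  obtain ⟨⟨hk1, hk2⟩, hk3⟩ := hk
  have hm : (δ ^ 2)⁻¹ < normFsq a F (n - k) := by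
    by_contra h
    exact hk3 (n - k) (not_lt.1 h) (by abel)
  have hk2' := not_le.1 hk2
  have hslow : ∀ m, (δ ^ 2)⁻¹ < normFsq a F m →
      ‖modePart a F 0 m (u m)‖ ≤ δ * ‖pv a F m (u m)‖ := by
    intro m hm
    have h1 : δ⁻¹ ≤ √(normFsq a F m) := by
      apply Real.le_sqrt_of_sq_le
      rw [inv_pow]; exact hm.le
    rw [norm_modePart_zero a F hF, div_le_iff₀ (lt_of_lt_of_le (by positivity) h1)]
    calc ‖pv a F m (u m)‖ = δ * ‖pv a F m (u m)‖ * δ⁻¹ := by field_simp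
      _ ≤ _ := by gcongr
  have hD : ∀ x y : ℝ, x * y ≤ (1 / 2) * (x ^ 2 + y ^ 2) := fun x y => by
    nlinarith [sq_nonneg (x - y)]
  have hH := normHsq_nonneg a k
  have hpt : ∀ σ τ ρ, ‖(if σ ≠ 0 ∧ τ ≠ 0 ∧ ρ = 0 then 0 else triad a F u σ τ ρ n k)‖ ≤
      √(normSq a n) * δ * tailDensity a F u n k := by
    intro σ τ ρ
    have hnn : 0 ≤ tailDensity a F u n k := by unfold tailDensity; positivity
    split_ifs with hc
    · rw [norm_zero]; positivity
    by_cases hh : (δ ^ 2)⁻¹ < normHsq a k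
    -- large horizontal frequency: the dissipation gives the factor `δ`
    · have h1 : 1 ≤ δ * √(normHsq a k) := by
        have : δ⁻¹ ≤ √(normHsq a k) := by
          apply Real.le_sqrt_of_sq_le
          rw [inv_pow]; exact hh.le
        calc (1 : ℝ) = δ * δ⁻¹ := by field_simp
          _ ≤ _ := by gcongr
      refine (norm_triad_le' a F hF u σ τ ρ n k).trans ?_
      rw [mul_assoc]
      refine mul_le_mul_of_nonneg_left ?_ (by positivity)
      calc ‖u k‖ * ‖u (n - k)‖ ≤ (δ * √(normHsq a k)) * (‖u k‖ * ‖u (n - k)‖) :=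
            le_mul_of_one_le_left (by positivity) h1
        _ = δ * ((√(normHsq a k) * ‖u k‖) * ‖u (n - k)‖) := by ring
        _ ≤ δ * tailDensity a F u n k := by
            gcongr
            refine (hD _ _).trans ?_
            rw [mul_pow, Real.sq_sqrt hH]
            unfold tailDensity
            have : 0 ≤ normHsq a k * ‖u k‖ ^ 2 := by positivity
            nlinarith [sq_nonneg ‖u k‖, sq_nonneg ‖u (n - k)‖, sq_nonneg ‖pv a F k (u k)‖,
              sq_nonneg ‖pv a F (n - k) (u (n - k))‖]
    · have hbd : ∀ x y : ℝ, ‖modePart a F σ k (u k)‖ * ‖modePart a F τ (n - k) (u (n - k))‖ ≤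
          δ * (x * y) → (1 / 2) * (x ^ 2 + y ^ 2) ≤ tailDensity a F u n k →
          ‖triad a F u σ τ ρ n k‖ ≤ √(normSq a n) * δ * tailDensity a F u n k := by
        intro x y h1 h2
        refine (norm_triad_le a F hF u σ τ ρ n k).trans ?_
        rw [mul_assoc]
        refine mul_le_mul_of_nonneg_left (h1.trans ?_) (by positivity)
        exact mul_le_mul_of_nonneg_left ((hD x y).trans h2) hδ.le
      have h5 : 0 ≤ normHsq a k * ‖u k‖ ^ 2 := by positivity
      -- a slow mode of large frequency: the potential enstrophy gives the factor `δ`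
      by_cases hσ : σ = 0
      · subst hσ
        refine hbd ‖pv a F k (u k)‖ ‖u (n - k)‖ ?_ ?_
        · rw [← mul_assoc]
          gcongr
          · exact hslow k hk2'
          · exact norm_modePart_le a F hF _ _ _
        · unfold tailDensity
          nlinarith [sq_nonneg ‖u k‖, sq_nonneg ‖u (n - k)‖, sq_nonneg ‖pv a F k (u k)‖,
              sq_nonneg ‖pv a F (n - k) (u (n - k))‖]
      by_cases hτ : τ = 0
      · subst hτ
        refine hbd ‖u k‖ ‖pv a F (n - k) (u (n - k))‖ ?_ ?_
        · rw [← mul_assoc, mul_comm δ, mul_assoc]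
          gcongr
          · exact norm_modePart_le a F hF _ _ _
          · exact hslow _ hm
        · unfold tailDensity
          nlinarith [sq_nonneg ‖u k‖, sq_nonneg ‖u (n - k)‖, sq_nonneg ‖pv a F k (u k)‖,
              sq_nonneg ‖pv a F (n - k) (u (n - k))‖]
      -- `redTerm` omits the triads of two oscillating modes and a slow one
      have hρ : ρ ≠ 0 := fun h => hc ⟨hσ, hτ, h⟩
      rw [triad, if_neg (hk1 (not_lt.1 hh) σ τ ρ hσ hτ hρ), norm_zero]
      positivity
  have h3 : Fintype.card SignType = 3 := rfl
  calc _ ≤ ∑ σ : SignType, ∑ τ : SignType, ∑ ρ : SignType,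
        √(normSq a n) * δ * tailDensity a F u n k :=
        norm_sum_le_of_le _ fun σ _ => norm_sum_le_of_le _ fun τ _ =>
          norm_sum_le_of_le _ fun ρ _ => hpt σ τ ρ
    _ = _ := by simp [h3]; ring

end Tails

/-! ### Dissipative ordinary differential equations -/

section ODE

lemma le_of_hasDerivAt_nonpos {φ φ' : ℝ → ℝ} {T : ℝ} (hc : Continuous φ)
    (hd : ∀ t ∈ Ioo 0 T, HasDerivAt φ (φ' t) t) (hφ : ∀ t ∈ Ioo 0 T, φ' t ≤ 0) {t : ℝ}
    (ht : t ∈ Icc 0 T) : φ t ≤ φ 0 := by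
  have h : AntitoneOn φ (Icc 0 T) := by
    refine antitoneOn_of_deriv_nonpos (convex_Icc 0 T) hc.continuousOn ?_ ?_
    · rw [interior_Icc]
      exact fun s hs => (hd s hs).differentiableAt.differentiableWithinAt
    · rw [interior_Icc]
      intro s hs
      rw [(hd s hs).deriv]
      exact hφ s hs
  exact h (left_mem_Icc.2 (ht.1.trans ht.2)) ht ht.1

/-- A dissipative `C¹` vector field on a finite-dimensional Euclidean space has solutions on any
bounded time interval: a cut-off makes the field Lipschitz and bounded, and the solution stays
where the cut-off is inactive because its norm does not increase. -/
theorem exists_solution_of_dissipative {E : Type*} [NormedAddCommGroup E] [InnerProductSpace ℝ E]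
    [FiniteDimensional ℝ E] {f : E → E} (hf : ContDiff ℝ 1 f) (hd : ∀ x, inner ℝ x (f x) ≤ 0)
    (x₀ : E) {T : ℝ} (hT : 0 ≤ T) :
    ∃ u : ℝ → E, Continuous u ∧ u 0 = x₀ ∧ ∀ t ∈ Ioo 0 T, HasDerivAt u (f (u t)) t := by
  have hR : 0 < ‖x₀‖ + 1 := by positivity
  let χ : ContDiffBump (0 : E) := ⟨‖x₀‖ + 1, ‖x₀‖ + 2, hR, by linarith⟩
  set g : E → E := fun x => χ x • f x with hg
  have hgc : ContDiff ℝ 1 g := χ.contDiff.smul hf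
  have hgs : HasCompactSupport g := χ.hasCompactSupport.smul_right
  obtain ⟨K, hK⟩ := hgc.lipschitzWith_of_hasCompactSupport hgs one_ne_zero
  obtain ⟨M, hM⟩ := hgs.exists_bound_of_continuous hgc.continuous
  have hM0 : 0 ≤ M := (norm_nonneg _).trans (hM 0)
  have hpl : IsPicardLindelof (fun _ : ℝ => g) (tmin := 0) (tmax := T) ⟨0, left_mem_Icc.2 hT⟩ x₀
      ⟨M * T, by positivity⟩ 0 ⟨M, hM0⟩ K := by
    refine ⟨fun t _ => hK.lipschitzOnWith, fun x _ => continuousOn_const, fun t _ x _ => hM x, ?_⟩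
    simp only [sub_zero, NNReal.coe_zero, sub_self]
    rw [max_eq_left hT]
    exact le_rfl
  obtain ⟨v, hv0, hv⟩ := hpl.exists_eq_forall_mem_Icc_hasDerivWithinAt₀
  simp only at hv0
  have hvc : ContinuousOn v (Icc 0 T) := fun t ht => (hv t ht).continuousWithinAt
  set u : ℝ → E := fun t => v (projIcc 0 T hT t) with hu
  have huc : Continuous u := by
    refine hvc.comp_continuous (continuous_subtype_val.comp continuous_projIcc) fun t => ?_
    exact (projIcc 0 T hT t).2
  have huv : ∀ t ∈ Icc 0 T, u t = v t := fun t ht => by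
    rw [hu]; simp only; rw [projIcc_of_mem hT ht]
  have hu0 : u 0 = x₀ := by rw [huv 0 (left_mem_Icc.2 hT), hv0]
  have hud : ∀ t ∈ Ioo 0 T, HasDerivAt u (g (u t)) t := by
    intro t ht
    have h1 := (hv t (Ioo_subset_Icc_self ht)).hasDerivAt (Icc_mem_nhds ht.1 ht.2)
    rw [huv t (Ioo_subset_Icc_self ht)]
    refine h1.congr_of_eventuallyEq ?_
    filter_upwards [Icc_mem_nhds ht.1 ht.2] with s hs using huv s hs
  have hle : ∀ t ∈ Icc 0 T, ‖u t‖ ^ 2 ≤ ‖u 0‖ ^ 2 := by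
    intro t ht
    refine le_of_hasDerivAt_nonpos (φ := fun t => ‖u t‖ ^ 2) (by fun_prop)
      (fun s hs => (hud s hs).norm_sq) (fun s _ => ?_) ht
    rw [hg]; simp only
    rw [inner_smul_right]
    have h1 : 0 ≤ χ (u s) := χ.nonneg
    nlinarith [hd (u s)]
  refine ⟨u, huc, hu0, fun t ht => ?_⟩
  have h1 : χ (u t) = 1 := by
    refine χ.one_of_mem_closedBall ?_
    have h2 := hle t (Ioo_subset_Icc_self ht)
    rw [hu0] at h2
    have h3 : ‖u t‖ ≤ ‖x₀‖ := le_of_sq_le_sq h2 (norm_nonneg _)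
    rw [mem_closedBall_zero_iff]
    change ‖u t‖ ≤ ‖x₀‖ + 1
    linarith
  have h2 := hud t ht
  rw [hg] at h2
  simpa only [h1, one_smul] using h2

/-- The version of `exists_solution_of_dissipative` for an invariant subspace. -/
theorem exists_solution_of_dissipative_submodule {V : Type*} [NormedAddCommGroup V]
    [InnerProductSpace ℝ V] [FiniteDimensional ℝ V] (E : Submodule ℝ V) {f : V → V}
    (hf : ContDiff ℝ 1 f) (hE : ∀ x ∈ E, f x ∈ E) (hd : ∀ x ∈ E, inner ℝ x (f x) ≤ 0)
    {x₀ : V} (hx₀ : x₀ ∈ E) {T : ℝ} (hT : 0 ≤ T) :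
    ∃ u : ℝ → V, Continuous u ∧ u 0 = x₀ ∧ (∀ t, u t ∈ E) ∧
      ∀ t ∈ Ioo 0 T, HasDerivAt u (f (u t)) t := by
  have hP : ∀ x : E, (E.orthogonalProjectionOnto (f x) : V) = f x := fun x =>
    Submodule.starProjection_eq_self_iff.2 (hE x x.2)
  have hc : ContDiff ℝ 1 fun x : E => E.orthogonalProjectionOnto (f x) :=
    E.orthogonalProjectionOnto.contDiff.comp (hf.comp E.subtypeL.contDiff)
  obtain ⟨u, huc, hu0, hud⟩ := exists_solution_of_dissipative hc (fun x => by
    rw [Submodule.coe_inner, hP]; exact hd x x.2) ⟨x₀, hx₀⟩ hT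
  refine ⟨fun t => u t, continuous_subtype_val.comp huc, by simp only [hu0], fun t => (u t).2,
    fun t ht => ?_⟩
  have := E.subtypeL.hasFDerivAt.comp_hasDerivAt t (hud t ht)
  simpa only [Function.comp_def, Submodule.subtypeL_apply, hP] using this

end ODE

/-! ### Galerkin approximation -/

section Galerkin

variable (a : Fin 3 → ℝ) (F ν ν' : ℝ)

/-- The Fourier coefficients of `𝒬(u, u) - 𝔻 u`, as a function of those of `u`. -/
noncomputable def limOp (u : (Fin 3 → ℤ) → C4) (n : Fin 3 → ℤ) : C4 :=
  bilin a F u u n - limitDiffusion a F ν ν' u n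

/-- The Fourier coefficients of a field with frequencies in `S`. -/
noncomputable def extendZero (S : Finset (Fin 3 → ℤ)) (x : PiLp 2 fun _ : S => C4)
    (n : Fin 3 → ℤ) : C4 := if h : n ∈ S then x ⟨n, h⟩ else 0

variable (S : Finset (Fin 3 → ℤ))

lemma extendZero_of_notMem (x : PiLp 2 fun _ : S => C4) {n : Fin 3 → ℤ} (h : n ∉ S) :
    extendZero S x n = 0 := by simp [extendZero, h]

lemma extendZero_coe (x : PiLp 2 fun _ : S => C4) (n : S) :
    extendZero S x n = x n := by simp [extendZero]

lemma conjV_real_smul (c : ℝ) (z : C4) : conjV (c • z) = c • conjV z := by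
  apply C4_ext <;> simp

lemma fdot_add (n : Fin 3 → ℤ) (z w : C4) : fdot a n (z + w) = fdot a n z + fdot a n w := by
  simp [fdot_eq]; ring

lemma fdot_real_smul (n : Fin 3 → ℤ) (c : ℝ) (z : C4) : fdot a n (c • z) = c * fdot a n z := by
  simp [fdot_eq]; ring

/-- The real, divergence-free, mean-zero fields with frequencies in `S`. -/
noncomputable def galerkinSpace : Submodule ℝ (PiLp 2 fun _ : S => C4) where
  carrier := {x | (∀ n, extendZero S x (-n) = conjV (extendZero S x n)) ∧
    (∀ n, fdot a n (extendZero S x n) = 0) ∧ extendZero S x 0 = 0}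
  add_mem' := by
    intro x y hx hy
    have h : ∀ n, extendZero S (x + y) n = extendZero S x n + extendZero S y n := by
      intro n; unfold extendZero; split_ifs <;> simp
    refine ⟨fun n => ?_, fun n => ?_, ?_⟩
    · rw [h, h, hx.1, hy.1, conjV_add]
    · rw [h, fdot_add, hx.2.1, hy.2.1, add_zero]
    · rw [h, hx.2.2, hy.2.2, add_zero]
  zero_mem' := by
    have h : ∀ n, extendZero S 0 n = 0 := by
      intro n; unfold extendZero; split_ifs <;> simp
    refine ⟨fun n => ?_, fun n => ?_, ?_⟩
    · rw [h, h, conjV_zero]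
    · rw [h]; simp [fdot_eq]
    · rw [h]
  smul_mem' := by
    intro c x hx
    have h : ∀ n, extendZero S (c • x) n = c • extendZero S x n := by
      intro n; unfold extendZero; split_ifs <;> simp
    refine ⟨fun n => ?_, fun n => ?_, ?_⟩
    · rw [h, h, hx.1, conjV_real_smul]
    · rw [h, fdot_real_smul, hx.2.1, mul_zero]
    · rw [h, hx.2.2, smul_zero]

/-- The Galerkin truncation of the limit system. -/
noncomputable def galerkinField (x : PiLp 2 fun _ : S => C4) : PiLp 2 fun _ : S => C4 :=
  WithLp.toLp 2 fun n => -limOp a F ν ν' (extendZero S x) n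

/-- For a field with frequencies in `S` the series that defines `𝒬` is a finite sum. -/
lemma bilin_eq_sum {u : (Fin 3 → ℤ) → C4} (hS : ∀ n, n ∉ S → u n = 0) (n : Fin 3 → ℤ) :
    bilin a F u u n = ∑ k ∈ S, bilinTerm a F u u n k :=
  tsum_eq_sum fun k hk => bilinTerm_of_left_eq_zero a F n (hS k hk)

variable {S}

lemma conjV_bilin (hneg : ∀ n ∈ S, -n ∈ S) {u : (Fin 3 → ℤ) → C4}
    (hu : ∀ n, u (-n) = conjV (u n)) (hS : ∀ n, n ∉ S → u n = 0) (n : Fin 3 → ℤ) :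
    bilin a F u u (-n) = conjV (bilin a F u u n) := by
  rw [bilin_eq_sum a F S hS, bilin_eq_sum a F S hS, conjV_sum]
  refine Finset.sum_nbij' (fun k => -k) (fun k => -k) hneg hneg (by simp) (by simp) ?_
  intro k _
  rw [← conjV_bilinTerm a F hu, neg_neg]

lemma conjV_diffusion (n : Fin 3 → ℤ) (z : C4) :
    diffusion a ν ν' (-n) (conjV z) = conjV (diffusion a ν ν' n z) := by
  apply C4_ext <;> simp [diffusion]

lemma continuous_diffusion {X : Type*} [TopologicalSpace X] {g : X → C4} (hg : Continuous g)
    (n : Fin 3 → ℤ) : Continuous fun t => diffusion a ν ν' n (g t) := by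
  unfold diffusion
  refine (PiLp.continuous_toLp 2 _).comp (continuous_pi fun i => ?_)
  fin_cases i <;> simp <;> fun_prop

variable [ha : ∀ i, Fact (0 < a i)]

lemma conjV_limitDiffusion (hF : 0 < F) {u : (Fin 3 → ℤ) → C4}
    (hu : ∀ n, u (-n) = conjV (u n)) (n : Fin 3 → ℤ) :
    limitDiffusion a F ν ν' u (-n) = conjV (limitDiffusion a F ν ν' u n) := by
  rw [limitDiffusion_eq a F hF, limitDiffusion_eq a F hF, conjV_sum, ← sum_signType_neg]
  refine Finset.sum_congr rfl fun σ _ => ?_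
  rw [conjV_modePart, ← conjV_diffusion, conjV_modePart, hu]

lemma fdot_limOp (hF : 0 < F) {u : (Fin 3 → ℤ) → C4} (hS : ∀ n, n ∉ S → u n = 0)
    (n : Fin 3 → ℤ) : fdot a n (limOp a F ν ν' u n) = 0 := by
  have h : ∀ z w : C4, fdot a n (z - w) = fdot a n z - fdot a n w := by
    intro z w; simp [fdot_eq]; ring
  rw [limOp, h, bilin_eq_sum a F S hS, limitDiffusion_eq a F hF, fdot_sum, fdot_sum]
  simp [fdot_bilinTerm, fdot_modePart]

lemma limOp_zero_freq (hF : 0 < F) (u : (Fin 3 → ℤ) → C4) : limOp a F ν ν' u 0 = 0 := by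
  rw [limOp, bilin, limitDiffusion_eq a F hF]
  simp [bilinTerm_eq, triad_zero_out, modePart_zero_freq]

omit ha in
lemma inner_real_C4 (z w : C4) : inner ℝ z w = (inner ℂ z w).re := by
  simp [PiLp.inner_apply, Complex.inner, mul_comm]

lemma galerkinField_mem (hF : 0 < F) (hneg : ∀ n ∈ S, -n ∈ S) {x : PiLp 2 fun _ : S => C4}
    (hx : x ∈ galerkinSpace a S) : galerkinField a F ν ν' S x ∈ galerkinSpace a S := by
  have hS : ∀ n, n ∉ S → extendZero S x n = 0 := fun n hn => extendZero_of_notMem S x hn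
  have he : ∀ n, extendZero S (galerkinField a F ν ν' S x) n =
      if n ∈ S then -limOp a F ν ν' (extendZero S x) n else 0 := by
    intro n
    unfold extendZero galerkinField
    split_ifs <;> rfl
  have hneg' : ∀ n, -n ∈ S ↔ n ∈ S :=
    fun n => ⟨fun h => by simpa using hneg _ h, hneg n⟩
  refine ⟨fun n => ?_, fun n => ?_, ?_⟩
  · rw [he, he]
    simp only [hneg']
    split_ifs
    · rw [limOp, limOp, conjV_bilin a F hneg hx.1 hS, conjV_limitDiffusion a F ν ν' hF hx.1]
      apply C4_ext <;> simp
    · simp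
  · rw [he]
    split_ifs
    · have : ∀ z : C4, fdot a n (-z) = -fdot a n z := by intro z; simp [fdot_eq]; ring
      rw [this, fdot_limOp a F ν ν' hF hS, neg_zero]
    · simp [fdot_eq]
  · rw [he, limOp_zero_freq a F ν ν' hF]; simp

/-- The energy estimate of the truncated system. -/
lemma sum_re_inner_limOp_le (hF : 0 < F) {u : (Fin 3 → ℤ) → C4}
    (hu : ∀ n, u (-n) = conjV (u n)) (hdiv : ∀ n, fdot a n (u n) = 0) (h0 : u 0 = 0)
    (hS : ∀ n, n ∉ S → u n = 0) :
    ∑ n ∈ S, (inner ℂ (u n) (-limOp a F ν ν' u n)).re ≤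
      -(min ν ν' * ∑ n ∈ S, normHsq a n * ‖u n‖ ^ 2) := by
  have h1 := tsum_inner_bilin a F hu S hS
  rw [tsum_eq_sum (s := S) (fun n hn => by rw [hS n hn, inner_zero_left])] at h1
  have h2 : ∑ n ∈ S, (inner ℂ (u n) (bilin a F u u n)).re = 0 := by
    rw [← Complex.re_sum, h1, Complex.zero_re]
  have h3 : ∀ n ∈ S, (inner ℂ (u n) (-limOp a F ν ν' u n)).re ≤
      -(min ν ν' * (normHsq a n * ‖u n‖ ^ 2)) - (inner ℂ (u n) (bilin a F u u n)).re := by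
    intro n _
    rw [inner_neg_right, limOp, inner_sub_right, Complex.neg_re, Complex.sub_re]
    by_cases hn : n = 0
    · simp [hn, h0]
    have := re_inner_limitDiffusion_le a F hF ν ν' u hn (hdiv n)
    linarith
  refine (Finset.sum_le_sum h3).trans ?_
  rw [Finset.sum_sub_distrib, h2, sub_zero, Finset.sum_neg_distrib, ← Finset.mul_sum]

/-- The potential enstrophy estimate of the truncated system. The truncation does not spoil it, because
the multiplier is the truncated potential vorticity itself. -/
lemma sum_re_pv_limOp_le (hF : 0 < F) (hF1 : F ≠ 1) (hν : 0 ≤ ν) (hν' : 0 ≤ ν')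
    {u : (Fin 3 → ℤ) → C4} (hu : ∀ n, u (-n) = conjV (u n)) (hS : ∀ n, n ∉ S → u n = 0) :
    ∑ n ∈ S, (conj (pv a F n (u n)) * pv a F n (-limOp a F ν ν' u n)).re ≤ 0 := by
  have h1 := tsum_pv_bilin a F hF hF1 hu S hS
  rw [tsum_eq_sum (s := S) (fun n hn => by simp [hS n hn, pv])] at h1
  have h2 : ∑ n ∈ S, (conj (pv a F n (u n)) * pv a F n (bilin a F u u n)).re = 0 := by
    rw [← Complex.re_sum, h1, Complex.zero_re]
  have h3 : ∀ n ∈ S, (conj (pv a F n (u n)) * pv a F n (-limOp a F ν ν' u n)).re ≤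
      -(conj (pv a F n (u n)) * pv a F n (bilin a F u u n)).re := by
    intro n _
    have := re_pv_limitDiffusion_le a F hF hν hν' u n
    have hp : ∀ z w : C4, pv a F n (z - w) = pv a F n z - pv a F n w := fun z w => by
      simp [pv]
    rw [limOp, neg_sub, hp, mul_sub, Complex.sub_re]
    linarith
  refine (Finset.sum_le_sum h3).trans ?_
  rw [Finset.sum_neg_distrib, h2, neg_zero]

lemma contDiff_galerkinField (hF : 0 < F) : ContDiff ℝ 1 (galerkinField a F ν ν' S) := by
  have he : ∀ n, ContDiff ℝ 1 fun x : PiLp 2 fun _ : S => C4 => extendZero S x n := by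
    intro n
    unfold extendZero
    split_ifs with h
    · exact (PiLp.proj (𝕜 := ℝ) 2 (fun _ : S => C4) ⟨n, h⟩).contDiff
    · exact contDiff_const
  have hm : ∀ {g : (PiLp 2 fun _ : S => C4) → C4}, ContDiff ℝ 1 g → ∀ σ n,
      ContDiff ℝ 1 fun x => modePart a F σ n (g x) := by
    intro g hg σ n
    unfold modePart
    exact (contDiff_const.inner ℂ hg).smul contDiff_const
  have hf : ∀ {g : (PiLp 2 fun _ : S => C4) → C4}, ContDiff ℝ 1 g → ∀ i,
      ContDiff ℝ 1 fun x => g x i := by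
    intro g hg i
    exact ((EuclideanSpace.proj (𝕜 := ℂ) i).restrictScalars ℝ).contDiff.comp hg
  unfold galerkinField
  refine (PiLp.contDiff_toLp (𝕜 := ℝ)).comp (contDiff_pi.2 fun n => ContDiff.neg ?_)
  unfold limOp
  refine ContDiff.sub ?_ ?_
  · have hb : ∀ x : PiLp 2 fun _ : S => C4, bilin a F (extendZero S x) (extendZero S x) n =
        ∑ k ∈ S, bilinTerm a F (extendZero S x) (extendZero S x) n k := fun x =>
      bilin_eq_sum a F S (fun n hn => extendZero_of_notMem S x hn) n
    simp only [hb, bilinTerm_eq]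
    refine ContDiff.sum fun k _ => ContDiff.sum fun σ _ => ContDiff.sum fun τ _ =>
      ContDiff.sum fun ρ _ => ?_
    unfold triad
    split_ifs
    · have hd : ContDiff ℝ 1 fun x : PiLp 2 fun _ : S => C4 =>
          fdot a n (modePart a F σ k (extendZero S x k)) := by
        unfold fdot
        exact ContDiff.sum fun j _ => contDiff_const.mul (hf (hm (he _) _ _) _)
      exact (contDiff_const.mul hd).smul (hm (hm (he _) _ _) _ _)
    · exact contDiff_const
  · simp only [limitDiffusion_eq a F hF]
    refine ContDiff.sum fun σ _ => hm ?_ _ _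
    unfold diffusion
    refine (PiLp.contDiff_toLp (𝕜 := ℝ)).comp (contDiff_pi.2 fun i => ?_)
    have h := fun i => hf (hm (he n) σ n) i
    fin_cases i <;> simp <;> exact (contDiff_const.mul (h _)).neg

/-- Galerkin approximations of the limit system on a bounded time interval, with their energy and
potential enstrophy estimates. -/
theorem exists_galerkin (hF : 0 < F) (hF1 : F ≠ 1) (hν : 0 ≤ ν) (hν' : 0 ≤ ν')
    (hneg : ∀ n ∈ S, -n ∈ S) {v : (Fin 3 → ℤ) → C4}
    (hv : ∀ n, v (-n) = conjV (v n)) (hdiv : ∀ n, fdot a n (v n) = 0) (h0 : v 0 = 0)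
    {T : ℝ} (hT : 0 ≤ T) :
    ∃ u : ℝ → (Fin 3 → ℤ) → C4, (∀ n, Continuous fun t => u t n) ∧
      (∀ t n, u t (-n) = conjV (u t n)) ∧ (∀ t n, fdot a n (u t n) = 0) ∧ (∀ t, u t 0 = 0) ∧
      (∀ t, ∀ n ∉ S, u t n = 0) ∧ (∀ n ∈ S, u 0 n = v n) ∧
      (∀ n ∈ S, ∀ t ∈ Ioo 0 T,
        HasDerivAt (fun t => u t n) (-limOp a F ν ν' (u t) n) t) ∧
      (∀ t ∈ Icc 0 T, ∑ n ∈ S, ‖u t n‖ ^ 2 +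
        2 * min ν ν' * ∫ s in (0 : ℝ)..t, ∑ n ∈ S, normHsq a n * ‖u s n‖ ^ 2 ≤
          ∑ n ∈ S, ‖v n‖ ^ 2) ∧
      ∀ t ∈ Icc 0 T, ∑ n ∈ S, ‖pv a F n (u t n)‖ ^ 2 ≤ ∑ n ∈ S, ‖pv a F n (v n)‖ ^ 2 := by
  set x₀ : PiLp 2 fun _ : S => C4 := WithLp.toLp 2 fun n => v n with hx₀
  have hx₀e : ∀ n, extendZero S x₀ n = if n ∈ S then v n else 0 := by
    intro n; unfold extendZero; split_ifs <;> rfl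
  have hneg' : ∀ n, -n ∈ S ↔ n ∈ S :=
    fun n => ⟨fun h => by simpa using hneg _ h, hneg n⟩
  have hmem : x₀ ∈ galerkinSpace a S := by
    refine ⟨fun n => ?_, fun n => ?_, ?_⟩
    · rw [hx₀e, hx₀e]; simp only [hneg']; split_ifs
      · exact hv n
      · simp
    · rw [hx₀e]; split_ifs
      · exact hdiv n
      · simp [fdot_eq]
    · rw [hx₀e]; split_ifs
      · exact h0
      · rfl
  have hdis : ∀ x ∈ galerkinSpace a S, inner ℝ x (galerkinField a F ν ν' S x) ≤ 0 := by
    intro x hx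
    have h1 := sum_re_inner_limOp_le a F ν ν' hF hx.1 hx.2.1 hx.2.2
      (fun n hn => extendZero_of_notMem S x hn)
    have h2 : 0 ≤ min ν ν' * ∑ n ∈ S, normHsq a n * ‖extendZero S x n‖ ^ 2 :=
      mul_nonneg (le_min hν hν') (Finset.sum_nonneg fun n _ =>
        mul_nonneg (normHsq_nonneg a n) (sq_nonneg _))
    have h3 : inner ℝ x (galerkinField a F ν ν' S x) =
        ∑ n ∈ S, (inner ℂ (extendZero S x n) (-limOp a F ν ν' (extendZero S x) n)).re := by
      rw [PiLp.inner_apply, ← Finset.sum_coe_sort S]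
      refine Finset.sum_congr rfl fun n _ => ?_
      rw [inner_real_C4, extendZero_coe]
      rfl
    linarith
  obtain ⟨w, hwc, hw0, hwE, hwd⟩ := exists_solution_of_dissipative_submodule (galerkinSpace a S)
    (contDiff_galerkinField a F ν ν' (S := S) hF) (fun x hx => galerkinField_mem a F ν ν' hF hneg hx)
    hdis hmem hT
  set u : ℝ → (Fin 3 → ℤ) → C4 := fun t => extendZero S (w t) with hu
  have huS : ∀ t, ∀ n ∉ S, u t n = 0 := fun t n hn => extendZero_of_notMem S _ hn
  have huc : ∀ n, Continuous fun t => u t n := by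
    intro n
    simp only [hu]
    unfold extendZero
    split_ifs with h
    · exact (PiLp.proj (𝕜 := ℝ) 2 (fun _ : S => C4) ⟨n, h⟩).continuous.comp hwc
    · exact continuous_const
  have hu0 : ∀ n ∈ S, u 0 n = v n := by
    intro n hn
    simp only [hu]
    rw [hw0, hx₀e, if_pos hn]
  have hud : ∀ n ∈ S, ∀ t ∈ Ioo 0 T,
      HasDerivAt (fun t => u t n) (-limOp a F ν ν' (u t) n) t := by
    intro n hn t ht
    have h1 := (PiLp.proj (𝕜 := ℝ) 2 (fun _ : S => C4) ⟨n, hn⟩).hasFDerivAt.comp_hasDerivAt t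
      (hwd t ht)
    have h2 : (fun t => u t n) = fun t => w t ⟨n, hn⟩ := by
      funext t; simp [hu, extendZero, hn]
    rw [h2]
    exact h1
  refine ⟨u, huc, fun t => (hwE t).1, fun t => (hwE t).2.1, fun t => (hwE t).2.2, huS, hu0, hud,
    fun t ht => ?_, fun t ht => ?_⟩
  · have hHc : Continuous fun s => ∑ n ∈ S, normHsq a n * ‖u s n‖ ^ 2 := by
      refine continuous_finsetSum _ fun n _ => ?_
      have := huc n
      fun_prop
    have h1 := le_of_hasDerivAt_nonpos
      (φ := fun t => ∑ n ∈ S, ‖u t n‖ ^ 2 +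
        2 * min ν ν' * ∫ s in (0 : ℝ)..t, ∑ n ∈ S, normHsq a n * ‖u s n‖ ^ 2)
      (φ' := fun t => ∑ n ∈ S, 2 * (inner ℂ (u t n) (-limOp a F ν ν' (u t) n)).re +
        2 * min ν ν' * ∑ n ∈ S, normHsq a n * ‖u t n‖ ^ 2) (T := T) ?_ ?_ ?_ ht
    · simp only [intervalIntegral.integral_same, mul_zero, add_zero] at h1
      refine h1.trans_eq (Finset.sum_congr rfl fun n hn => by rw [hu0 n hn])
    · refine Continuous.add (continuous_finsetSum _ fun n _ => ?_) ?_
      · have := huc n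
        fun_prop
      · exact continuous_const.mul
          (intervalIntegral.continuous_primitive (fun a b => hHc.intervalIntegrable a b) 0)
    · intro s hs
      refine HasDerivAt.add (HasDerivAt.fun_sum fun n hn => ?_) ?_
      · have h2 := (hud n hn s hs).norm_sq
        rwa [inner_real_C4] at h2
      · exact (intervalIntegral.integral_hasDerivAt_right (hHc.intervalIntegrable _ _)
          (hHc.stronglyMeasurableAtFilter _ _) hHc.continuousAt).const_mul _
    · intro s _
      have h2 := sum_re_inner_limOp_le a F ν ν' hF (hwE s).1 (hwE s).2.1 (hwE s).2.2 (huS s)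
      rw [← Finset.mul_sum]
      linarith
  · have hpc : ∀ n, Continuous fun z : C4 => pv a F n z := fun n => by
      unfold pv; fun_prop
    have h1 := le_of_hasDerivAt_nonpos
      (φ := fun t => ∑ n ∈ S, ‖pv a F n (u t n)‖ ^ 2)
      (φ' := fun t => ∑ n ∈ S,
        2 * (conj (pv a F n (u t n)) * pv a F n (-limOp a F ν ν' (u t) n)).re) (T := T) ?_ ?_ ?_ ht
    · exact h1.trans_eq (Finset.sum_congr rfl fun n hn => by rw [hu0 n hn])
    · refine continuous_finsetSum _ fun n _ => ?_
      have := (hpc n).comp (huc n)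
      simp only [Function.comp_def] at this
      fun_prop
    · intro s hs
      refine HasDerivAt.fun_sum fun n hn => ?_
      have h2 : HasDerivAt (fun t => pv a F n (u t n)) (pv a F n (-limOp a F ν ν' (u s) n)) s := by
        unfold pv
        have := (hasDerivAt_const s (rawVec a F 0 n)).inner ℂ (hud n hn s hs)
        simpa only [inner_zero_left, add_zero] using this
      have h3 := h2.norm_sq
      rwa [Complex.inner, mul_comm (pv a F n _)] at h3
    · intro s _
      have h2 := sum_re_pv_limOp_le a F ν ν' hF hF1 hν hν' (hwE s).1 (huS s)
      rw [← Finset.mul_sum]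
      linarith

end Galerkin

/-! ### Compactness of equi-Lipschitz curves -/

section Compactness

/-- A bounded sequence of curves with equi-Lipschitz components has a subsequence that converges
pointwise. -/
theorem exists_subseq_tendsto_of_lipschitz {ι E : Type*} [Countable ι] [NormedAddCommGroup E]
    [ProperSpace E] {f : ℕ → ℝ → ι → E} {R : ℝ} (hb : ∀ N t i, ‖f N t i‖ ≤ R) {L : ι → ℝ}
    (hL : ∀ i, ∀ᶠ N in atTop, ∀ s t, ‖f N t i - f N s i‖ ≤ L i * |t - s|) :
    ∃ φ : ℕ → ℕ, StrictMono φ ∧ ∃ u : ℝ → ι → E,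
      (∀ t i, Tendsto (fun j => f (φ j) t i) atTop (𝓝 (u t i))) ∧
      ∀ i s t, ‖u t i - u s i‖ ≤ L i * |t - s| := by
  have hK : IsCompact (Set.univ.pi fun _ : ι × ℚ => Metric.closedBall (0 : E) R) :=
    isCompact_univ_pi fun _ => isCompact_closedBall 0 R
  obtain ⟨x, -, φ, hφ, hx⟩ := hK.tendsto_subseq (x := fun N (p : ι × ℚ) => f N p.2 p.1)
    (fun N p _ => by simpa using hb N p.2 p.1)
  have hx' : ∀ i (q : ℚ), Tendsto (fun j => f (φ j) q i) atTop (𝓝 (x (i, q))) :=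
    fun i q => (tendsto_pi_nhds.1 hx) (i, q)
  have hL' : ∀ i, ∀ᶠ j in atTop, ∀ s t, ‖f (φ j) t i - f (φ j) s i‖ ≤ L i * |t - s| :=
    fun i => hφ.tendsto_atTop.eventually (hL i)
  have hcauchy : ∀ t i, CauchySeq fun j => f (φ j) t i := by
    intro t i
    rw [Metric.cauchySeq_iff']
    intro ε hε
    have hη : 0 < ε / (4 * (|L i| + 1)) := by positivity
    obtain ⟨q, hq1, hq2⟩ := exists_rat_btwn (lt_add_of_pos_right t hη)
    have hq : L i * |t - q| ≤ ε / 4 := by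
      have h1 : |t - q| ≤ ε / (4 * (|L i| + 1)) := by
        rw [abs_sub_comm, abs_of_pos (by linarith)]; linarith
      calc L i * |t - q| ≤ (|L i| + 1) * (ε / (4 * (|L i| + 1))) := by
            gcongr
            linarith [le_abs_self (L i)]
        _ = ε / 4 := by field_simp
    obtain ⟨N₁, hN₁⟩ := Metric.cauchySeq_iff'.1 (hx' i q).cauchySeq (ε / 8) (by positivity)
    obtain ⟨N₂, hN₂⟩ := eventually_atTop.1 (hL' i)
    refine ⟨max N₁ N₂, fun j hj => ?_⟩
    have h1 := hN₂ j ((le_max_right _ _).trans hj) q t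
    have h2 := hN₂ (max N₁ N₂) (le_max_right _ _) q t
    have h3 := hN₁ j ((le_max_left _ _).trans hj)
    have h4 := hN₁ (max N₁ N₂) (le_max_left _ _)
    rw [dist_eq_norm] at h3 h4 ⊢
    have e : f (φ j) t i - f (φ (max N₁ N₂)) t i =
        (f (φ j) t i - f (φ j) q i) - (f (φ (max N₁ N₂)) t i - f (φ (max N₁ N₂)) q i) +
          ((f (φ j) q i - f (φ N₁) q i) - (f (φ (max N₁ N₂)) q i - f (φ N₁) q i)) := by abel
    rw [e]
    refine (norm_add_le _ _).trans_lt ?_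
    have h5 := norm_sub_le (f (φ j) t i - f (φ j) q i)
      (f (φ (max N₁ N₂)) t i - f (φ (max N₁ N₂)) q i)
    have h6 := norm_sub_le (f (φ j) q i - f (φ N₁) q i) (f (φ (max N₁ N₂)) q i - f (φ N₁) q i)
    linarith
  choose u hu using fun t i => cauchySeq_tendsto_of_complete (hcauchy t i)
  refine ⟨φ, hφ, u, hu, fun i s t => ?_⟩
  exact le_of_tendsto ((hu t i).sub (hu s i)).norm ((hL' i).mono fun j hj => hj s t)

end Compactness

/-! ### Uniform convergence of the truncated interactions -/

section Paths

variable (a : Fin 3 → ℝ) (F ν ν' : ℝ)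

/-- The a priori bounds on `[0, T]` of the approximations: continuous modes, energy at most `E₀`,
potential enstrophy at most `W₀`, and the horizontal dissipation `c ∫ ∑ |ňₕ|² |w|²` at most `E₀`. -/
structure IsBoundedPath (c E₀ W₀ T : ℝ) (w : ℝ → (Fin 3 → ℤ) → C4) : Prop where
  cont : ∀ n, Continuous fun t => w t n
  energy : ∀ t ∈ Icc 0 T, ∀ K : Finset (Fin 3 → ℤ), ∑ n ∈ K, ‖w t n‖ ^ 2 ≤ E₀
  enstrophy : ∀ t ∈ Icc 0 T, ∀ K : Finset (Fin 3 → ℤ), ∑ n ∈ K, ‖pv a F n (w t n)‖ ^ 2 ≤ W₀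
  dissipation : ∀ K : Finset (Fin 3 → ℤ),
    c * ∫ t in (0 : ℝ)..T, ∑ n ∈ K, normHsq a n * ‖w t n‖ ^ 2 ≤ E₀

lemma norm_diffusion_le (hν : 0 ≤ ν) (hν' : 0 ≤ ν') (n : Fin 3 → ℤ) (z : C4) :
    ‖diffusion a ν ν' n z‖ ≤ (ν + ν') * normHsq a n * ‖z‖ := by
  have hh := normHsq_nonneg a n
  refine le_of_sq_le_sq ?_ (by positivity)
  rw [EuclideanSpace.norm_sq_eq, mul_pow, EuclideanSpace.norm_sq_eq, Fin.sum_univ_four,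
    Fin.sum_univ_four]
  have h : ∀ (μ : ℝ) (x : ℂ), 0 ≤ μ → μ ≤ ν + ν' →
      ‖(μ : ℂ) * -(normHsq a n : ℂ) * x‖ ^ 2 ≤ ((ν + ν') * normHsq a n) ^ 2 * ‖x‖ ^ 2 := by
    intro μ x h0 h1
    rw [norm_mul, norm_mul, norm_neg, Complex.norm_real, Complex.norm_real, Real.norm_of_nonneg h0,
      Real.norm_of_nonneg hh, ← mul_pow]
    gcongr
  have h1 := h ν (z 0) hν (by linarith)
  have h2 := h ν (z 1) hν (by linarith)
  have h3 := h ν (z 2) hν (by linarith)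
  have h4 := h ν' (z 3) hν' (by linarith)
  change ‖(ν : ℂ) * -(normHsq a n : ℂ) * z 0‖ ^ 2 + ‖(ν : ℂ) * -(normHsq a n : ℂ) * z 1‖ ^ 2 +
    ‖(ν : ℂ) * -(normHsq a n : ℂ) * z 2‖ ^ 2 + ‖(ν' : ℂ) * -(normHsq a n : ℂ) * z 3‖ ^ 2 ≤ _
  linarith

lemma continuous_modePart {X : Type*} [TopologicalSpace X] {g : X → C4} (hg : Continuous g)
    (σ : SignType) (n : Fin 3 → ℤ) : Continuous fun t => modePart a F σ n (g t) := by
  unfold modePart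
  fun_prop

variable [ha : ∀ i, Fact (0 < a i)]

lemma norm_limitDiffusion_le (hF : 0 < F) (hν : 0 ≤ ν) (hν' : 0 ≤ ν') (u : (Fin 3 → ℤ) → C4)
    (n : Fin 3 → ℤ) :
    ‖limitDiffusion a F ν ν' u n‖ ≤ 3 * (ν + ν') * normHsq a n * ‖u n‖ := by
  have h3 : Fintype.card SignType = 3 := rfl
  have hh := normHsq_nonneg a n
  rw [limitDiffusion_eq a F hF]
  calc _ ≤ ∑ σ : SignType, (ν + ν') * normHsq a n * ‖u n‖ := by
        refine norm_sum_le_of_le _ fun σ _ => (norm_modePart_le a F hF _ _ _).trans ?_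
        refine (norm_diffusion_le a ν ν' hν hν' n _).trans ?_
        gcongr
        exact norm_modePart_le a F hF _ _ _
    _ = _ := by simp [h3]; ring

lemma continuous_limitDiffusion (hF : 0 < F) {X : Type*} [TopologicalSpace X]
    {u : X → (Fin 3 → ℤ) → C4} {n : Fin 3 → ℤ} (hu : Continuous fun t => u t n) :
    Continuous fun t => limitDiffusion a F ν ν' (u t) n := by
  simp only [limitDiffusion_eq a F hF]
  exact continuous_finsetSum _ fun σ _ => continuous_modePart a F
    (continuous_diffusion a ν ν' (continuous_modePart a F hu σ n) n) σ n

/-- The bound of the time derivative of the mode `n` of a solution of energy `E₀`. -/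
noncomputable def rateBound (E₀ : ℝ) (n : Fin 3 → ℤ) : ℝ :=
  27 * √(normSq a n) * E₀ + 3 * (ν + ν') * normHsq a n * √E₀

omit ha in
lemma summable_of_energy {w : (Fin 3 → ℤ) → C4} {E₀ : ℝ}
    (h : ∀ K : Finset (Fin 3 → ℤ), ∑ n ∈ K, ‖w n‖ ^ 2 ≤ E₀) : Summable fun n => ‖w n‖ ^ 2 :=
  summable_of_sum_le (fun _ => sq_nonneg _) h

omit ha in
lemma norm_le_of_energy {w : (Fin 3 → ℤ) → C4} {E₀ : ℝ}
    (h : ∀ K : Finset (Fin 3 → ℤ), ∑ n ∈ K, ‖w n‖ ^ 2 ≤ E₀) (n : Fin 3 → ℤ) : ‖w n‖ ≤ √E₀ := by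
  refine Real.le_sqrt_of_sq_le ?_
  simpa using h {n}

/-- The modes of a field of bounded energy move at a rate that depends on the mode only. -/
lemma norm_limOp_le (hF : 0 < F) (hν : 0 ≤ ν) (hν' : 0 ≤ ν') {w : (Fin 3 → ℤ) → C4} {E₀ : ℝ}
    (h : ∀ K : Finset (Fin 3 → ℤ), ∑ n ∈ K, ‖w n‖ ^ 2 ≤ E₀) (n : Fin 3 → ℤ) :
    ‖limOp a F ν ν' w n‖ ≤ rateBound a ν ν' E₀ n := by
  have h1 := norm_bilin_le a F hF (summable_of_energy h) n
  have h2 := norm_limitDiffusion_le a F ν ν' hF hν hν' w n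
  have h3 : ∑' n, ‖w n‖ ^ 2 ≤ E₀ := (summable_of_energy h).tsum_le_of_sum_le h
  have h4 := norm_le_of_energy h n
  have h5 := normHsq_nonneg a n
  refine (norm_sub_le _ _).trans (add_le_add (h1.trans ?_) (h2.trans ?_))
  · gcongr
  · gcongr

/-- The truncation of `limOp` to finitely many interactions. -/
noncomputable def truncOp (K : Finset (Fin 3 → ℤ)) (u : (Fin 3 → ℤ) → C4) (n : Fin 3 → ℤ) : C4 :=
  ∑ k ∈ K, redTerm a F u n k - limitDiffusion a F ν ν' u n

lemma continuous_truncOp (hF : 0 < F) (K : Finset (Fin 3 → ℤ)) {X : Type*} [TopologicalSpace X]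
    {u : X → (Fin 3 → ℤ) → C4} (hu : ∀ n, Continuous fun t => u t n) (n : Fin 3 → ℤ) :
    Continuous fun t => truncOp a F ν ν' K (u t) n :=
  (continuous_finsetSum _ fun k _ => continuous_redTerm a F hu n k).sub
    (continuous_limitDiffusion a F ν ν' hF (hu n))

lemma norm_truncOp_le (hF : 0 < F) (hν : 0 ≤ ν) (hν' : 0 ≤ ν') (K : Finset (Fin 3 → ℤ))
    {w : (Fin 3 → ℤ) → C4} {E₀ : ℝ}
    (h : ∀ K : Finset (Fin 3 → ℤ), ∑ n ∈ K, ‖w n‖ ^ 2 ≤ E₀) (n : Fin 3 → ℤ) :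
    ‖truncOp a F ν ν' K w n‖ ≤ rateBound a ν ν' E₀ n := by
  have hs := summable_of_energy h
  have h2 := norm_limitDiffusion_le a F ν ν' hF hν hν' w n
  have h3 : ∑' n, ‖w n‖ ^ 2 ≤ E₀ := hs.tsum_le_of_sum_le h
  have h4 := norm_le_of_energy h n
  have h5 := normHsq_nonneg a n
  refine (norm_sub_le _ _).trans (add_le_add ?_ (h2.trans ?_))
  · calc _ ≤ ∑ k ∈ K, 27 * √(normSq a n) * (‖w k‖ * ‖w (n - k)‖) :=
          norm_sum_le_of_le _ fun k _ => norm_redTerm_le a F hF w n k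
      _ = 27 * √(normSq a n) * ∑ k ∈ K, ‖w k‖ * ‖w (n - k)‖ := by rw [Finset.mul_sum]
      _ ≤ 27 * √(normSq a n) * E₀ := by
          refine mul_le_mul_of_nonneg_left ?_ (by positivity)
          refine ((summable_norm_mul_norm_sub hs n).sum_le_tsum K fun k _ => by positivity).trans ?_
          exact (tsum_norm_mul_norm_sub_le hs n).trans h3
  · gcongr

/-- The limit of the truncations is `limOp`, although they omit the production of slow modes by
oscillating ones: that production has sum zero. -/
lemma tendsto_truncOp (hF : 0 < F) (hF1 : F ≠ 1) {w : (Fin 3 → ℤ) → C4}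
    (hs : Summable fun n => ‖w n‖ ^ 2) (n : Fin 3 → ℤ) :
    Tendsto (fun K => truncOp a F ν ν' K w n) atTop (𝓝 (limOp a F ν ν' w n)) := by
  have h := (summable_norm_redTerm a F hF hs n).of_norm.hasSum
  rw [tsum_redTerm a F hF hF1 hs] at h
  exact h.sub_const _

/-- The truncations of `limOp` converge, in the mean in time, uniformly over bounded paths. -/
lemma exists_norm_integral_limOp_sub_le (hF : 0 < F) (hF1 : F ≠ 1) (hν : 0 < ν) (hν' : 0 < ν')
    {c E₀ W₀ T : ℝ} (hc : 0 < c) (hT : 0 ≤ T) (hE : 0 ≤ E₀) (hW : 0 ≤ W₀) {χ : ℝ → C4}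
    (hχ : Continuous χ) (n : Fin 3 → ℤ) {ε : ℝ} (hε : 0 < ε) :
    ∃ K : Finset (Fin 3 → ℤ), ∀ w, IsBoundedPath a F c E₀ W₀ T w →
      ‖(∫ t in (0 : ℝ)..T, inner ℂ (χ t) (limOp a F ν ν' (w t) n)) -
        ∫ t in (0 : ℝ)..T, inner ℂ (χ t) (truncOp a F ν ν' K (w t) n)‖ ≤ ε := by
  classical
  obtain ⟨M, hM⟩ := (isCompact_Icc (a := (0 : ℝ)) (b := T)).exists_bound_of_continuousOn
    hχ.continuousOn
  have hM0 : 0 ≤ M := (norm_nonneg _).trans (hM 0 (left_mem_Icc.2 hT))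
  set B : ℝ := E₀ / c + T * (3 * E₀ + 2 * W₀) with hB
  have hB0 : 0 ≤ B := by positivity
  set Q : ℝ := M * (27 * √(normSq a n)) * B with hQ
  have hQ0 : 0 ≤ Q := by positivity
  set δ : ℝ := ε / (Q + 1) with hδ
  have hδ0 : 0 < δ := by positivity
  have hδQ : Q * δ ≤ ε := by
    rw [hδ, mul_div_assoc', div_le_iff₀ (by positivity)]
    nlinarith
  obtain ⟨K₀, hK₀⟩ := exists_norm_redTerm_le a F hF n hδ0
  refine ⟨K₀, fun w hw => ?_⟩
  have huIoc : uIoc 0 T ⊆ Icc 0 T := by rw [uIoc_of_le hT]; exact Ioc_subset_Icc_self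
  have hcont : ∀ K, Continuous fun t => inner ℂ (χ t) (truncOp a F ν ν' K (w t) n) := fun K =>
    hχ.inner (continuous_truncOp a F ν ν' hF K hw.cont n)
  have hlim : Tendsto (fun K => ∫ t in (0 : ℝ)..T, inner ℂ (χ t) (truncOp a F ν ν' K (w t) n)) atTop
      (𝓝 (∫ t in (0 : ℝ)..T, inner ℂ (χ t) (limOp a F ν ν' (w t) n))) := by
    refine intervalIntegral.tendsto_integral_filter_of_dominated_convergence
      (fun _ => M * rateBound a ν ν' E₀ n) ?_ ?_ ?_ ?_
    · exact Eventually.of_forall fun K => (hcont K).aestronglyMeasurable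
    · refine Eventually.of_forall fun K => Eventually.of_forall fun t ht => ?_
      refine (norm_inner_le_norm _ _).trans ?_
      gcongr
      · exact hM t (huIoc ht)
      · exact norm_truncOp_le a F ν ν' hF hν.le hν'.le K (hw.energy t (huIoc ht)) n
    · exact intervalIntegrable_const
    · refine Eventually.of_forall fun t ht => ?_
      exact tendsto_const_nhds.inner
        (tendsto_truncOp a F ν ν' hF hF1 (summable_of_energy (hw.energy t (huIoc ht))) n)
  refine le_of_tendsto (hlim.sub_const _).norm ?_
  filter_upwards [eventually_ge_atTop K₀] with K hK
  rw [← intervalIntegral.integral_sub ((hcont K).intervalIntegrable _ _)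
    ((hcont K₀).intervalIntegrable _ _)]
  have hpc : ∀ n, Continuous fun z : C4 => pv a F n z := fun n => by
    unfold pv; fun_prop
  have hHc : Continuous fun t => ∑ k ∈ K \ K₀, normHsq a k * ‖w t k‖ ^ 2 := by
    refine continuous_finsetSum _ fun k _ => ?_
    have := hw.cont k
    fun_prop
  calc _ ≤ ∫ t in (0 : ℝ)..T, M * (27 * √(normSq a n) * δ *
        ((∑ k ∈ K \ K₀, normHsq a k * ‖w t k‖ ^ 2) + (3 * E₀ + 2 * W₀))) := by
        refine intervalIntegral.norm_integral_le_of_norm_le hT ?_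
          ((continuous_const.mul (continuous_const.mul
            (hHc.add continuous_const))).intervalIntegrable _ _)
        refine Eventually.of_forall fun t ht => ?_
        have htT : t ∈ Icc 0 T := Ioc_subset_Icc_self ht
        have e : truncOp a F ν ν' K (w t) n - truncOp a F ν ν' K₀ (w t) n =
            ∑ k ∈ K \ K₀, redTerm a F (w t) n k := by
          rw [truncOp, truncOp, sub_sub_sub_cancel_right, ← Finset.sum_sdiff hK,
            add_sub_cancel_right]
        rw [← inner_sub_right, e]
        refine (norm_inner_le_norm _ _).trans ?_
        refine mul_le_mul (hM t htT) ?_ (norm_nonneg _) hM0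
        have himg : ∀ g : (Fin 3 → ℤ) → ℝ, ∑ k ∈ K \ K₀, g (n - k) =
            ∑ m ∈ (K \ K₀).image (fun k => n - k), g m := by
          intro g
          rw [Finset.sum_image]
          intro x _ y _ h
          exact sub_right_injective h
        calc _ ≤ ∑ k ∈ K \ K₀, 27 * √(normSq a n) * δ * tailDensity a F (w t) n k :=
              norm_sum_le_of_le _ fun k hk => hK₀ k (Finset.mem_sdiff.1 hk).2 (w t)
          _ = 27 * √(normSq a n) * δ * ∑ k ∈ K \ K₀, tailDensity a F (w t) n k := by
              rw [Finset.mul_sum]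
          _ ≤ _ := by
              refine mul_le_mul_of_nonneg_left ?_ (by positivity)
              simp only [tailDensity, Finset.sum_add_distrib, ← Finset.mul_sum]
              have h1 := hw.energy t htT (K \ K₀)
              have h2 := hw.enstrophy t htT (K \ K₀)
              have h3 := hw.energy t htT ((K \ K₀).image fun k => n - k)
              have h4 := hw.enstrophy t htT ((K \ K₀).image fun k => n - k)
              rw [← himg (fun m => ‖w t m‖ ^ 2)] at h3
              rw [← himg (fun m => ‖pv a F m (w t m)‖ ^ 2)] at h4
              linarith
    _ = M * (27 * √(normSq a n) * δ * ((∫ t in (0 : ℝ)..T,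
          ∑ k ∈ K \ K₀, normHsq a k * ‖w t k‖ ^ 2) + T * (3 * E₀ + 2 * W₀))) := by
        rw [intervalIntegral.integral_const_mul, intervalIntegral.integral_const_mul,
          intervalIntegral.integral_add (hHc.intervalIntegrable _ _) intervalIntegrable_const,
          intervalIntegral.integral_const, sub_zero, smul_eq_mul]
    _ ≤ M * (27 * √(normSq a n) * δ * B) := by
        have h1 : ∫ t in (0 : ℝ)..T, ∑ k ∈ K \ K₀, normHsq a k * ‖w t k‖ ^ 2 ≤ E₀ / c := by
          rw [le_div_iff₀ hc, mul_comm]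
          exact hw.dissipation (K \ K₀)
        rw [hB]
        gcongr
    _ = Q * δ := by rw [hQ]; ring
    _ ≤ ε := hδQ

end Paths

/-! ### Global solutions in Fourier variables -/

section Existence

variable (a : Fin 3 → ℝ) (F ν ν' : ℝ) [ha : ∀ i, Fact (0 < a i)]

/-- Existence of a global weak solution in Fourier variables. -/
theorem exists_fourier_solution (hF : 0 < F) (hF1 : F ≠ 1) (hν : 0 < ν) (hν' : 0 < ν')
    {v : (Fin 3 → ℤ) → C4} (hv : ∀ n, v (-n) = conjV (v n)) (hdiv : ∀ n, fdot a n (v n) = 0)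
    (h0 : v 0 = 0) (hsv : Summable fun n => ‖v n‖ ^ 2)
    (hsp : Summable fun n => ‖pv a F n (v n)‖ ^ 2) :
    ∃ u : ℝ → (Fin 3 → ℤ) → C4, (∀ n, Continuous fun t => u t n) ∧
      (∀ t n, u t (-n) = conjV (u t n)) ∧ (∀ t n, fdot a n (u t n) = 0) ∧ (∀ t, u t 0 = 0) ∧
      (∀ t, ∀ K : Finset (Fin 3 → ℤ), ∑ n ∈ K, ‖u t n‖ ^ 2 ≤ ∑' n, ‖v n‖ ^ 2) ∧
      (∀ t, 0 ≤ t → ∀ K : Finset (Fin 3 → ℤ), ∑ n ∈ K, ‖u t n‖ ^ 2 +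
        2 * min ν ν' * ∫ s in (0 : ℝ)..t, ∑ n ∈ K, normHsq a n * ‖u s n‖ ^ 2 ≤
          ∑' n, ‖v n‖ ^ 2) ∧
      ∀ (n : Fin 3 → ℤ) (χ χ' : ℝ → C4) (T : ℝ), 0 ≤ T → (∀ t, HasDerivAt χ (χ' t) t) →
        Continuous χ' → χ T = 0 →
        (∫ t in (0 : ℝ)..T, inner ℂ (χ' t) (u t n)) + inner ℂ (χ 0) (v n) =
          ∫ t in (0 : ℝ)..T, inner ℂ (χ t) (limOp a F ν ν' (u t) n) := by
  classical
  set E₀ := ∑' n, ‖v n‖ ^ 2 with hE₀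
  set W₀ := ∑' n, ‖pv a F n (v n)‖ ^ 2 with hW₀
  have hE : 0 ≤ E₀ := tsum_nonneg fun _ => sq_nonneg _
  have hW : 0 ≤ W₀ := tsum_nonneg fun _ => sq_nonneg _
  have hc : 0 < min ν ν' := lt_min hν hν'
  let S : ℕ → Finset (Fin 3 → ℤ) := fun N => Finset.Icc (fun _ => -(N : ℤ)) (fun _ => (N : ℤ))
  have hS : ∀ N, ∀ n ∈ S N, -n ∈ S N := by
    intro N n hn
    simp only [S, Finset.mem_Icc, Pi.le_def, Pi.neg_apply] at hn ⊢
    exact ⟨fun i => neg_le_neg (hn.2 i), fun i => by linarith [hn.1 i]⟩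
  have hSn : ∀ n : Fin 3 → ℤ, ∀ᶠ N in atTop, n ∈ S N := by
    intro n
    filter_upwards [eventually_ge_atTop (∑ i, (n i).natAbs)] with N hN
    have h : ∀ i, |n i| ≤ (N : ℤ) := by
      intro i
      have h1 : (n i).natAbs ≤ ∑ i, (n i).natAbs :=
        Finset.single_le_sum (f := fun i => (n i).natAbs) (fun _ _ => Nat.zero_le _)
          (Finset.mem_univ i)
      have h2 : (n i).natAbs ≤ N := h1.trans hN
      rw [Int.abs_eq_natAbs]
      exact_mod_cast h2
    simp only [S, Finset.mem_Icc, Pi.le_def]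
    exact ⟨fun i => (abs_le.1 (h i)).1, fun i => (abs_le.1 (h i)).2⟩
  have hgal := fun N : ℕ => exists_galerkin a F ν ν' (S := S N) hF hF1 hν.le hν'.le (hS N)
    hv hdiv h0 (T := N) (Nat.cast_nonneg N)
  choose y hyc hyr hyd hy0 hyS hyi hyt hye hyp using hgal
  -- finite sums over any set of frequencies are bounded by those over `S N`
  have hsub : ∀ N (t : ℝ) (g : (Fin 3 → ℤ) → C4 → ℝ) (K : Finset (Fin 3 → ℤ)),
      (∀ n z, 0 ≤ g n z) → (∀ n, g n 0 = 0) →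
      ∑ n ∈ K, g n (y N t n) ≤ ∑ n ∈ S N, g n (y N t n) := by
    intro N t g K hg hg0
    calc _ = ∑ n ∈ K ∩ S N, g n (y N t n) := by
          refine (Finset.sum_subset Finset.inter_subset_left fun n hn hn' => ?_).symm
          rw [hyS N t n fun h => hn' (Finset.mem_inter.2 ⟨hn, h⟩), hg0]
      _ ≤ _ := Finset.sum_le_sum_of_subset_of_nonneg Finset.inter_subset_right
          fun n _ _ => hg _ _
  have hen : ∀ (N : ℕ), ∀ t ∈ Icc (0 : ℝ) N, ∀ K : Finset (Fin 3 → ℤ), ∑ n ∈ K, ‖y N t n‖ ^ 2 +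
      2 * min ν ν' * ∫ s in (0 : ℝ)..t, ∑ n ∈ K, normHsq a n * ‖y N s n‖ ^ 2 ≤ E₀ := by
    intro N t ht K
    have h1 := hye N t ht
    have h2 : ∑ n ∈ S N, ‖v n‖ ^ 2 ≤ E₀ := hsv.sum_le_tsum _ fun _ _ => sq_nonneg _
    have h3 := hsub N t (fun _ z => ‖z‖ ^ 2) K (fun _ _ => sq_nonneg _) (by simp)
    have hcK : ∀ K : Finset (Fin 3 → ℤ),
        Continuous fun s => ∑ n ∈ K, normHsq a n * ‖y N s n‖ ^ 2 := fun K => by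
      refine continuous_finsetSum _ fun n _ => ?_
      have := hyc N n
      fun_prop
    have h4 : ∫ s in (0 : ℝ)..t, ∑ n ∈ K, normHsq a n * ‖y N s n‖ ^ 2 ≤
        ∫ s in (0 : ℝ)..t, ∑ n ∈ S N, normHsq a n * ‖y N s n‖ ^ 2 :=
      intervalIntegral.integral_mono_on ht.1 ((hcK K).intervalIntegrable _ _)
        ((hcK _).intervalIntegrable _ _) fun s _ =>
          hsub N s (fun n z => normHsq a n * ‖z‖ ^ 2) K
            (fun n _ => mul_nonneg (normHsq_nonneg a n) (sq_nonneg _)) (by simp)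
    have h5 := mul_le_mul_of_nonneg_left h4 hc.le
    linarith
  have hdis0 : ∀ N t, 0 ≤ t → ∀ K : Finset (Fin 3 → ℤ),
      0 ≤ ∫ s in (0 : ℝ)..t, ∑ n ∈ K, normHsq a n * ‖y N s n‖ ^ 2 := fun N t ht K =>
    intervalIntegral.integral_nonneg ht fun s _ => Finset.sum_nonneg fun n _ =>
      mul_nonneg (normHsq_nonneg a n) (sq_nonneg _)
  have hpath : ∀ (N : ℕ) (T : ℝ), 0 ≤ T → T ≤ N → IsBoundedPath a F (min ν ν') E₀ W₀ T (y N) := by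
    intro N T hT hTN
    refine ⟨hyc N, fun t ht K => ?_, fun t ht K => ?_, fun K => ?_⟩
    · have h1 := hen N t ⟨ht.1, ht.2.trans hTN⟩ K
      have h2 := mul_nonneg hc.le (hdis0 N t ht.1 K)
      linarith
    · refine (hsub N t (fun n z => ‖pv a F n z‖ ^ 2) K (fun _ _ => sq_nonneg _)
        (by simp [pv])).trans ((hyp N t ⟨ht.1, ht.2.trans hTN⟩).trans ?_)
      exact hsp.sum_le_tsum _ fun _ _ => sq_nonneg _
    · have h1 := hen N T ⟨hT, hTN⟩ K
      have h2 := mul_nonneg hc.le (hdis0 N T hT K)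
      have h3 : 0 ≤ ∑ n ∈ K, ‖y N T n‖ ^ 2 := Finset.sum_nonneg fun _ _ => sq_nonneg _
      linarith
  -- the approximations, frozen outside of `[0, N]`
  set cl : ℕ → ℝ → ℝ := fun N t => max 0 (min t N) with hcl
  have hclI : ∀ (N : ℕ) (t : ℝ), cl N t ∈ Icc (0 : ℝ) N := fun N t =>
    ⟨le_max_left _ _, max_le (Nat.cast_nonneg N) (min_le_right _ _)⟩
  have hclid : ∀ N : ℕ, ∀ t ∈ Icc (0 : ℝ) N, cl N t = t := fun N t ht => by
    simp only [hcl]; rw [min_eq_left ht.2, max_eq_right ht.1]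
  have hclL : ∀ (N : ℕ) (s t : ℝ), |cl N t - cl N s| ≤ |t - s| := by
    intro N s t
    simp only [hcl]
    rw [max_comm 0, max_comm 0]
    exact (abs_max_sub_max_le_abs _ _ 0).trans ((abs_min_sub_min_le_max t N s N).trans (by simp))
  have hlimc : ∀ N n, Continuous fun t => limOp a F ν ν' (y N t) n := by
    intro N n
    have hb : ∀ t, bilin a F (y N t) (y N t) n = ∑ k ∈ S N, bilinTerm a F (y N t) (y N t) n k :=
      fun t => bilin_eq_sum a F (S N) (hyS N t) n
    simp only [limOp, hb]
    exact (continuous_finsetSum _ fun k _ => continuous_bilinTerm a F (hyc N) n k).sub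
      (continuous_limitDiffusion a F ν ν' hF (hyc N n))
  have hlip : ∀ n, ∀ᶠ N in atTop, ∀ s t : ℝ,
      ‖y N (cl N t) n - y N (cl N s) n‖ ≤ rateBound a ν ν' E₀ n * |t - s| := by
    intro n
    filter_upwards [hSn n] with N hN
    have key : ∀ s ∈ Icc (0 : ℝ) N, ∀ t ∈ Icc (0 : ℝ) N, s ≤ t →
        ‖y N t n - y N s n‖ ≤ rateBound a ν ν' E₀ n * |t - s| := by
      intro s hs t ht hst
      rw [← intervalIntegral.integral_eq_sub_of_hasDerivAt_of_le hst (hyc N n).continuousOn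
        (fun r hr => hyt N n hN r ⟨hs.1.trans_lt hr.1, hr.2.trans_le ht.2⟩)
        ((hlimc N n).neg.intervalIntegrable _ _)]
      refine intervalIntegral.norm_integral_le_of_norm_le_const fun r hr => ?_
      rw [uIoc_of_le hst] at hr
      rw [norm_neg]
      exact norm_limOp_le a F ν ν' hF hν.le hν'.le
        ((hpath N N (Nat.cast_nonneg N) le_rfl).energy r
          ⟨hs.1.trans hr.1.le, hr.2.trans ht.2⟩) n
    have hr0 : 0 ≤ rateBound a ν ν' E₀ n := by
      have := normHsq_nonneg a n
      unfold rateBound; positivity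
    intro s t
    refine le_trans ?_ (mul_le_mul_of_nonneg_left (hclL N s t) hr0)
    rcases le_total (cl N s) (cl N t) with h | h
    · exact key _ (hclI N s) _ (hclI N t) h
    · rw [norm_sub_rev, abs_sub_comm]
      exact key _ (hclI N t) _ (hclI N s) h
  have hbd : ∀ N t n, ‖y N (cl N t) n‖ ≤ √E₀ := fun N t n =>
    norm_le_of_energy ((hpath N N (Nat.cast_nonneg N) le_rfl).energy _ (hclI N t)) n
  obtain ⟨φ, hφ, u, hu, huL⟩ := exists_subseq_tendsto_of_lipschitz
    (f := fun N t n => y N (cl N t) n) hbd hlip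
  have huc : ∀ n, Continuous fun t => u t n := by
    intro n
    have hr0 : 0 ≤ rateBound a ν ν' E₀ n := by
      have := normHsq_nonneg a n
      unfold rateBound; positivity
    refine (LipschitzWith.of_dist_le_mul (K := ⟨_, hr0⟩) fun t s => ?_).continuous
    rw [dist_eq_norm, Real.dist_eq]
    exact huL n s t
  have hφ' : ∀ T : ℝ, ∀ᶠ j in atTop, T ≤ (φ j : ℝ) := fun T =>
    (tendsto_natCast_atTop_atTop.comp hφ.tendsto_atTop).eventually_ge_atTop T
  have hu' : ∀ t, 0 ≤ t → ∀ n, Tendsto (fun j => y (φ j) t n) atTop (𝓝 (u t n)) := by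
    intro t ht n
    refine (hu t n).congr' ?_
    filter_upwards [hφ' t] with j hj
    rw [hclid _ t ⟨ht, hj⟩]
  have hconjc : Continuous conjV := by
    unfold conjV
    refine (PiLp.continuous_toLp 2 _).comp (continuous_pi fun i => ?_)
    fun_prop
  have hpc : ∀ n, Continuous fun z : C4 => pv a F n z := fun n => by
    unfold pv; fun_prop
  have huE : ∀ t, ∀ K : Finset (Fin 3 → ℤ), ∑ n ∈ K, ‖u t n‖ ^ 2 ≤ E₀ := by
    intro t K
    refine le_of_tendsto (tendsto_finsetSum K fun n _ => (hu t n).norm.pow 2)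
      (Eventually.of_forall fun j => ?_)
    exact (hpath (φ j) (φ j) (Nat.cast_nonneg _) le_rfl).energy _ (hclI _ t) K
  have huen : ∀ t, 0 ≤ t → ∀ K : Finset (Fin 3 → ℤ), ∑ n ∈ K, ‖u t n‖ ^ 2 +
        2 * min ν ν' * ∫ s in (0 : ℝ)..t, ∑ n ∈ K, normHsq a n * ‖u s n‖ ^ 2 ≤ E₀ := by
    intro t ht K
    have hint : Tendsto (fun j => ∫ s in (0 : ℝ)..t, ∑ n ∈ K, normHsq a n * ‖y (φ j) s n‖ ^ 2) atTop
        (𝓝 (∫ s in (0 : ℝ)..t, ∑ n ∈ K, normHsq a n * ‖u s n‖ ^ 2)) := by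
      refine intervalIntegral.tendsto_integral_filter_of_dominated_convergence
        (fun _ => ∑ n ∈ K, normHsq a n * √E₀ ^ 2) ?_ ?_ intervalIntegrable_const ?_
      · refine Eventually.of_forall fun j => Continuous.aestronglyMeasurable ?_
        refine continuous_finsetSum _ fun n _ => ?_
        have := hyc (φ j) n
        fun_prop
      · filter_upwards [hφ' t] with j hj
        refine Eventually.of_forall fun s hs => ?_
        rw [uIoc_of_le ht] at hs
        refine norm_sum_le_of_le _ fun n _ => ?_
        have h1 := norm_le_of_energy ((hpath (φ j) t ht hj).energy s ⟨hs.1.le, hs.2⟩) n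
        have h2 := normHsq_nonneg a n
        rw [norm_mul, norm_pow, norm_norm, Real.norm_of_nonneg h2]
        gcongr
      · refine Eventually.of_forall fun s hs => ?_
        rw [uIoc_of_le ht] at hs
        exact tendsto_finsetSum K fun n _ => ((hu' s hs.1.le n).norm.pow 2).const_mul _
    refine le_of_tendsto ((tendsto_finsetSum K fun n _ => (hu' t ht n).norm.pow 2).add
      (hint.const_mul (2 * min ν ν'))) ?_
    filter_upwards [hφ' t] with j hj using hen (φ j) t ⟨ht, hj⟩ K
  have hupath : ∀ T : ℝ, 0 ≤ T → IsBoundedPath a F (min ν ν') E₀ W₀ T u := by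
    intro T hT
    refine ⟨huc, fun t _ K => huE t K, fun t ht K => ?_, fun K => ?_⟩
    · refine le_of_tendsto (tendsto_finsetSum K fun n _ =>
        (((hpc n).tendsto _).comp (hu' t ht.1 n)).norm.pow 2) ?_
      filter_upwards [hφ' T] with j hj using (hpath (φ j) T hT hj).enstrophy t ht K
    · have h1 := huen T hT K
      have h2 : 0 ≤ ∫ s in (0 : ℝ)..T, ∑ n ∈ K, normHsq a n * ‖u s n‖ ^ 2 :=
        intervalIntegral.integral_nonneg hT fun s _ => Finset.sum_nonneg fun n _ =>
          mul_nonneg (normHsq_nonneg a n) (sq_nonneg _)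
      have h2 := mul_nonneg hc.le h2
      have h3 : 0 ≤ ∑ n ∈ K, ‖u T n‖ ^ 2 := Finset.sum_nonneg fun _ _ => sq_nonneg _
      linarith
  refine ⟨u, huc, fun t n => ?_, fun t n => ?_, fun t => ?_, huE, huen, ?_⟩
  · refine tendsto_nhds_unique (hu t (-n)) ?_
    simp only [hyr]
    exact (hconjc.tendsto _).comp (hu t n)
  · have hfc : Continuous fun z : C4 => fdot a n z := by unfold fdot; fun_prop
    refine tendsto_nhds_unique ((hfc.tendsto _).comp (hu t n)) ?_
    simp only [Function.comp_def, hyd]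
    exact tendsto_const_nhds
  · refine tendsto_nhds_unique (hu t 0) ?_
    simp only [hy0]
    exact tendsto_const_nhds
  intro n χ χ' T hT hχ hχ' hχT
  have hχc : Continuous χ := continuous_iff_continuousAt.2 fun t => (hχ t).continuousAt
  -- the weak formulation for the approximations
  have hweak : ∀ᶠ j in atTop,
      (∫ t in (0 : ℝ)..T, inner ℂ (χ' t) (y (φ j) t n)) + inner ℂ (χ 0) (v n) =
        ∫ t in (0 : ℝ)..T, inner ℂ (χ t) (limOp a F ν ν' (y (φ j) t) n) := by
    filter_upwards [hφ' T, hφ.tendsto_atTop.eventually (hSn n)] with j hj hjn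
    have c1 : Continuous fun t => inner ℂ (χ' t) (y (φ j) t n) := hχ'.inner (hyc _ n)
    have c2 : Continuous fun t => inner ℂ (χ t) (limOp a F ν ν' (y (φ j) t) n) :=
      hχc.inner (hlimc _ n)
    have h1 := intervalIntegral.integral_eq_sub_of_hasDerivAt_of_le hT
      (f := fun t => inner ℂ (χ t) (y (φ j) t n))
      (f' := fun t => inner ℂ (χ' t) (y (φ j) t n) -
        inner ℂ (χ t) (limOp a F ν ν' (y (φ j) t) n))
      (hχc.inner (hyc _ n)).continuousOn (fun t ht => by
        have h2 := (hχ t).inner ℂ (hyt (φ j) n hjn t ⟨ht.1, ht.2.trans_le hj⟩)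
        rw [inner_neg_right] at h2
        exact h2.congr_deriv (by ring)) ((c1.sub c2).intervalIntegrable _ _)
    rw [intervalIntegral.integral_sub (c1.intervalIntegrable _ _) (c2.intervalIntegrable _ _),
      hχT, inner_zero_left, hyi (φ j) n hjn] at h1
    linear_combination h1
  have hL : Tendsto (fun j => (∫ t in (0 : ℝ)..T, inner ℂ (χ' t) (y (φ j) t n)) +
      inner ℂ (χ 0) (v n)) atTop
      (𝓝 ((∫ t in (0 : ℝ)..T, inner ℂ (χ' t) (u t n)) + inner ℂ (χ 0) (v n))) := by
    refine Tendsto.add_const _ ?_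
    refine intervalIntegral.tendsto_integral_filter_of_dominated_convergence
      (fun t => ‖χ' t‖ * √E₀) ?_ ?_ ?_ ?_
    · exact Eventually.of_forall fun j => (hχ'.inner (hyc _ n)).aestronglyMeasurable
    · filter_upwards [hφ' T] with j hj
      refine Eventually.of_forall fun s hs => ?_
      rw [uIoc_of_le hT] at hs
      refine (norm_inner_le_norm _ _).trans ?_
      gcongr
      exact norm_le_of_energy ((hpath (φ j) T hT hj).energy s ⟨hs.1.le, hs.2⟩) n
    · exact (hχ'.norm.mul continuous_const).intervalIntegrable _ _
    · refine Eventually.of_forall fun s hs => ?_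
      rw [uIoc_of_le hT] at hs
      exact tendsto_const_nhds.inner (hu' s hs.1.le n)
  have hR : Tendsto (fun j => ∫ t in (0 : ℝ)..T, inner ℂ (χ t) (limOp a F ν ν' (y (φ j) t) n)) atTop
      (𝓝 (∫ t in (0 : ℝ)..T, inner ℂ (χ t) (limOp a F ν ν' (u t) n))) := by
    -- the truncated operator is continuous for the convergence of the modes, and the truncation
    -- error is small along the approximations and along the limit
    rw [Metric.tendsto_atTop']
    intro ε hε
    obtain ⟨K, hK⟩ := exists_norm_integral_limOp_sub_le a F ν ν' hF hF1 hν hν' hc hT hE hW hχc n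
      (ε := ε / 4) (by positivity)
    have hKlim : Tendsto
        (fun j => ∫ t in (0 : ℝ)..T, inner ℂ (χ t) (truncOp a F ν ν' K (y (φ j) t) n)) atTop
        (𝓝 (∫ t in (0 : ℝ)..T, inner ℂ (χ t) (truncOp a F ν ν' K (u t) n))) := by
      refine intervalIntegral.tendsto_integral_filter_of_dominated_convergence
        (fun t => ‖χ t‖ * rateBound a ν ν' E₀ n) ?_ ?_ ?_ ?_
      · exact Eventually.of_forall fun j =>
          (hχc.inner (continuous_truncOp a F ν ν' hF K (hyc _) n)).aestronglyMeasurable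
      · filter_upwards [hφ' T] with j hj
        refine Eventually.of_forall fun s hs => ?_
        rw [uIoc_of_le hT] at hs
        refine (norm_inner_le_norm _ _).trans ?_
        gcongr
        exact norm_truncOp_le a F ν ν' hF hν.le hν'.le K
          ((hpath (φ j) T hT hj).energy s ⟨hs.1.le, hs.2⟩) n
      · exact (hχc.norm.mul continuous_const).intervalIntegrable _ _
      · refine Eventually.of_forall fun s hs => ?_
        rw [uIoc_of_le hT] at hs
        refine tendsto_const_nhds.inner ?_
        have hid : Continuous fun z : (Fin 3 → ℤ) → C4 => truncOp a F ν ν' K z n :=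
          continuous_truncOp a F ν ν' hF K (fun m => continuous_apply m) n
        exact (hid.tendsto _).comp (tendsto_pi_nhds.2 fun m => hu' s hs.1.le m)
    have h1 := Metric.tendsto_nhds.1 hKlim (ε / 4) (by positivity)
    obtain ⟨J, hJ⟩ := eventually_atTop.1 (h1.and (hφ' T))
    refine ⟨J, fun j hj => ?_⟩
    obtain ⟨h2, h3⟩ := hJ j hj.le
    have h4 := hK _ (hpath (φ j) T hT h3)
    have h5 := hK _ (hupath T hT)
    rw [← dist_eq_norm] at h4 h5
    have h6 := dist_triangle4_right
      (∫ t in (0 : ℝ)..T, inner ℂ (χ t) (limOp a F ν ν' (y (φ j) t) n))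
      (∫ t in (0 : ℝ)..T, inner ℂ (χ t) (limOp a F ν ν' (u t) n))
      (∫ t in (0 : ℝ)..T, inner ℂ (χ t) (truncOp a F ν ν' K (y (φ j) t) n))
      (∫ t in (0 : ℝ)..T, inner ℂ (χ t) (truncOp a F ν ν' K (u t) n))
    linarith
  exact tendsto_nhds_unique hL (hR.congr' (hweak.mono fun j hj => hj.symm))

end Existence

/-! ### The Fourier basis of the torus -/

section TorusFourier

variable (a : Fin 3 → ℝ)

lemma monomial_neg (n : Fin 3 → ℤ) (x : Torus a) : monomial a (-n) x = conj (monomial a n x) := by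
  simp only [monomial, Pi.neg_apply, fourier_neg, map_prod]

lemma monomial_add (m n : Fin 3 → ℤ) (x : Torus a) :
    monomial a (m + n) x = monomial a m x * monomial a n x := by
  simp only [monomial, Pi.add_apply, fourier_add, ← Finset.prod_mul_distrib]

@[simp] lemma monomial_zero (x : Torus a) : monomial a 0 x = 1 := by
  simp [monomial]

@[simp] lemma norm_monomial (n : Fin 3 → ℤ) (x : Torus a) : ‖monomial a n x‖ = 1 := by
  rw [monomial, norm_prod]
  exact Finset.prod_eq_one fun i _ => Circle.norm_coe _

lemma continuous_monomial (n : Fin 3 → ℤ) : Continuous (monomial a n) := by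
  unfold monomial
  fun_prop

/-- The exponential `e^{i ň·x}` as a continuous map. -/
noncomputable def monomialC (n : Fin 3 → ℤ) : C(Torus a, ℂ) := ⟨monomial a n, continuous_monomial a n⟩

@[simp] lemma monomialC_apply (n : Fin 3 → ℤ) (x : Torus a) : monomialC a n x = monomial a n x := rfl

variable [ha : ∀ i, Fact (0 < a i)]

/-- The star subalgebra of trigonometric polynomials. -/
noncomputable def trigSubalgebra : StarSubalgebra ℂ C(Torus a, ℂ) where
  toSubalgebra := Algebra.adjoin ℂ (range (monomialC a))
  star_mem' := by
    change Algebra.adjoin ℂ (range (monomialC a)) ≤ star (Algebra.adjoin ℂ (range (monomialC a)))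
    refine Algebra.adjoin_le ?_
    rintro _ ⟨n, rfl⟩
    refine Algebra.subset_adjoin ⟨-n, ?_⟩
    ext1 x
    simp only [monomialC_apply, monomial_neg, starRingEnd_apply, ContinuousMap.star_apply]

lemma trigSubalgebra_coe :
    Subalgebra.toSubmodule (trigSubalgebra a).toSubalgebra =
      Submodule.span ℂ (range (monomialC a)) := by
  apply Algebra.adjoin_eq_span_of_subset
  refine .trans (fun x ↦ Submonoid.closure_induction (fun _ ↦ id) ⟨0, ?_⟩ ?_) Submodule.subset_span
  · ext z
    simp
  · rintro _ _ _ _ ⟨m, rfl⟩ ⟨n, rfl⟩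
    exact ⟨m + n, by ext z; simp [monomial_add]⟩

omit ha in
lemma monomial_single (i : Fin 3) (z : Torus a) :
    monomial a (Pi.single i 1) z = fourier 1 (z i) := by
  rw [monomial, Finset.prod_eq_single i]
  · simp
  · intro j _ hj
    simp [Pi.single_eq_of_ne hj]
  · simp

lemma trigSubalgebra_separatesPoints : (trigSubalgebra a).SeparatesPoints := by
  intro x y hxy
  obtain ⟨i, hi⟩ := Function.ne_iff.1 hxy
  refine ⟨_, ⟨monomialC a (Pi.single i 1), Algebra.subset_adjoin ⟨Pi.single i 1, rfl⟩, rfl⟩, ?_⟩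
  dsimp only
  rw [monomialC_apply, monomialC_apply, monomial_single, monomial_single, fourier_one, fourier_one]
  exact fun h => hi (AddCircle.injective_toCircle (factPeriod (a i)).out.ne' (Circle.ext h))

/-- The trigonometric polynomials are dense, by the Stone–Weierstrass theorem. -/
lemma span_monomialC_closure :
    (Submodule.span ℂ (range (monomialC a))).topologicalClosure = ⊤ := by
  rw [← trigSubalgebra_coe]
  exact congr_arg (Subalgebra.toSubmodule <| StarSubalgebra.toSubalgebra ·)
    (ContinuousMap.starSubalgebra_topologicalClosure_eq_top_of_separatesPoints _
      (trigSubalgebra_separatesPoints a))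

/-- The volume of the torus. -/
noncomputable def vol : ℝ := (volume : Measure (Torus a)).real univ

lemma vol_pos : 0 < vol a := by
  refine ENNReal.toReal_pos ?_ (measure_ne_top _ _)
  exact (isOpen_univ.measure_pos _ univ_nonempty).ne'

lemma integral_monomial {n : Fin 3 → ℤ} (hn : n ≠ 0) : ∫ x, monomial a n x = 0 := by
  obtain ⟨i, hi⟩ := Function.ne_iff.1 hn
  unfold monomial
  rw [integral_fintype_prod_volume_eq_prod (fun i (x : AddCircle (2 * π * a i)) => fourier (n i) x)]
  refine Finset.prod_eq_zero (Finset.mem_univ i) ?_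
  exact integral_eq_zero_of_add_right_eq_neg
    (fourier_add_half_inv_index hi (factPeriod (a i)).out)

lemma integral_monomial_zero : ∫ x, monomial a 0 x = vol a := by
  simp [vol]

/-- The normalized exponentials in `L²(𝕋³; ℂ)`. -/
noncomputable def expL2 (n : Fin 3 → ℤ) : Lp ℂ 2 (volume : Measure (Torus a)) :=
  (((√(vol a))⁻¹ : ℝ) : ℂ) • ContinuousMap.toLp 2 volume ℂ (monomialC a n)

lemma orthonormal_expL2 : Orthonormal ℂ (expL2 a) := by
  rw [orthonormal_iff_ite]
  intro m n
  have hv := vol_pos a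
  have h : inner ℂ (ContinuousMap.toLp 2 volume ℂ (monomialC a m))
      (ContinuousMap.toLp 2 volume ℂ (monomialC a n)) =
        ∫ x : Torus a, monomial a (n - m) x := by
    rw [ContinuousMap.inner_toLp]
    congr 1
    ext x
    rw [monomialC_apply, monomialC_apply, sub_eq_add_neg, monomial_add, monomial_neg]
  rw [expL2, expL2, inner_smul_left, inner_smul_right, h]
  split_ifs with hmn
  · subst hmn
    rw [sub_self, integral_monomial_zero, Complex.conj_ofReal]
    norm_cast
    rw [← mul_assoc, ← mul_inv, Real.mul_self_sqrt hv.le]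
    exact inv_mul_cancel₀ hv.ne'
  · rw [integral_monomial a (sub_ne_zero.2 (Ne.symm hmn))]
    simp

lemma span_expL2_closure : (Submodule.span ℂ (range (expL2 a))).topologicalClosure = ⊤ := by
  have h1 : (Submodule.span ℂ (range fun n => ContinuousMap.toLp 2 volume ℂ
      (monomialC a n))).topologicalClosure = ⊤ := by
    simpa only [Submodule.map_span, ContinuousLinearMap.coe_coe, ← range_comp,
      Function.comp_def] using
      (ContinuousMap.toLp_denseRange ℂ (volume : Measure (Torus a)) ℂ
        ENNReal.ofNat_ne_top).topologicalClosure_map_submodule (span_monomialC_closure a)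
  rw [← h1]
  congr 1
  refine le_antisymm (Submodule.span_le.2 ?_) (Submodule.span_le.2 ?_)
  · rintro _ ⟨n, rfl⟩
    exact Submodule.smul_mem _ _ (Submodule.subset_span ⟨n, rfl⟩)
  · rintro _ ⟨n, rfl⟩
    have hc : (((√(vol a))⁻¹ : ℝ) : ℂ) ≠ 0 := by
      have := vol_pos a
      exact_mod_cast (inv_pos.2 (Real.sqrt_pos.2 this)).ne'
    have : ContinuousMap.toLp 2 volume ℂ (monomialC a n) =
        ((((√(vol a))⁻¹ : ℝ) : ℂ))⁻¹ • expL2 a n := by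
      rw [expL2, smul_smul, inv_mul_cancel₀ hc, one_smul]
    simp only [SetLike.mem_coe]
    rw [this]
    exact Submodule.smul_mem _ _ (Submodule.subset_span ⟨n, rfl⟩)

/-- The Fourier basis of `L²(𝕋³; ℂ)`. -/
noncomputable def torusBasis : HilbertBasis (Fin 3 → ℤ) ℂ (Lp ℂ 2 (volume : Measure (Torus a))) :=
  HilbertBasis.mk (orthonormal_expL2 a) (span_expL2_closure a).ge

/-- The Fourier coefficient of a complex function. -/
noncomputable def scoeff (f : Torus a → ℂ) (n : Fin 3 → ℤ) : ℂ := ⨍ x, monomial a (-n) x * f x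

lemma coeff_apply (f : Torus a → E4) (n : Fin 3 → ℤ) (l : Fin 4) :
    coeff a f n l = scoeff a (fun x => (f x l : ℂ)) n := rfl

lemma scoeff_eq (f : Torus a → ℂ) (n : Fin 3 → ℤ) :
    scoeff a f n = ((vol a)⁻¹ : ℝ) * ∫ x, monomial a (-n) x * f x := by
  rw [scoeff, average_eq, vol, Complex.real_smul]

lemma scoeff_congr {f g : Torus a → ℂ} (h : f =ᵐ[volume] g) (n : Fin 3 → ℤ) :
    scoeff a f n = scoeff a g n := by
  rw [scoeff_eq, scoeff_eq]
  congr 1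
  refine integral_congr_ae ?_
  filter_upwards [h] with x hx
  rw [hx]

lemma torusBasis_repr (f : Lp ℂ 2 (volume : Measure (Torus a))) (n : Fin 3 → ℤ) :
    (torusBasis a).repr f n = √(vol a) * scoeff a f n := by
  have hv := vol_pos a
  rw [HilbertBasis.repr_apply_apply, torusBasis, HilbertBasis.coe_mk, expL2, inner_smul_left,
    L2.inner_def, scoeff_eq, Complex.conj_ofReal, ← mul_assoc]
  have h1 : (√(vol a))⁻¹ = √(vol a) * (vol a)⁻¹ := by
    nth_rewrite 3 [← Real.mul_self_sqrt hv.le]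
    have := (Real.sqrt_pos.2 hv).ne'
    field_simp
  rw [h1]
  push_cast
  congr 1
  refine integral_congr_ae ?_
  filter_upwards [ContinuousMap.coeFn_toLp (p := 2) (𝕜 := ℂ) volume (monomialC a n)] with x hx
  rw [hx, monomial_neg, monomialC_apply, RCLike.inner_apply, mul_comm]

/-- Parseval's identity. -/
lemma hasSum_scoeff (f g : Lp ℂ 2 (volume : Measure (Torus a))) :
    HasSum (fun n => conj (scoeff a f n) * scoeff a g n)
      (((vol a)⁻¹ : ℝ) * ∫ x, conj (f x) * g x) := by
  have hv := vol_pos a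
  have h := ((torusBasis a).hasSum_inner_mul_inner f g).mul_left (((vol a)⁻¹ : ℝ) : ℂ)
  rw [L2.inner_def] at h
  have e : (∫ x, inner ℂ (f x) (g x)) = ∫ x, conj (f x) * g x := by
    congr 1; ext x; rw [RCLike.inner_apply, mul_comm]
  rw [e] at h
  refine h.congr_fun fun n => ?_
  have h2 : ((vol a : ℝ) : ℂ) ≠ 0 := by exact_mod_cast hv.ne'
  have h3 : ((√(vol a) : ℝ) : ℂ) * ((√(vol a) : ℝ) : ℂ) = vol a := by
    exact_mod_cast Real.mul_self_sqrt hv.le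
  rw [← inner_conj_symm, ← HilbertBasis.repr_apply_apply, ← HilbertBasis.repr_apply_apply,
    torusBasis_repr, torusBasis_repr, map_mul, Complex.conj_ofReal]
  push_cast
  field_simp
  rw [← h3]
  ring

end TorusFourier

/-! ### Fourier coefficients of fields -/

section Fields

variable (a : Fin 3 → ℝ) [ha : ∀ i, Fact (0 < a i)]

/-- The component `l` of a field, as a complex function. -/
noncomputable def compL (l : Fin 4) : L2Field a →L[ℝ] Lp ℂ 2 (volume : Measure (Torus a)) :=
  ContinuousLinearMap.compLpL 2 volume
    (Complex.ofRealCLM.comp ((EuclideanSpace.proj l : E4 →L[ℝ] ℝ)))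

lemma compL_coe (l : Fin 4) (V : L2Field a) :
    compL a l V =ᵐ[volume] fun x => ((V x l : ℝ) : ℂ) := by
  filter_upwards [ContinuousLinearMap.coeFn_compLpL (p := 2) (μ := volume)
    (Complex.ofRealCLM.comp ((EuclideanSpace.proj l : E4 →L[ℝ] ℝ))) V] with x hx
  exact hx

lemma coeff_eq_scoeff (V : L2Field a) (n : Fin 3 → ℤ) (l : Fin 4) :
    coeff a V n l = scoeff a (compL a l V) n := by
  rw [coeff_apply]
  exact (scoeff_congr a (compL_coe a l V) n).symm

lemma coeff_congr {f g : Torus a → E4} (h : f =ᵐ[volume] g) (n : Fin 3 → ℤ) :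
    coeff a f n = coeff a g n := by
  ext l
  rw [coeff_apply, coeff_apply]
  refine scoeff_congr a ?_ n
  filter_upwards [h] with x hx
  rw [hx]

/-- Parseval's identity for fields. -/
lemma hasSum_inner_coeff (V W : L2Field a) :
    HasSum (fun n => inner ℂ (coeff a W n) (coeff a V n))
      ((((vol a)⁻¹ * ∫ x, inner ℝ (V x) (W x) : ℝ)) : ℂ) := by
  have h := fun l => hasSum_scoeff a (compL a l W) (compL a l V)
  have h2 := hasSum_sum (s := Finset.univ) fun l _ => h l
  have e1 : ∀ l, ∫ x, conj (compL a l W x) * compL a l V x = ((∫ x, V x l * W x l : ℝ) : ℂ) := by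
    intro l
    refine Eq.trans (integral_congr_ae ?_) (integral_ofReal (𝕜 := ℂ))
    filter_upwards [compL_coe a l V, compL_coe a l W] with x h1 h2
    rw [h1, h2]
    simp [mul_comm]
  have hi : ∀ l, Integrable (fun x => V x l * W x l) (volume : Measure (Torus a)) := by
    intro l
    have hV : MemLp (fun x => V x l) 2 (volume : Measure (Torus a)) :=
      (EuclideanSpace.proj l : E4 →L[ℝ] ℝ).comp_memLp' (Lp.memLp V)
    have hW : MemLp (fun x => W x l) 2 (volume : Measure (Torus a)) :=
      (EuclideanSpace.proj l : E4 →L[ℝ] ℝ).comp_memLp' (Lp.memLp W)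
    exact hV.integrable_mul hW
  have e2 : ∫ x, inner ℝ (V x) (W x) = ∑ l, ∫ x, V x l * W x l := by
    rw [← integral_finsetSum _ fun l _ => hi l]
    congr 1
    ext x
    simp [PiLp.inner_apply, mul_comm]
  convert! h2 using 1
  · ext n
    rw [PiLp.inner_apply]
    refine Finset.sum_congr rfl fun l _ => ?_
    rw [RCLike.inner_apply, coeff_eq_scoeff, coeff_eq_scoeff, mul_comm]
  · rw [e2]
    push_cast
    rw [Finset.mul_sum]
    refine Finset.sum_congr rfl fun l _ => ?_
    rw [e1]

lemma hasSum_norm_sq_coeff (V : L2Field a) :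
    HasSum (fun n => ‖coeff a V n‖ ^ 2) ((vol a)⁻¹ * ‖V‖ ^ 2) := by
  have h := hasSum_inner_coeff a V V
  have e : ∫ x, inner ℝ (V x) (V x) = ‖V‖ ^ 2 := by
    rw [← L2.inner_def, real_inner_self_eq_norm_sq]
  rw [e] at h
  have h2 := Complex.hasSum_re h
  rw [Complex.ofReal_re] at h2
  refine h2.congr_fun fun n => ?_
  rw [inner_self_eq_norm_sq_to_K]
  norm_cast

lemma scoeff_ofReal_conj {f : Torus a → ℝ} (n : Fin 3 → ℤ) :
    scoeff a (fun x => (f x : ℂ)) (-n) = conj (scoeff a (fun x => (f x : ℂ)) n) := by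
  rw [scoeff_eq, scoeff_eq, map_mul, Complex.conj_ofReal, ← integral_conj]
  congr 2
  ext x
  rw [map_mul, Complex.conj_ofReal, ← monomial_neg]

/-- The reality of a field, read on its coefficients. -/
lemma coeff_neg (f : Torus a → E4) (n : Fin 3 → ℤ) : coeff a f (-n) = conjV (coeff a f n) := by
  ext l
  rw [conjV_apply, coeff_apply, coeff_apply]
  exact scoeff_ofReal_conj a n

/-- A square summable family of complex numbers as an element of `ℓ²`. -/
noncomputable def toL2 (c : (Fin 3 → ℤ) → ℂ) (h : Summable fun n => ‖c n‖ ^ 2) :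
    lp (fun _ : Fin 3 → ℤ => ℂ) 2 :=
  ⟨c, memℓp_gen (by simpa using h)⟩

lemma summable_comp {c : (Fin 3 → ℤ) → C4} (h : Summable fun n => ‖c n‖ ^ 2) (l : Fin 4) :
    Summable fun n => ‖c n l‖ ^ 2 := by
  refine Summable.of_nonneg_of_le (fun _ => sq_nonneg _) (fun n => ?_) h
  have := PiLp.norm_apply_le (c n) l
  gcongr

/-- The real part of a complex function, placed in the component `l` of a field. -/
noncomputable def embL (l : Fin 4) : Lp ℂ 2 (volume : Measure (Torus a)) →L[ℝ] L2Field a :=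
  ContinuousLinearMap.compLpL 2 volume
    ((Complex.reCLM.smulRight (EuclideanSpace.single l (1 : ℝ)) : ℂ →L[ℝ] E4))

/-- The field with given Fourier coefficients. -/
noncomputable def synth (c : (Fin 3 → ℤ) → C4) (h : Summable fun n => ‖c n‖ ^ 2) : L2Field a :=
  ∑ l, embL a l ((√(vol a) : ℝ) • (torusBasis a).repr.symm (toL2 (fun n => c n l) (summable_comp h l)))

lemma scoeff_symm (c : (Fin 3 → ℤ) → ℂ) (h : Summable fun n => ‖c n‖ ^ 2) (n : Fin 3 → ℤ) :
    √(vol a) * scoeff a ((torusBasis a).repr.symm (toL2 c h)) n = c n := by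
  rw [← torusBasis_repr, LinearIsometryEquiv.apply_symm_apply]
  rfl

lemma scoeff_re (f : Lp ℂ 2 (volume : Measure (Torus a))) (n : Fin 3 → ℤ) :
    scoeff a (fun x => ((f x).re : ℂ)) n =
      (1 / 2) * (scoeff a f n + conj (scoeff a f (-n))) := by
  have hi : ∀ n, Integrable (fun x => monomial a n x * f x) (volume : Measure (Torus a)) := by
    intro n
    refine Integrable.bdd_mul (c := 1) ((Lp.memLp f).integrable (by norm_num))
      (continuous_monomial a n).aestronglyMeasurable ?_
    exact Eventually.of_forall fun x => by rw [norm_monomial]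
  have hi' : Integrable (fun x => conj (monomial a n x * f x)) (volume : Measure (Torus a)) := by
    have := Complex.conjCLE.toContinuousLinearMap.integrable_comp (hi n)
    exact this
  rw [scoeff_eq, scoeff_eq, scoeff_eq, map_mul, Complex.conj_ofReal, ← integral_conj, ← mul_add,
    neg_neg, ← integral_add (hi _) hi']
  rw [mul_left_comm, ← integral_const_mul (1 / 2 : ℂ)]
  refine congrArg _ (integral_congr_ae (Eventually.of_forall fun x => ?_))
  dsimp only
  rw [map_mul, ← monomial_neg, ← mul_add, Complex.add_conj]
  push_cast
  ring

/-- The coefficients must satisfy the reality condition, since `synth` takes real parts. -/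
lemma coeff_synth {c : (Fin 3 → ℤ) → C4} (h : Summable fun n => ‖c n‖ ^ 2)
    (hc : ∀ n, c (-n) = conjV (c n)) (n : Fin 3 → ℤ) : coeff a (synth a c h) n = c n := by
  have hv := vol_pos a
  set g : Fin 4 → Lp ℂ 2 (volume : Measure (Torus a)) := fun l =>
    (√(vol a) : ℝ) • (torusBasis a).repr.symm (toL2 (fun n => c n l) (summable_comp h l)) with hg
  have h1 : (synth a c h : Torus a → E4) =ᵐ[volume]
      fun x => ∑ l, (g l x).re • EuclideanSpace.single l (1 : ℝ) := by
    have e1 : ∀ l, (embL a l (g l) : Torus a → E4) =ᵐ[volume]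
        fun x => (g l x).re • EuclideanSpace.single l (1 : ℝ) := fun l =>
      ContinuousLinearMap.coeFn_compLpL (p := 2) (μ := volume)
        ((Complex.reCLM.smulRight (EuclideanSpace.single l (1 : ℝ)) : ℂ →L[ℝ] E4)) (g l)
    have e2 := Lp.coeFn_finsetSum (μ := volume) (p := 2) Finset.univ fun l => embL a l (g l)
    filter_upwards [eventually_all.2 e1, e2] with x hx1 hx2
    change (∑ l, embL a l (g l) : L2Field a) x = _
    rw [hx2]
    simp only [Finset.sum_apply]
    exact Finset.sum_congr rfl fun l _ => hx1 l
  have hcoef : ∀ l m, scoeff a (g l) m = c m l := by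
    intro l m
    rw [← scoeff_symm a (fun n => c n l) (summable_comp h l) m, scoeff_eq, scoeff_eq]
    have e3 : (g l : Torus a → ℂ) =ᵐ[volume] (√(vol a) : ℝ) •
      ((torusBasis a).repr.symm (toL2 (fun n => c n l) (summable_comp h l)) : Torus a → ℂ) :=
      Lp.coeFn_smul _ _
    rw [mul_left_comm, ← integral_const_mul (√(vol a) : ℂ)]
    refine congrArg _ (integral_congr_ae ?_)
    filter_upwards [e3] with x hx
    rw [hx, Pi.smul_apply, Complex.real_smul]
    ring
  rw [coeff_congr a h1]
  ext l
  rw [coeff_apply]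
  have e4 : ∀ x, (∑ l, (g l x).re • EuclideanSpace.single l (1 : ℝ) : E4) l = (g l x).re := by
    intro x
    fin_cases l <;> simp [Fin.sum_univ_four]
  simp only [e4]
  rw [scoeff_re, hcoef, hcoef, hc, conjV_apply, Complex.conj_conj]
  ring

/-- The field with given Fourier coefficients depends measurably on a parameter if the coefficients
do. -/
lemma aestronglyMeasurable_synth {X : Type*} [MeasurableSpace X] {μ : Measure X}
    {c : X → (Fin 3 → ℤ) → C4} (hc : ∀ n, AEStronglyMeasurable (fun t => c t n) μ)
    (h : ∀ t, Summable fun n => ‖c t n‖ ^ 2) :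
    AEStronglyMeasurable (fun t => synth a (c t) (h t)) μ := by
  classical
  unfold synth
  refine Finset.aestronglyMeasurable_fun_sum _ fun l _ => ?_
  refine (embL a l).continuous.comp_aestronglyMeasurable ?_
  suffices h0 : AEStronglyMeasurable (fun t => (torusBasis a).repr.symm
      (toL2 (fun n => c t n l) (summable_comp (h t) l))) μ from h0.const_smul (√(vol a) : ℝ)
  refine (torusBasis a).repr.symm.continuous.comp_aestronglyMeasurable ?_
  refine aestronglyMeasurable_of_tendsto_ae (u := atTop)
    (f := fun (K : Finset (Fin 3 → ℤ)) t => ∑ n ∈ K, lp.single 2 n (c t n l)) ?_ ?_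
  · intro K
    refine Finset.aestronglyMeasurable_fun_sum _ fun n _ => ?_
    have h1 : Continuous fun z : ℂ => (lp.single 2 n z : lp (fun _ : Fin 3 → ℤ => ℂ) 2) := by
      have : Isometry fun z : ℂ => (lp.single 2 n z : lp (fun _ : Fin 3 → ℤ => ℂ) 2) := by
        refine Isometry.of_dist_eq fun x y => ?_
        rw [dist_eq_norm, dist_eq_norm, ← lp.single_sub, lp.norm_single (by norm_num)]
      exact this.continuous
    exact h1.comp_aestronglyMeasurable
      ((EuclideanSpace.proj (𝕜 := ℂ) l).continuous.comp_aestronglyMeasurable (hc n))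
  · refine Eventually.of_forall fun t => ?_
    exact lp.hasSum_single (by norm_num) (toL2 (fun n => c t n l) (summable_comp (h t) l))

end Fields

/-! ### Fourier coefficients of smooth functions -/

section SmoothFunctions

variable (a : Fin 3 → ℝ)

lemma isOpenQuotientMap_proj : IsOpenQuotientMap (proj a) :=
  IsOpenQuotientMap.piMap fun _ => QuotientAddGroup.isOpenQuotientMap_mk

lemma proj_surjective : Function.Surjective (proj a) := (isOpenQuotientMap_proj a).surjective

lemma proj_add_single (y : Fin 3 → ℝ) (j : Fin 3) (s : ℝ) :
    proj a y + Pi.single j (s : AddCircle (2 * π * a j)) = proj a (y + s • Pi.single j 1) := by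
  funext i
  by_cases h : i = j
  · subst h
    simp [proj]
  · simp [proj, Pi.single_eq_of_ne h]

/-- Time-dependent functions on the torus that are smooth in both variables. -/
def IsSmoothST (f : ℝ → Torus a → ℝ) : Prop :=
  ContDiff ℝ ∞ fun p : ℝ × (Fin 3 → ℝ) => f p.1 (proj a p.2)

variable {a}

lemma IsSmooth.isSmoothST {φ : Torus a → ℝ} (h : IsSmooth a φ) : IsSmoothST a fun _ => φ :=
  ContDiff.comp (g := fun y : Fin 3 → ℝ => φ (proj a y)) h contDiff_snd

lemma IsSmoothST.isSmooth {f : ℝ → Torus a → ℝ} (h : IsSmoothST a f) (t : ℝ) : IsSmooth a (f t) :=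
  ContDiff.comp (g := fun p : ℝ × (Fin 3 → ℝ) => f p.1 (proj a p.2)) h (contDiff_prodMk_right t)

lemma IsSmoothST.continuous {f : ℝ → Torus a → ℝ} (h : IsSmoothST a f) :
    Continuous (Function.uncurry f) := by
  rw [← (IsOpenQuotientMap.id.prodMap (isOpenQuotientMap_proj a)).continuous_comp_iff]
  exact ContDiff.continuous h

lemma IsSmoothST.continuous_right {f : ℝ → Torus a → ℝ} (h : IsSmoothST a f) (t : ℝ) :
    Continuous (f t) :=
  h.continuous.comp (Continuous.prodMk_right t)

lemma IsSmooth.continuous {φ : Torus a → ℝ} (h : IsSmooth a φ) : Continuous φ :=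
  h.isSmoothST.continuous_right 0

lemma IsSmoothST.hasDerivAt_shift {f : ℝ → Torus a → ℝ} (h : IsSmoothST a f) (j : Fin 3) (t : ℝ)
    (y : Fin 3 → ℝ) (s : ℝ) :
    HasDerivAt (fun s : ℝ => f t (proj a y + Pi.single j (s : AddCircle (2 * π * a j))))
      (fderiv ℝ (fun p : ℝ × (Fin 3 → ℝ) => f p.1 (proj a p.2)) (t, y + s • Pi.single j 1)
        (0, Pi.single j 1)) s := by
  have hd := (h.differentiable (by simp)).differentiableAt
    (x := (t, y + s • Pi.single j (1 : ℝ))) |>.hasFDerivAt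
  have hc : HasDerivAt (fun s : ℝ => (t, y + s • Pi.single j (1 : ℝ)))
      ((0 : ℝ), (Pi.single j (1 : ℝ) : Fin 3 → ℝ)) s := by
    refine (hasDerivAt_const s t).prodMk ?_
    simpa using ((hasDerivAt_id s).smul_const (Pi.single j (1 : ℝ) : Fin 3 → ℝ)).const_add y
  have := hd.comp_hasDerivAt s hc
  simp only [proj_add_single]
  exact this

lemma IsSmoothST.pderiv_proj {f : ℝ → Torus a → ℝ} (h : IsSmoothST a f) (j : Fin 3) (t : ℝ)
    (y : Fin 3 → ℝ) :
    pderiv a j (f t) (proj a y) =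
      fderiv ℝ (fun p : ℝ × (Fin 3 → ℝ) => f p.1 (proj a p.2)) (t, y) (0, Pi.single j 1) := by
  have := (h.hasDerivAt_shift j t y 0).deriv
  rwa [zero_smul, add_zero] at this

lemma IsSmoothST.pderiv {f : ℝ → Torus a → ℝ} (h : IsSmoothST a f) (j : Fin 3) :
    IsSmoothST a fun t => pderiv a j (f t) := by
  unfold IsSmoothST
  simp only [h.pderiv_proj j]
  exact (ContDiff.fderiv_right h (by simp)).clm_apply contDiff_const

/-- The derivative along the `j`-th circle at any point of the orbit. -/
lemma IsSmoothST.hasDerivAt_add_single {f : ℝ → Torus a → ℝ} (h : IsSmoothST a f) (j : Fin 3)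
    (t : ℝ) (x : Torus a) (s : ℝ) :
    HasDerivAt (fun s : ℝ => f t (x + Pi.single j (s : AddCircle (2 * π * a j))))
      (LimitPE.pderiv a j (f t) (x + Pi.single j (s : AddCircle (2 * π * a j)))) s := by
  obtain ⟨y, rfl⟩ := proj_surjective a x
  rw [proj_add_single, h.pderiv_proj]
  exact h.hasDerivAt_shift j t y s

lemma IsSmoothST.hasDerivAt_time' {f : ℝ → Torus a → ℝ} (h : IsSmoothST a f) (y : Fin 3 → ℝ)
    (t : ℝ) :
    HasDerivAt (fun s : ℝ => f s (proj a y))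
      (fderiv ℝ (fun p : ℝ × (Fin 3 → ℝ) => f p.1 (proj a p.2)) (t, y) (1, 0)) t := by
  have hd := (h.differentiable (by simp)).differentiableAt (x := (t, y)) |>.hasFDerivAt
  have hc : HasDerivAt (fun s : ℝ => (s, y)) ((1 : ℝ), (0 : Fin 3 → ℝ)) t :=
    (hasDerivAt_id t).prodMk (hasDerivAt_const t y)
  exact hd.comp_hasDerivAt t hc

lemma IsSmoothST.hasDerivAt_time {f : ℝ → Torus a → ℝ} (h : IsSmoothST a f) (x : Torus a) (t : ℝ) :
    HasDerivAt (fun s : ℝ => f s x) (deriv (fun s : ℝ => f s x) t) t := by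
  obtain ⟨y, rfl⟩ := proj_surjective a x
  exact (h.hasDerivAt_time' y t).differentiableAt.hasDerivAt

lemma IsSmoothST.deriv_time {f : ℝ → Torus a → ℝ} (h : IsSmoothST a f) :
    IsSmoothST a fun t x => deriv (fun s : ℝ => f s x) t := by
  unfold IsSmoothST
  have e : ∀ p : ℝ × (Fin 3 → ℝ), deriv (fun s : ℝ => f s (proj a p.2)) p.1 =
      fderiv ℝ (fun p : ℝ × (Fin 3 → ℝ) => f p.1 (proj a p.2)) p (1, 0) :=
    fun p => (h.hasDerivAt_time' p.2 p.1).deriv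
  simp only [e]
  exact (ContDiff.fderiv_right h (by simp)).clm_apply contDiff_const

lemma IsSmoothST.sub {f g : ℝ → Torus a → ℝ} (hf : IsSmoothST a f) (hg : IsSmoothST a g) :
    IsSmoothST a fun t x => f t x - g t x :=
  ContDiff.sub hf hg

variable [ha : ∀ i, Fact (0 < a i)]

variable (a) in
/-- The Fourier coefficient of a real function. -/
noncomputable def rcoeff (f : Torus a → ℝ) (n : Fin 3 → ℤ) : ℂ := scoeff a (fun x => (f x : ℂ)) n

lemma rcoeff_eq (f : Torus a → ℝ) (n : Fin 3 → ℤ) :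
    rcoeff a f n = ((vol a)⁻¹ : ℝ) * ∫ x, monomial a (-n) x * f x := scoeff_eq a _ n

lemma integrable_monomial_mul {f : Torus a → ℝ} (hf : Continuous f) (n : Fin 3 → ℤ) :
    Integrable (fun x => monomial a n x * (f x : ℂ)) (volume : Measure (Torus a)) :=
  ((continuous_monomial a n).mul (Complex.continuous_ofReal.comp hf)).integrable_of_hasCompactSupport
    (HasCompactSupport.of_compactSpace _)

lemma rcoeff_sub {f g : Torus a → ℝ} (hf : Continuous f) (hg : Continuous g) (n : Fin 3 → ℤ) :
    rcoeff a (fun x => f x - g x) n = rcoeff a f n - rcoeff a g n := by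
  rw [rcoeff_eq, rcoeff_eq, rcoeff_eq, ← mul_sub,
    ← integral_sub (integrable_monomial_mul hf _) (integrable_monomial_mul hg _)]
  congr 2
  funext x
  push_cast
  ring

lemma norm_rcoeff_le {f : Torus a → ℝ} {M : ℝ} (hf : ∀ x, |f x| ≤ M) (n : Fin 3 → ℤ) :
    ‖rcoeff a f n‖ ≤ M := by
  have hv := vol_pos a
  rw [rcoeff_eq, norm_mul, Complex.norm_real, Real.norm_of_nonneg (inv_nonneg.2 hv.le)]
  have h : ‖∫ x, monomial a (-n) x * (f x : ℂ)‖ ≤ M * vol a := by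
    refine norm_integral_le_of_norm_le_const (Eventually.of_forall fun x => ?_)
    rw [norm_mul, norm_monomial, one_mul, Complex.norm_real]
    exact hf x
  calc (vol a)⁻¹ * ‖∫ x, monomial a (-n) x * (f x : ℂ)‖ ≤ (vol a)⁻¹ * (M * vol a) := by gcongr
    _ = M := by field_simp

/-- Differentiation of a Fourier coefficient with respect to a parameter. -/
lemma hasDerivAt_rcoeff {g g' : ℝ → Torus a → ℝ} (hg : ∀ s, Continuous (g s))
    (hg' : Continuous (Function.uncurry g'))
    (hd : ∀ x s, HasDerivAt (fun s => g s x) (g' s x) s) (n : Fin 3 → ℤ) (s₀ : ℝ) :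
    HasDerivAt (fun s => rcoeff a (g s) n) (rcoeff a (g' s₀) n) s₀ := by
  have hK : IsCompact (Metric.closedBall s₀ 1 ×ˢ (univ : Set (Torus a))) :=
    (isCompact_closedBall s₀ 1).prod isCompact_univ
  obtain ⟨B, hB⟩ := hK.exists_bound_of_continuousOn hg'.continuousOn
  simp only [rcoeff_eq]
  refine HasDerivAt.const_mul _ ?_
  have hg's : ∀ s, Continuous (g' s) := fun s => hg'.comp (Continuous.prodMk_right s)
  refine (hasDerivAt_integral_of_dominated_loc_of_deriv_le (bound := fun _ => B)
    (F' := fun s x => monomial a (-n) x * (g' s x : ℂ)) (Metric.closedBall_mem_nhds s₀ one_pos)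
    ?_ (integrable_monomial_mul (hg s₀) _)
    (integrable_monomial_mul (hg's s₀) _).aestronglyMeasurable ?_ (integrable_const B) ?_).2
  · exact Eventually.of_forall fun s => (integrable_monomial_mul (hg s) _).aestronglyMeasurable
  · refine Eventually.of_forall fun x s hs => ?_
    rw [norm_mul, norm_monomial, one_mul, Complex.norm_real]
    exact hB (s, x) ⟨hs, mem_univ x⟩
  · exact Eventually.of_forall fun x s _ => (hd x s).ofReal_comp.const_mul _

lemma monomial_add_single (n : Fin 3 → ℤ) (x : Torus a) (j : Fin 3) (s : ℝ) :
    monomial a n (x + Pi.single j (s : AddCircle (2 * π * a j))) =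
      Complex.exp (Complex.I * freq a n j * s) * monomial a n x := by
  have h : ∀ x y : Torus a, monomial a n (x + y) = monomial a n x * monomial a n y := by
    intro x y
    rw [monomial, monomial, monomial, ← Finset.prod_mul_distrib]
    refine Finset.prod_congr rfl fun i _ => ?_
    simp [fourier_apply, smul_add, AddCircle.toCircle_add]
  rw [h, mul_comm]
  congr 1
  rw [monomial, Finset.prod_eq_single j]
  · rw [Pi.single_eq_same, fourier_coe_apply]
    congr 1
    have h1 : (a j : ℂ) ≠ 0 := by exact_mod_cast (ha j).out.ne'
    have h2 : (π : ℂ) ≠ 0 := by exact_mod_cast Real.pi_ne_zero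
    rw [freq]
    push_cast
    field_simp
  · intro i _ hi
    simp [Pi.single_eq_of_ne hi]
  · simp

/-- Translation multiplies the coefficients by a phase; its derivative gives the symbol of `∂ⱼ`. -/
lemma rcoeff_shift (f : Torus a → ℝ) (n : Fin 3 → ℤ) (j : Fin 3) (s : ℝ) :
    rcoeff a (fun x => f (x + Pi.single j (s : AddCircle (2 * π * a j)))) n =
      Complex.exp (Complex.I * freq a n j * s) * rcoeff a f n := by
  rw [rcoeff_eq, rcoeff_eq, mul_left_comm, ← integral_const_mul (Complex.exp _)]
  congr 1
  rw [← integral_add_right_eq_self (μ := (volume : Measure (Torus a)))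
    (fun x => Complex.exp (Complex.I * freq a n j * s) * (monomial a (-n) x * (f x : ℂ)))
    (Pi.single j (s : AddCircle (2 * π * a j)))]
  refine integral_congr_ae (Eventually.of_forall fun x => ?_)
  dsimp only
  rw [monomial_add_single, freq_neg, ← mul_assoc, ← mul_assoc, ← Complex.exp_add]
  simp

/-- The symbol of `∂ⱼ` is `i ňⱼ`. -/
lemma IsSmoothST.rcoeff_pderiv {f : ℝ → Torus a → ℝ} (h : IsSmoothST a f) (j : Fin 3) (t : ℝ)
    (n : Fin 3 → ℤ) :
    rcoeff a (LimitPE.pderiv a j (f t)) n = Complex.I * freq a n j * rcoeff a (f t) n := by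
  have hc : Continuous fun s : ℝ => (Pi.single j (s : AddCircle (2 * π * a j)) : Torus a) :=
    (continuous_single j).comp (AddCircle.continuous_mk' _)
  have h1 := hasDerivAt_rcoeff
    (g := fun s x => f t (x + Pi.single j (s : AddCircle (2 * π * a j))))
    (g' := fun s x => LimitPE.pderiv a j (f t) (x + Pi.single j (s : AddCircle (2 * π * a j))))
    (fun s => (h.continuous_right t).comp (continuous_id.add continuous_const))
    (((h.pderiv j).continuous_right t).comp
      (continuous_snd.add (hc.comp continuous_fst)))
    (fun x s => h.hasDerivAt_add_single j t x s) n 0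
  simp only [rcoeff_shift] at h1
  have h2 : HasDerivAt (fun s : ℝ => Complex.exp (Complex.I * freq a n j * s) * rcoeff a (f t) n)
      (Complex.I * freq a n j * rcoeff a (f t) n) 0 := by
    have : HasDerivAt (fun s : ℝ => Complex.exp (Complex.I * freq a n j * s))
        (Complex.I * freq a n j) 0 := by
      have h3 := ((hasDerivAt_id (0 : ℂ)).const_mul (Complex.I * freq a n j)).cexp
      have h4 := h3.comp_ofReal (z := 0)
      simpa using h4
    exact this.mul_const _
  simpa using h1.unique h2

lemma IsSmooth.rcoeff_pderiv {φ : Torus a → ℝ} (h : IsSmooth a φ) (j : Fin 3) (n : Fin 3 → ℤ) :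
    rcoeff a (LimitPE.pderiv a j φ) n = Complex.I * freq a n j * rcoeff a φ n :=
  h.isSmoothST.rcoeff_pderiv j 0 n

omit ha in
lemma IsSmooth.pderiv {φ : Torus a → ℝ} (h : IsSmooth a φ) (j : Fin 3) :
    IsSmooth a (LimitPE.pderiv a j φ) :=
  (h.isSmoothST.pderiv j).isSmooth 0

lemma IsSmoothST.hasDerivAt_rcoeff {f : ℝ → Torus a → ℝ} (h : IsSmoothST a f) (n : Fin 3 → ℤ)
    (t : ℝ) :
    HasDerivAt (fun t => rcoeff a (f t) n) (rcoeff a (fun x => deriv (fun s => f s x) t) n) t :=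
  LimitPE.hasDerivAt_rcoeff (g' := fun t x => deriv (fun s => f s x) t) h.continuous_right
    h.deriv_time.continuous h.hasDerivAt_time n t

lemma IsSmoothST.continuous_rcoeff {f : ℝ → Torus a → ℝ} (h : IsSmoothST a f) (n : Fin 3 → ℤ) :
    Continuous fun t => rcoeff a (f t) n :=
  continuous_iff_continuousAt.2 fun t => (h.hasDerivAt_rcoeff n t).continuousAt

/-! ### Decay of the coefficients -/

variable (a) in
/-- The operator `1 - ∂ⱼ²`. -/
noncomputable def oneSubSq (j : Fin 3) (f : ℝ → Torus a → ℝ) (t : ℝ) (x : Torus a) : ℝ :=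
  f t x - LimitPE.pderiv a j (LimitPE.pderiv a j (f t)) x

omit ha in
lemma IsSmoothST.oneSubSq {f : ℝ → Torus a → ℝ} (h : IsSmoothST a f) (j : Fin 3) :
    IsSmoothST a (oneSubSq a j f) :=
  h.sub ((h.pderiv j).pderiv j)

lemma IsSmoothST.rcoeff_oneSubSq {f : ℝ → Torus a → ℝ} (h : IsSmoothST a f) (j : Fin 3) (t : ℝ)
    (n : Fin 3 → ℤ) :
    rcoeff a (LimitPE.oneSubSq a j f t) n = (1 + freq a n j ^ 2 : ℝ) * rcoeff a (f t) n := by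
  unfold LimitPE.oneSubSq
  rw [rcoeff_sub (h.continuous_right t) (((h.pderiv j).pderiv j).continuous_right t),
    (h.pderiv j).rcoeff_pderiv, h.rcoeff_pderiv]
  push_cast
  linear_combination (-(freq a n j : ℂ) ^ 2 * rcoeff a (f t) n) * Complex.I_sq

omit ha in
lemma oneSubSq_eq_zero {j : Fin 3} {f : ℝ → Torus a → ℝ} {t : ℝ} (h : ∀ x, f t x = 0)
    (x : Torus a) : oneSubSq a j f t x = 0 := by
  have h0 : f t = fun _ => 0 := funext h
  have h1 : LimitPE.pderiv a j (fun _ => 0) = fun _ => 0 := by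
    funext x; simp [LimitPE.pderiv]
  simp [oneSubSq, h0, h1]

variable (a) in
/-- The weight `∏ⱼ (1 + ňⱼ²)`. -/
noncomputable def weight (n : Fin 3 → ℤ) : ℝ := ∏ j, (1 + freq a n j ^ 2)

omit ha in
lemma one_add_normSq_le_weight (n : Fin 3 → ℤ) : 1 + normSq a n ≤ weight a n := by
  have h0 := sq_nonneg (freq a n 0)
  have h1 := sq_nonneg (freq a n 1)
  have h2 := sq_nonneg (freq a n 2)
  rw [weight, Fin.prod_univ_three, normSq, normHsq]
  nlinarith [mul_nonneg h0 h1, mul_nonneg h0 h2, mul_nonneg h1 h2, mul_nonneg (mul_nonneg h0 h1) h2]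

omit ha in
lemma weight_pos (n : Fin 3 → ℤ) : 0 < weight a n :=
  Finset.prod_pos fun j _ => by positivity

lemma summable_inv_weight : Summable fun n => (weight a n)⁻¹ := by
  have h1 : ∀ j, Summable fun m : ℤ => (1 + ((m : ℝ) / a j) ^ 2)⁻¹ := by
    intro j
    have hj := (ha j).out
    have h := (Real.summable_one_div_int_pow (p := 2)).2 one_lt_two |>.mul_left (a j ^ 2)
    refine Summable.of_norm_bounded_eventually h ?_
    rw [Filter.eventually_cofinite]
    refine (finite_singleton (0 : ℤ)).subset fun m hm => ?_
    by_contra hm0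
    refine hm ?_
    have : (0 : ℝ) < (m : ℝ) ^ 2 := by
      have : (m : ℝ) ≠ 0 := by exact_mod_cast hm0
      positivity
    rw [Real.norm_of_nonneg (by positivity), inv_le_comm₀ (by positivity) (by positivity)]
    rw [div_pow]
    have e : (a j ^ 2 * (1 / (m : ℝ) ^ 2))⁻¹ = (m : ℝ) ^ 2 / a j ^ 2 := by
      field_simp
    rw [e]
    linarith
  have hnn : ∀ j, (0 : ℤ → ℝ) ≤ fun m : ℤ => (1 + ((m : ℝ) / a j) ^ 2)⁻¹ := by
    intro j m
    simp only [Pi.zero_apply]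
    positivity
  have h2 := (h1 0).mul_of_nonneg ((h1 1).mul_of_nonneg (h1 2) (hnn 1) (hnn 2)) (hnn 0)
    (fun m => mul_nonneg (hnn 1 m.1) (hnn 2 m.2))
  let e : (Fin 3 → ℤ) → ℤ × ℤ × ℤ := fun n => (n 0, n 1, n 2)
  have he : Function.Injective e := by
    intro n m h
    simp only [e, Prod.mk.injEq] at h
    funext j
    fin_cases j
    · exact h.1
    · exact h.2.1
    · exact h.2.2
  refine (h2.comp_injective he).congr fun n => ?_
  simp only [weight, Fin.prod_univ_three, Function.comp, e, freq, mul_inv]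
  ring

/-- The coefficients of a smooth function with bounded support in time decay, uniformly in time. -/
lemma IsSmoothST.exists_norm_rcoeff_le {f : ℝ → Torus a → ℝ} (h : IsSmoothST a f) {R : ℝ}
    (hR : ∀ t, R ≤ |t| → ∀ x, f t x = 0) :
    ∃ B, 0 ≤ B ∧ ∀ t n, ‖rcoeff a (f t) n‖ ≤ B * ((weight a n)⁻¹) ^ 2 := by
  have key : ∀ {f : ℝ → Torus a → ℝ}, IsSmoothST a f → (∀ t, R ≤ |t| → ∀ x, f t x = 0) →
      ∃ B, 0 ≤ B ∧ ∀ t n, ‖rcoeff a (f t) n‖ ≤ B := by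
    intro f h hR
    have hK : IsCompact (Icc (-R) R ×ˢ (univ : Set (Torus a))) := isCompact_Icc.prod isCompact_univ
    obtain ⟨B, hB⟩ := hK.exists_bound_of_continuousOn h.continuous.continuousOn
    refine ⟨max B 0, le_max_right _ _, fun t n => norm_rcoeff_le (fun x => ?_) n⟩
    rcases le_total R |t| with ht | ht
    · rw [hR t ht, abs_zero]
      exact le_max_right _ _
    · exact (hB (t, x) ⟨abs_le.1 ht, mem_univ x⟩).trans (le_max_left _ _)
  have hs : ∀ (j : Fin 3) {f : ℝ → Torus a → ℝ}, (∀ t, R ≤ |t| → ∀ x, f t x = 0) →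
      ∀ t, R ≤ |t| → ∀ x, LimitPE.oneSubSq a j f t x = 0 :=
    fun j f hf t ht => oneSubSq_eq_zero (hf t ht)
  -- `(1 - ∂₁²)²(1 - ∂₂²)²(1 - ∂₃²)² f` is bounded, and its symbol is `weight ^ 2`
  obtain ⟨B, hB0, hB⟩ := key
    (((((h.oneSubSq 0).oneSubSq 1).oneSubSq 2).oneSubSq 0).oneSubSq 1 |>.oneSubSq 2)
    (hs 2 (hs 1 (hs 0 (hs 2 (hs 1 (hs 0 hR))))))
  refine ⟨B, hB0, fun t n => ?_⟩
  have := hB t n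
  rw [((((h.oneSubSq 0).oneSubSq 1).oneSubSq 2).oneSubSq 0).oneSubSq 1 |>.rcoeff_oneSubSq,
    ((((h.oneSubSq 0).oneSubSq 1).oneSubSq 2).oneSubSq 0).rcoeff_oneSubSq,
    (((h.oneSubSq 0).oneSubSq 1).oneSubSq 2).rcoeff_oneSubSq,
    ((h.oneSubSq 0).oneSubSq 1).rcoeff_oneSubSq, (h.oneSubSq 0).rcoeff_oneSubSq,
    h.rcoeff_oneSubSq] at this
  simp only [norm_mul, Complex.norm_real, Real.norm_eq_abs] at this
  have hp : ∀ j, 0 < 1 + freq a n j ^ 2 := fun j => by positivity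
  rw [abs_of_pos (hp 0), abs_of_pos (hp 1), abs_of_pos (hp 2)] at this
  have hw := weight_pos (a := a) n
  rw [inv_pow, ← div_eq_mul_inv, le_div_iff₀ (by positivity)]
  refine le_trans (le_of_eq ?_) this
  rw [weight, Fin.prod_univ_three]
  ring

end SmoothFunctions

/-! ### Distributional identities read on the coefficients -/

section Distributions

variable {a : Fin 3 → ℝ} [ha : ∀ i, Fact (0 < a i)]

lemma integrable_mul_continuous {f φ : Torus a → ℝ} (hf : Integrable f) (hφ : Continuous φ) :
    Integrable fun x => f x * φ x := by
  obtain ⟨B, hB⟩ := isCompact_univ.exists_bound_of_continuousOn hφ.continuousOn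
  exact hf.mul_bdd (c := B) hφ.aestronglyMeasurable
    (Eventually.of_forall fun x => hB x (mem_univ x))

omit ha in
lemma integral_add_add {X : Type*} [MeasurableSpace X] {μ : Measure X} {f g h : X → ℝ}
    (hf : Integrable f μ) (hg : Integrable g μ) (hh : Integrable h μ) :
    ∫ x, (f x + g x + h x) ∂μ = (∫ x, f x ∂μ) + (∫ x, g x ∂μ) + ∫ x, h x ∂μ := by
  rw [← integral_add hf hg]
  exact integral_add (hf.add hg) hh

omit ha in
lemma integral_sub_add {X : Type*} [MeasurableSpace X] {μ : Measure X} {f g h : X → ℝ}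
    (hf : Integrable f μ) (hg : Integrable g μ) (hh : Integrable h μ) :
    ∫ x, (f x - g x + h x) ∂μ = (∫ x, f x ∂μ) - (∫ x, g x ∂μ) + ∫ x, h x ∂μ := by
  rw [← integral_sub hf hg]
  exact integral_add (hf.sub hg) hh

lemma integrable_component (V : L2Field a) (l : Fin 4) : Integrable fun x => V x l :=
  MemLp.integrable (q := 2) (by norm_num)
    ((EuclideanSpace.proj l : E4 →L[ℝ] ℝ).comp_memLp' (Lp.memLp V))

lemma coeff_apply_rcoeff (f : Torus a → E4) (n : Fin 3 → ℤ) (l : Fin 4) :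
    coeff a f n l = rcoeff a (fun x => f x l) n := rfl

/-- The continuous complex function attached to a continuous real one, in `L²`. -/
lemma exists_toLp {φ : Torus a → ℝ} (hφ : Continuous φ) :
    ∃ f : Lp ℂ 2 (volume : Measure (Torus a)), f =ᵐ[volume] fun x => (φ x : ℂ) :=
  ⟨ContinuousMap.toLp 2 volume ℂ ⟨fun x => (φ x : ℂ), Complex.continuous_ofReal.comp hφ⟩,
    ContinuousMap.coeFn_toLp (p := 2) (𝕜 := ℂ) volume _⟩

/-- Parseval's identity between a component of a field and a continuous function. -/
lemma hasSum_conj_rcoeff_mul (V : L2Field a) (l : Fin 4) {φ : Torus a → ℝ} (hφ : Continuous φ) :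
    HasSum (fun n => conj (rcoeff a φ n) * coeff a V n l)
      (((vol a)⁻¹ * ∫ x, V x l * φ x : ℝ) : ℂ) := by
  obtain ⟨f, hf⟩ := exists_toLp hφ
  have h := hasSum_scoeff a f (compL a l V)
  have e : ∫ x, conj (f x) * compL a l V x = ((∫ x, V x l * φ x : ℝ) : ℂ) := by
    refine Eq.trans (integral_congr_ae ?_) (integral_ofReal (𝕜 := ℂ))
    filter_upwards [compL_coe a l V, hf] with x h1 h2
    rw [h1, h2]
    simp [mul_comm]
  rw [e] at h
  rw [Complex.ofReal_mul]
  refine h.congr_fun fun n => ?_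
  rw [scoeff_congr a hf, coeff_eq_scoeff]
  rfl

/-- The derivative in the sense of distributions, read on the coefficients. -/
lemma isWeakPartial_of_coeff {j : Fin 3} {V G : L2Field a}
    (h : ∀ n, coeff a G n = (Complex.I * freq a n j) • coeff a V n) : IsWeakPartial a j V G := by
  intro l φ hφ
  have h1 := hasSum_conj_rcoeff_mul V l (hφ.pderiv j).continuous
  have h2 := (hasSum_conj_rcoeff_mul G l hφ.continuous).neg
  have h3 := h1.unique (h2.congr_fun fun n => by
    rw [hφ.rcoeff_pderiv, h, PiLp.smul_apply, smul_eq_mul, map_mul, map_mul, Complex.conj_I,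
      Complex.conj_ofReal]
    ring)
  have h4 : (vol a)⁻¹ * ∫ x, V x l * pderiv a j φ x = -((vol a)⁻¹ * ∫ x, G x l * φ x) := by
    exact_mod_cast h3
  have h5 := inv_pos.2 (vol_pos a)
  rw [← mul_neg] at h4
  exact mul_left_cancel₀ h5.ne' h4

/-- Divergence-freeness, read on the coefficients. -/
lemma divFree_of_coeff {V : L2Field a} (h : ∀ n, fdot a n (coeff a V n) = 0) : DivFree a V := by
  intro φ hφ
  have hs := fun j : Fin 3 =>
    hasSum_conj_rcoeff_mul V (Fin.castSucc j) (hφ.pderiv j).continuous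
  have h2 := ((hs 0).add (hs 1)).add (hs 2)
  have h3 := h2.unique ((hasSum_zero (α := ℂ) (β := Fin 3 → ℤ)).congr_fun
    fun n => by
      have := h n
      rw [fdot_eq] at this
      simp only [hφ.rcoeff_pderiv, map_mul, Complex.conj_I, Complex.conj_ofReal]
      simp only [Fin.castSucc_zero, Fin.castSucc_one, show Fin.castSucc (2 : Fin 3) = 2 from rfl]
      linear_combination (-Complex.I * conj (rcoeff a φ n)) * this)
  have hi : ∀ j : Fin 3, Integrable fun x => V x (Fin.castSucc j) * pderiv a j φ x := fun j =>
    integrable_mul_continuous (integrable_component V _) (hφ.pderiv j).continuous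
  have h4 : (vol a)⁻¹ * ((∫ x, V x 0 * pderiv a 0 φ x) + (∫ x, V x 1 * pderiv a 1 φ x) +
      ∫ x, V x 2 * pderiv a 2 φ x) = 0 := by
    rw [mul_add, mul_add]
    exact_mod_cast h3
  have h5 := inv_pos.2 (vol_pos a)
  refine (integral_add_add (hi 0) (hi 1) (hi 2)).trans ?_
  exact (mul_eq_zero.1 h4).resolve_left h5.ne'

lemma coeff_zero_apply (V : L2Field a) (l : Fin 4) :
    coeff a V 0 l = ((vol a)⁻¹ * ∫ x, V x l : ℝ) := by
  rw [coeff_apply_rcoeff, rcoeff_eq, Complex.ofReal_mul]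
  congr 1
  simp only [neg_zero, monomial_zero, one_mul]
  exact integral_ofReal (𝕜 := ℂ)

lemma meanZero_iff (V : L2Field a) : MeanZero a V ↔ coeff a V 0 = 0 := by
  have h5 := (inv_pos.2 (vol_pos a)).ne'
  constructor
  · intro h
    ext l
    rw [coeff_zero_apply, h l]
    simp
  · intro h l
    have := congrArg (fun z : C4 => z l) h
    simp only [coeff_zero_apply, PiLp.zero_apply] at this
    have h6 : (vol a)⁻¹ * ∫ x, V x l = 0 := by exact_mod_cast this
    exact (mul_eq_zero.1 h6).resolve_left h5

variable (a) in
/-- The real exponentials: `Re (c e^{i ň·x})`. -/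
noncomputable def waveRe (c : ℂ) (n : Fin 3 → ℤ) (x : Torus a) : ℝ := (c * monomial a n x).re

lemma monomial_proj (n : Fin 3 → ℤ) (y : Fin 3 → ℝ) :
    monomial a n (proj a y) = Complex.exp (Complex.I * ((∑ j, freq a n j * y j : ℝ) : ℂ)) := by
  have e : ∀ i, fourier (n i) (proj a y i) = Complex.exp (Complex.I * ((freq a n i * y i : ℝ) : ℂ)) := by
    intro i
    rw [proj, fourier_coe_apply]
    congr 1
    have h1 : (a i : ℂ) ≠ 0 := by exact_mod_cast (ha i).out.ne'
    have h2 : (π : ℂ) ≠ 0 := by exact_mod_cast Real.pi_ne_zero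
    rw [freq]
    push_cast
    field_simp
  rw [monomial, Finset.prod_congr rfl fun i _ => e i, ← Complex.exp_sum]
  push_cast
  rw [Finset.mul_sum]

lemma isSmooth_waveRe (c : ℂ) (n : Fin 3 → ℤ) : IsSmooth a (waveRe a c n) := by
  unfold IsSmooth waveRe
  simp only [monomial_proj]
  have h1 : ContDiff ℝ ∞ fun y : Fin 3 → ℝ => ∑ j, freq a n j * y j :=
    ContDiff.sum fun j _ => contDiff_const.mul (contDiff_apply ℝ ℝ j)
  have h2 : ContDiff ℝ ∞ fun y : Fin 3 → ℝ => ((∑ j, freq a n j * y j : ℝ) : ℂ) :=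
    Complex.ofRealCLM.contDiff.comp h1
  exact Complex.reCLM.contDiff.comp (contDiff_const.mul (contDiff_const.mul h2).cexp)

lemma continuous_waveRe (c : ℂ) (n : Fin 3 → ℤ) : Continuous (waveRe a c n) :=
  (isSmooth_waveRe c n).continuous

lemma pderiv_waveRe (c : ℂ) (n : Fin 3 → ℤ) (j : Fin 3) :
    pderiv a j (waveRe a c n) = waveRe a (c * (Complex.I * freq a n j)) n := by
  funext x
  have h2 : HasDerivAt (fun s : ℝ => c * (Complex.exp (Complex.I * freq a n j * s) * monomial a n x))
      (c * (Complex.I * freq a n j * monomial a n x)) 0 := by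
    have h3 := ((hasDerivAt_id (0 : ℂ)).const_mul (Complex.I * freq a n j)).cexp
    have h4 := h3.comp_ofReal (z := 0)
    exact (HasDerivAt.mul_const (by simpa using h4) _).const_mul c
  have h3 := Complex.reCLM.hasFDerivAt.comp_hasDerivAt (0 : ℝ) h2
  rw [pderiv]
  simp only [waveRe, monomial_add_single]
  refine (HasDerivAt.deriv h3).trans ?_
  rw [Complex.reCLM_apply]
  congr 1
  ring

/-- Testing a real function against the exponentials gives its coefficients. -/
lemma integral_mul_waveRe {f : Torus a → ℝ} (hf : Integrable f) (c : ℂ) (n : Fin 3 → ℤ) :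
    ∫ x, f x * waveRe a c n x = (c * (vol a * rcoeff a f (-n))).re := by
  have hv := (vol_pos a).ne'
  have hi : Integrable fun x => c * (monomial a n x * (f x : ℂ)) := by
    refine Integrable.const_mul ?_ c
    refine Integrable.bdd_mul (c := 1) hf.ofReal (continuous_monomial a n).aestronglyMeasurable ?_
    exact Eventually.of_forall fun x => by rw [norm_monomial]
  have e : (c * (vol a * rcoeff a f (-n))) = ∫ x, c * (monomial a n x * (f x : ℂ)) := by
    rw [integral_const_mul, rcoeff_eq, neg_neg]
    push_cast
    have : (vol a : ℂ) ≠ 0 := by exact_mod_cast hv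
    field_simp
  rw [e]
  refine Eq.trans ?_ (Complex.reCLM.integral_comp_comm hi)
  refine integral_congr_ae (Eventually.of_forall fun x => ?_)
  simp only [waveRe, Complex.reCLM_apply, Complex.mul_re, Complex.ofReal_re, Complex.ofReal_im,
    Complex.mul_im]
  ring

lemma eq_zero_of_re_mul {z : ℂ} (h : ∀ c : ℂ, (c * z).re = 0) : z = 0 := by
  have h1 := h 1
  have h2 := h (-Complex.I)
  apply Complex.ext
  · simpa using h1
  · simpa using h2

/-- A divergence-free field has coefficients orthogonal to `ň`: test against the exponentials. -/
lemma fdot_coeff_of_divFree {V : L2Field a} (h : DivFree a V) (n : Fin 3 → ℤ) :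
    fdot a n (coeff a V n) = 0 := by
  have hv : (vol a : ℂ) ≠ 0 := by exact_mod_cast (vol_pos a).ne'
  have hi : ∀ (l : Fin 4) (c : ℂ), Integrable fun x => V x l * waveRe a c (-n) x := fun l c =>
    integrable_mul_continuous (integrable_component V _) (continuous_waveRe c (-n))
  have key : Complex.I * (vol a * fdot a n (coeff a V n)) = 0 := by
    refine eq_zero_of_re_mul fun c => ?_
    have h1 := h _ (isSmooth_waveRe (-c) (-n))
    simp only [pderiv_waveRe] at h1
    rw [integral_add_add (hi 0 _) (hi 1 _) (hi 2 _),
      integral_mul_waveRe (integrable_component V _), integral_mul_waveRe (integrable_component V _),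
      integral_mul_waveRe (integrable_component V _), ← Complex.add_re, ← Complex.add_re] at h1
    rw [← h1, fdot_eq, neg_neg]
    simp only [coeff_apply_rcoeff, freq_neg]
    congr 1
    push_cast
    ring
  have h2 := (mul_eq_zero.1 key).resolve_left Complex.I_ne_zero
  exact (mul_eq_zero.1 h2).resolve_left hv

/-- The potential vorticity in the sense of distributions has the coefficients `i pv`. -/
lemma pv_coeff_of_isPotentialVorticity {F : ℝ} {V : L2Field a}
    {Ω : Lp ℝ 2 (volume : Measure (Torus a))} (h : IsPotentialVorticity a F V Ω) (n : Fin 3 → ℤ) :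
    Complex.I * pv a F n (coeff a V n) = rcoeff a Ω n := by
  have hv : (vol a : ℂ) ≠ 0 := by exact_mod_cast (vol_pos a).ne'
  have hi : ∀ (l : Fin 4) (c : ℂ), Integrable fun x => V x l * waveRe a c (-n) x := fun l c =>
    integrable_mul_continuous (integrable_component V _) (continuous_waveRe c (-n))
  have hΩ : Integrable Ω := MemLp.integrable (q := 2) (by norm_num) (Lp.memLp Ω)
  have key : vol a * (Complex.I * pv a F n (coeff a V n) - rcoeff a Ω n) = 0 := by
    refine eq_zero_of_re_mul fun c => ?_
    have h1 := h _ (isSmooth_waveRe c (-n))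
    simp only [pderiv_waveRe] at h1
    rw [integral_sub_add (hi 0 _) (hi 1 _) ((hi 3 _).const_mul F), integral_const_mul, integral_mul_waveRe hΩ,
      integral_mul_waveRe (integrable_component V _), integral_mul_waveRe (integrable_component V _),
      integral_mul_waveRe (integrable_component V _), ← Complex.sub_re, ← Complex.re_ofReal_mul,
      ← Complex.add_re, ← sub_eq_zero, ← Complex.sub_re] at h1
    rw [← neg_eq_zero, ← Complex.neg_re, ← h1, pv_eq, neg_neg]
    simp only [coeff_apply_rcoeff, freq_neg]
    congr 1
    push_cast
    ring
  exact sub_eq_zero.1 ((mul_eq_zero.1 key).resolve_left hv)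

lemma summable_norm_sq_pv {F : ℝ} {V : L2Field a}
    {Ω : Lp ℝ 2 (volume : Measure (Torus a))} (h : IsPotentialVorticity a F V Ω) :
    Summable fun n => ‖pv a F n (coeff a V n)‖ ^ 2 := by
  set f : Lp ℂ 2 (volume : Measure (Torus a)) :=
    ContinuousLinearMap.compLpL 2 volume Complex.ofRealCLM Ω
  have hf : f =ᵐ[volume] fun x => (Ω x : ℂ) :=
    ContinuousLinearMap.coeFn_compLpL (p := 2) (μ := volume) Complex.ofRealCLM Ω
  refine (hasSum_scoeff a f f).summable.norm.congr fun n => ?_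
  rw [norm_mul, RCLike.norm_conj, ← sq, scoeff_congr a hf]
  change ‖rcoeff a Ω n‖ ^ 2 = _
  rw [← pv_coeff_of_isPotentialVorticity h n, norm_mul, Complex.norm_I, one_mul]

end Distributions

/-! ### Fourier coefficients of test fields -/

section TestFields

variable {a : Fin 3 → ℝ}

lemma IsTest.isSmoothST {φ : ℝ → Torus a → E4} (h : IsTest a φ) (l : Fin 4) :
    IsSmoothST a fun t x => φ t x l :=
  (EuclideanSpace.proj l : E4 →L[ℝ] ℝ).contDiff.comp h.1

lemma IsTest.hasDerivAt {φ : ℝ → Torus a → E4} (h : IsTest a φ) (x : Torus a) (t : ℝ) :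
    HasDerivAt (fun s => φ s x) (deriv (fun s => φ s x) t) t := by
  obtain ⟨y, rfl⟩ := proj_surjective a x
  have h1 := ContDiff.comp (g := fun p : ℝ × (Fin 3 → ℝ) => φ p.1 (proj a p.2)) h.1
    (contDiff_prodMk_left (𝕜 := ℝ) y)
  exact (h1.differentiable (by simp)).differentiableAt.hasDerivAt

lemma IsTest.deriv_apply {φ : ℝ → Torus a → E4} (h : IsTest a φ) (x : Torus a) (t : ℝ) (l : Fin 4) :
    deriv (fun s => φ s x) t l = deriv (fun s => φ s x l) t :=
  ((EuclideanSpace.proj l : E4 →L[ℝ] ℝ).hasFDerivAt.comp_hasDerivAt t (h.hasDerivAt x t)).deriv.symm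

lemma IsTest.exists_pos {φ : ℝ → Torus a → E4} (h : IsTest a φ) :
    ∃ R, 0 < R ∧ ∀ t, R ≤ |t| → ∀ x, φ t x = 0 := by
  obtain ⟨R, hR⟩ := h.2
  exact ⟨max R 1, lt_max_of_lt_right one_pos, fun t ht => hR t ((le_max_left _ _).trans ht)⟩

variable [ha : ∀ i, Fact (0 < a i)]

omit ha in
lemma continuous_field {φ : Torus a → E4} (h : ∀ l, Continuous fun x => φ x l) : Continuous φ := by
  have : Continuous fun x => (WithLp.toLp 2 (fun l => φ x l) : E4) :=
    (PiLp.continuous_toLp 2 _).comp (continuous_pi h)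
  exact this

/-- Parseval's identity between a field and a continuous field. -/
lemma hasSum_inner_coeff_continuous (V : L2Field a) {φ : Torus a → E4} (h : Continuous φ) :
    HasSum (fun n => inner ℂ (coeff a φ n) (coeff a V n))
      (((vol a)⁻¹ * ∫ x, inner ℝ (V x) (φ x) : ℝ) : ℂ) := by
  have hm : MemLp φ 2 (volume : Measure (Torus a)) :=
    h.memLp_of_hasCompactSupport (HasCompactSupport.of_compactSpace _)
  have h1 := hasSum_inner_coeff a V hm.toLp
  have e : ∫ x, inner ℝ (V x) (hm.toLp φ x) = ∫ x, inner ℝ (V x) (φ x) := by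
    refine integral_congr_ae ?_
    filter_upwards [hm.coeFn_toLp] with x hx
    rw [hx]
  rw [e] at h1
  exact h1.congr_fun fun n => by rw [coeff_congr a hm.coeFn_toLp]

variable {φ : ℝ → Torus a → E4}

omit ha in
lemma IsTest.continuous_apply (h : IsTest a φ) (t : ℝ) : Continuous (φ t) :=
  continuous_field fun l => (h.isSmoothST l).continuous_right t

omit ha in
lemma IsTest.continuous_deriv (h : IsTest a φ) (t : ℝ) :
    Continuous fun x => deriv (fun s => φ s x) t := by
  refine continuous_field fun l => ?_
  simp only [h.deriv_apply]
  exact (h.isSmoothST l).deriv_time.continuous_right t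

lemma IsTest.hasDerivAt_coeff (h : IsTest a φ) (n : Fin 3 → ℤ) (t : ℝ) :
    HasDerivAt (fun t => coeff a (φ t) n) (coeff a (fun x => deriv (fun s => φ s x) t) n) t := by
  have h1 : HasDerivAt (fun t => fun l => coeff a (φ t) n l)
      (fun l => coeff a (fun x => deriv (fun s => φ s x) t) n l) t := by
    refine hasDerivAt_pi.2 fun l => ?_
    simp only [coeff_apply_rcoeff, h.deriv_apply]
    exact (h.isSmoothST l).hasDerivAt_rcoeff n t
  exact (PiLp.continuousLinearEquiv 2 ℝ (fun _ : Fin 4 => ℂ)).symm.toContinuousLinearMap.hasFDerivAt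
    |>.comp_hasDerivAt t h1

lemma IsTest.continuous_coeff (h : IsTest a φ) (n : Fin 3 → ℤ) :
    Continuous fun t => coeff a (φ t) n :=
  continuous_iff_continuousAt.2 fun t => (h.hasDerivAt_coeff n t).continuousAt

lemma IsTest.continuous_coeff_deriv (h : IsTest a φ) (n : Fin 3 → ℤ) :
    Continuous fun t => coeff a (fun x => deriv (fun s => φ s x) t) n := by
  refine (PiLp.continuous_toLp 2 _).comp (continuous_pi fun l => ?_)
  change Continuous fun t => rcoeff a (fun x => deriv (fun s => φ s x) t l) n
  simp only [h.deriv_apply]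
  exact (h.isSmoothST l).deriv_time.continuous_rcoeff n

lemma norm_coeff_le_sum (f : Torus a → E4) (n : Fin 3 → ℤ) :
    ‖coeff a f n‖ ≤ ∑ l, ‖rcoeff a (fun x => f x l) n‖ := by
  have h : coeff a f n = ∑ l, EuclideanSpace.single l (coeff a f n l) := by
    ext l
    fin_cases l <;> simp [Fin.sum_univ_four]
  rw [h]
  refine (norm_sum_le _ _).trans (le_of_eq (Finset.sum_congr rfl fun l _ => ?_))
  rw [PiLp.norm_single, coeff_apply_rcoeff]

lemma exists_norm_coeff_le {φ : ℝ → Torus a → E4} {R : ℝ}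
    (hs : ∀ l, IsSmoothST a fun t x => φ t x l) (hR : ∀ t, R ≤ |t| → ∀ x, φ t x = 0) :
    ∃ B, 0 ≤ B ∧ ∀ t n, ‖coeff a (φ t) n‖ ≤ B * ((weight a n)⁻¹) ^ 2 := by
  choose B hB0 hB using fun l => (hs l).exists_norm_rcoeff_le (R := R)
    (fun t ht x => by simp [hR t ht x])
  refine ⟨∑ l, B l, Finset.sum_nonneg fun l _ => hB0 l, fun t n => ?_⟩
  refine (norm_coeff_le_sum _ _).trans ?_
  rw [Finset.sum_mul]
  exact Finset.sum_le_sum fun l _ => hB l t n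

omit ha in
lemma deriv_eq_zero_of_support {R : ℝ} (hR : ∀ t, R ≤ |t| → ∀ x, φ t x = 0) {t : ℝ}
    (ht : R < |t|) (x : Torus a) : deriv (fun s => φ s x) t = 0 := by
  have : (fun s => φ s x) =ᶠ[𝓝 t] fun _ => 0 := by
    filter_upwards [(isOpen_lt continuous_const continuous_abs).mem_nhds ht] with s hs
    exact hR s (le_of_lt hs) x
  rw [this.deriv_eq, deriv_const]

end TestFields

/-! ### Termwise integration -/

section Series

/-- A series of nonnegative continuous functions whose finite sums have bounded integrals. -/
lemma integrableOn_tsum_of_bound {ι : Type*} [Countable ι] {f : ι → ℝ → ℝ}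
    (hf : ∀ i, Continuous (f i)) (hf0 : ∀ i t, 0 ≤ f i t) {B : ℝ}
    (hB : ∀ T, 0 ≤ T → ∀ K : Finset ι, ∫ t in (0 : ℝ)..T, ∑ i ∈ K, f i t ≤ B) :
    (∀ᵐ t ∂(volume.restrict (Ioi (0 : ℝ))), Summable fun i => f i t) ∧
      IntegrableOn (fun t => ∑' i, f i t) (Ioi 0) := by
  have hK : ∀ K : Finset ι, Continuous fun t => ∑ i ∈ K, f i t := fun K =>
    continuous_finsetSum _ fun i _ => hf i
  have hK0 : ∀ (K : Finset ι) t, 0 ≤ ∑ i ∈ K, f i t := fun K t =>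
    Finset.sum_nonneg fun i _ => hf0 i t
  have hint : ∀ K : Finset ι, IntegrableOn (fun t => ∑ i ∈ K, f i t) (Ioi 0) := by
    intro K
    refine integrableOn_Ioi_of_intervalIntegral_norm_bounded (b := fun N : ℕ => (N : ℝ)) (l := atTop)
      B 0 (fun N => (hK K).integrableOn_Ioc) tendsto_natCast_atTop_atTop
      (Eventually.of_forall fun N => ?_)
    simpa only [Real.norm_of_nonneg (hK0 K _)] using hB N N.cast_nonneg K
  have hint2 : ∀ K : Finset ι, ∫ t in Ioi (0 : ℝ), ∑ i ∈ K, f i t ≤ B := fun K =>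
    le_of_tendsto (intervalIntegral_tendsto_integral_Ioi (b := fun N : ℕ => (N : ℝ)) (l := atTop)
      0 (hint K) tendsto_natCast_atTop_atTop)
      (Eventually.of_forall fun N => hB N N.cast_nonneg K)
  have hm : Measurable fun t => ∑' i, ENNReal.ofReal (f i t) :=
    Measurable.tsum fun i => (hf i).measurable.ennreal_ofReal
  have hl : ∫⁻ t in Ioi (0 : ℝ), ∑' i, ENNReal.ofReal (f i t) ≠ ⊤ := by
    refine ne_top_of_le_ne_top (ENNReal.ofReal_ne_top (r := B)) ?_
    rw [lintegral_tsum fun i => (hf i).measurable.ennreal_ofReal.aemeasurable,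
      ENNReal.tsum_eq_iSup_sum]
    refine iSup_le fun K => ?_
    rw [← lintegral_finsetSum _ fun i _ => (hf i).measurable.ennreal_ofReal]
    simp only [← ENNReal.ofReal_sum_of_nonneg fun i _ => hf0 i _]
    rw [← ofReal_integral_eq_lintegral_ofReal (hint K) (Eventually.of_forall (hK0 K))]
    exact ENNReal.ofReal_le_ofReal (hint2 K)
  have e : ∀ t, (∑' i, ENNReal.ofReal (f i t)).toReal = ∑' i, f i t := by
    intro t
    rw [ENNReal.tsum_toReal_eq fun _ => ENNReal.ofReal_ne_top]
    exact tsum_congr fun i => ENNReal.toReal_ofReal (hf0 i t)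
  refine ⟨?_, ?_⟩
  · filter_upwards [ae_lt_top hm hl] with t ht
    refine (ENNReal.summable_toReal ht.ne).congr fun i => ?_
    exact ENNReal.toReal_ofReal (hf0 i t)
  · have := integrable_toReal_of_lintegral_ne_top hm.aemeasurable hl
    simp only [e] at this
    exact this

/-- Termwise integration of such a series over a bounded interval. -/
lemma hasSum_integral_of_bound {ι : Type*} [Countable ι] {f : ι → ℝ → ℝ}
    (hf : ∀ i, Continuous (f i)) (hf0 : ∀ i t, 0 ≤ f i t) {B T : ℝ} (hT : 0 ≤ T)
    (hB : ∀ K : Finset ι, ∫ t in (0 : ℝ)..T, ∑ i ∈ K, f i t ≤ B) :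
    HasSum (fun i => ∫ t in (0 : ℝ)..T, f i t) (∫ t in (0 : ℝ)..T, ∑' i, f i t) := by
  simp only [intervalIntegral.integral_of_le hT] at hB ⊢
  refine hasSum_integral_of_summable_integral_norm (fun i => (hf i).integrableOn_Ioc) ?_
  simp only [Real.norm_of_nonneg (hf0 _ _)]
  refine summable_of_sum_le (c := B) (fun i => integral_nonneg (hf0 i)) fun K => ?_
  rw [← integral_finsetSum _ fun i _ => (hf i).integrableOn_Ioc]
  exact hB K

/-- A uniformly dominated series may be integrated termwise over a bounded interval. -/
lemma hasSum_intervalIntegral_of_dominated {ι : Type*} [Countable ι] {q : ι → ℝ → ℂ} {b : ι → ℝ}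
    (hb : Summable b) (hq : ∀ i, AEStronglyMeasurable (q i) volume) (hle : ∀ i t, ‖q i t‖ ≤ b i)
    (T : ℝ) : HasSum (fun i => ∫ t in (0 : ℝ)..T, q i t) (∫ t in (0 : ℝ)..T, ∑' i, q i t) :=
  intervalIntegral.hasSum_integral_of_dominated_convergence (fun i _ => b i)
    (fun i => (hq i).restrict) (fun i => Eventually.of_forall fun t _ => hle i t)
    (Eventually.of_forall fun _ _ => hb) intervalIntegrable_const
    (Eventually.of_forall fun t _ => (hb.of_norm_bounded fun i => hle i t).hasSum)

lemma aestronglyMeasurable_tsum {ι : Type*} [Countable ι] {q : ι → ℝ → ℂ} {b : ι → ℝ}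
    (hb : Summable b) (hq : ∀ i, AEStronglyMeasurable (q i) volume) (hle : ∀ i t, ‖q i t‖ ≤ b i) :
    AEStronglyMeasurable (fun t => ∑' i, q i t) volume := by
  classical
  refine aestronglyMeasurable_of_tendsto_ae (u := (atTop : Filter (Finset ι)))
    (f := fun K t => ∑ i ∈ K, q i t) (fun K => Finset.aestronglyMeasurable_fun_sum _ fun i _ => hq i)
    (Eventually.of_forall fun t => ?_)
  exact (hb.of_norm_bounded fun i => hle i t).hasSum

lemma setIntegral_Ioi_eq_intervalIntegral {E : Type*} [NormedAddCommGroup E] [NormedSpace ℝ E]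
    {f : ℝ → E} {R : ℝ} (hR : 0 ≤ R) (hf : ∀ t, R < t → f t = 0) :
    ∫ t in Ioi (0 : ℝ), f t = ∫ t in (0 : ℝ)..R, f t := by
  rw [intervalIntegral.integral_of_le hR]
  refine setIntegral_eq_of_subset_of_forall_sdiff_eq_zero measurableSet_Ioi Ioc_subset_Ioi_self ?_
  intro t ht
  refine hf t ?_
  by_contra h
  exact ht.2 ⟨ht.1, not_lt.1 h⟩

end Series

/-! ### Horizontal derivatives -/

section Gradient

variable (a : Fin 3 → ℝ)

/-- The coefficients `i ňⱼ w(n)` of the derivative `∂ⱼ` of a field with coefficients `w`, replaced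
by `0` when they are not square summable. -/
noncomputable def gradCoeff (j : Fin 3) (w : (Fin 3 → ℤ) → C4) (n : Fin 3 → ℤ) : C4 :=
  open Classical in
  if Summable fun m => freq a m j ^ 2 * ‖w m‖ ^ 2 then (Complex.I * freq a n j) • w n else 0

variable {a}

lemma norm_sq_gradCoeff {j : Fin 3} {w : (Fin 3 → ℤ) → C4}
    (h : Summable fun m => freq a m j ^ 2 * ‖w m‖ ^ 2) (n : Fin 3 → ℤ) :
    ‖gradCoeff a j w n‖ ^ 2 = freq a n j ^ 2 * ‖w n‖ ^ 2 := by
  rw [gradCoeff, if_pos h, norm_smul, norm_mul, Complex.norm_I, one_mul, Complex.norm_real, mul_pow,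
    Real.norm_eq_abs, sq_abs]

variable (a) in
lemma summable_gradCoeff (j : Fin 3) (w : (Fin 3 → ℤ) → C4) :
    Summable fun n => ‖gradCoeff a j w n‖ ^ 2 := by
  by_cases h : Summable fun m => freq a m j ^ 2 * ‖w m‖ ^ 2
  · simpa only [norm_sq_gradCoeff h] using h
  · simp [gradCoeff, h]

lemma gradCoeff_neg {j : Fin 3} {w : (Fin 3 → ℤ) → C4} (hw : ∀ n, w (-n) = conjV (w n))
    (n : Fin 3 → ℤ) : gradCoeff a j w (-n) = conjV (gradCoeff a j w n) := by
  unfold gradCoeff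
  split_ifs
  · rw [hw, conjV_smul, freq_neg]
    simp
  · rw [conjV_zero]

variable [ha : ∀ i, Fact (0 < a i)]

variable (a) in
/-- The derivative `∂ⱼ` of the field with coefficients `w`, if it belongs to `L²`. -/
noncomputable def gradField (j : Fin 3) (w : (Fin 3 → ℤ) → C4) : L2Field a :=
  synth a (gradCoeff a j w) (summable_gradCoeff a j w)

lemma norm_sq_eq_tsum (V : L2Field a) : ‖V‖ ^ 2 = vol a * ∑' n, ‖coeff a V n‖ ^ 2 := by
  have := (vol_pos a).ne'
  rw [(hasSum_norm_sq_coeff a V).tsum_eq]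
  field_simp

lemma norm_sq_synth {w : (Fin 3 → ℤ) → C4} (h : Summable fun n => ‖w n‖ ^ 2)
    (hw : ∀ n, w (-n) = conjV (w n)) : ‖synth a w h‖ ^ 2 = vol a * ∑' n, ‖w n‖ ^ 2 := by
  rw [norm_sq_eq_tsum]
  simp only [coeff_synth a h hw]

lemma norm_sq_gradField {j : Fin 3} {w : (Fin 3 → ℤ) → C4} (hw : ∀ n, w (-n) = conjV (w n))
    (h : Summable fun m => freq a m j ^ 2 * ‖w m‖ ^ 2) :
    ‖gradField a j w‖ ^ 2 = vol a * ∑' n, freq a n j ^ 2 * ‖w n‖ ^ 2 := by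
  rw [gradField, norm_sq_synth _ (gradCoeff_neg hw)]
  simp only [norm_sq_gradCoeff h]

lemma isWeakPartial_gradField {j : Fin 3} {w : (Fin 3 → ℤ) → C4} (hs : Summable fun n => ‖w n‖ ^ 2)
    (hw : ∀ n, w (-n) = conjV (w n)) (h : Summable fun m => freq a m j ^ 2 * ‖w m‖ ^ 2) :
    IsWeakPartial a j (synth a w hs) (gradField a j w) := by
  refine isWeakPartial_of_coeff fun n => ?_
  rw [gradField, coeff_synth a _ (gradCoeff_neg hw), coeff_synth a hs hw, gradCoeff, if_pos h]

end Gradient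

/-! ### From modes to distributions -/

section Assembly

variable {a : Fin 3 → ℝ} [ha : ∀ i, Fact (0 < a i)] {F ν ν' : ℝ}

/-- The weak formulation mode by mode, for a path of bounded energy, gives the distributional
formulation. -/
lemma isDistribSolution_synth (hF : 0 < F) (hF1 : F ≠ 1) (hν : 0 < ν) (hν' : 0 < ν')
    {V₀ : L2Field a} {u : ℝ → (Fin 3 → ℤ) → C4} {E₀ : ℝ} (hcont : ∀ n, Continuous fun t => u t n)
    (hreal : ∀ t n, u t (-n) = conjV (u t n)) (hdiv : ∀ t n, fdot a n (u t n) = 0)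
    (hzero : ∀ t, u t 0 = 0) (hE : ∀ t, ∀ K : Finset (Fin 3 → ℤ), ∑ n ∈ K, ‖u t n‖ ^ 2 ≤ E₀)
    (heq : ∀ (n : Fin 3 → ℤ) (χ χ' : ℝ → C4) (T : ℝ), 0 ≤ T → (∀ t, HasDerivAt χ (χ' t) t) →
        Continuous χ' → χ T = 0 →
        (∫ t in (0 : ℝ)..T, inner ℂ (χ' t) (u t n)) + inner ℂ (χ 0) (coeff a V₀ n) =
          ∫ t in (0 : ℝ)..T, inner ℂ (χ t) (limOp a F ν ν' (u t) n)) :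
    IsDistribSolution a F ν ν' V₀ fun t => synth a (u t) (summable_of_energy (hE t)) := by
  have hv := (vol_pos a).ne'
  have hs : ∀ t, Summable fun n => ‖u t n‖ ^ 2 := fun t => summable_of_energy (hE t)
  have hE0 : 0 ≤ E₀ := by simpa using hE 0 ∅
  have hcoef : ∀ t, coeff a (synth a (u t) (hs t)) = u t := fun t =>
    funext fun n => coeff_synth a (hs t) (hreal t) n
  have hlim : ∀ t n, limitOp a F ν ν' (synth a (u t) (hs t)) n = limOp a F ν ν' (u t) n := by
    intro t n
    rw [limitOp, hcoef]
    rfl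
  set A : ℝ := 27 * E₀ + 3 * (ν + ν') * √E₀ with hA
  have hA0 : 0 ≤ A := by positivity
  have hrate : ∀ t n, ‖limOp a F ν ν' (u t) n‖ ≤ A * weight a n := by
    intro t n
    refine (norm_limOp_le a F ν ν' hF hν.le hν'.le (hE t) n).trans ?_
    have h1 := one_add_normSq_le_weight (a := a) n
    have h2 := normSq_nonneg a n
    have h3 : √(normSq a n) ≤ weight a n := by
      have := Real.sq_sqrt h2
      nlinarith [sq_nonneg (√(normSq a n) - 1)]
    have h4 : normHsq a n ≤ weight a n := by
      have : normHsq a n ≤ normSq a n := by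
        rw [normSq]; nlinarith [sq_nonneg (freq a n 2)]
      linarith
    rw [rateBound, hA, add_mul]
    refine add_le_add ?_ ?_
    · calc 27 * √(normSq a n) * E₀ ≤ 27 * weight a n * E₀ := by gcongr
        _ = 27 * E₀ * weight a n := by ring
    · calc 3 * (ν + ν') * normHsq a n * √E₀ ≤ 3 * (ν + ν') * weight a n * √E₀ := by gcongr
        _ = 3 * (ν + ν') * √E₀ * weight a n := by ring
  have hmeas : ∀ n, AEStronglyMeasurable (fun t => limOp a F ν ν' (u t) n) volume := by
    intro n
    refine aestronglyMeasurable_of_tendsto_ae (u := (atTop : Filter (Finset (Fin 3 → ℤ))))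
      (f := fun K t => truncOp a F ν ν' K (u t) n)
      (fun K => (continuous_truncOp a F ν ν' hF K hcont n).aestronglyMeasurable)
      (Eventually.of_forall fun t => tendsto_truncOp a F ν ν' hF hF1 (hs t) n)
  -- the series pairing `limOp` with a test field is dominated by `B A / weight`
  have hdom : ∀ φ : ℝ → Torus a → E4, IsTest a φ → ∃ b : (Fin 3 → ℤ) → ℝ, Summable b ∧
      ∀ n t, ‖inner ℂ (coeff a (φ t) n) (limOp a F ν ν' (u t) n)‖ ≤ b n := by
    intro φ hφ
    obtain ⟨R, hR0, hR⟩ := hφ.exists_pos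
    obtain ⟨B, hB0, hB⟩ := exists_norm_coeff_le hφ.isSmoothST hR
    refine ⟨fun n => B * A * (weight a n)⁻¹, summable_inv_weight.mul_left _, fun n t => ?_⟩
    have hw := weight_pos (a := a) n
    refine (norm_inner_le_norm _ _).trans ?_
    calc _ ≤ (B * ((weight a n)⁻¹) ^ 2) * (A * weight a n) :=
          mul_le_mul (hB t n) (hrate t n) (norm_nonneg _) (by positivity)
      _ = B * A * (weight a n)⁻¹ := by field_simp
  have hmeas2 : ∀ φ : ℝ → Torus a → E4, IsTest a φ → ∀ n,
      AEStronglyMeasurable (fun t => inner ℂ (coeff a (φ t) n) (limOp a F ν ν' (u t) n)) volume :=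
    fun φ hφ n => (hφ.continuous_coeff n).aestronglyMeasurable.inner (hmeas n)
  have hcoef0 : ∀ {φ : ℝ → Torus a → E4} {t : ℝ}, (∀ x, φ t x = 0) → ∀ n, coeff a (φ t) n = 0 := by
    intro φ t ht n
    ext l
    rw [coeff_apply_rcoeff, rcoeff_eq]
    simp [ht]
  refine ⟨?_, ?_, ?_, ?_, ?_, ?_⟩
  · exact Eventually.of_forall fun t => (meanZero_iff _).2 (by rw [hcoef, hzero])
  · exact Eventually.of_forall fun t => divFree_of_coeff fun n => by rw [hcoef, hdiv]
  · refine Eventually.of_forall fun t n => ?_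
    rw [hcoef]
    exact (summable_norm_bilinTerm a F hF (hs t) n).of_norm
  · intro φ hφ
    obtain ⟨b, hb, hle⟩ := hdom φ hφ
    refine Eventually.of_forall fun t => ?_
    simp only [hlim]
    exact hb.of_norm_bounded fun n => hle n t
  · intro φ hφ
    obtain ⟨b, hb, hle⟩ := hdom φ hφ
    obtain ⟨R, hR0, hR⟩ := hφ.exists_pos
    simp only [pairing, hlim]
    refine Integrable.const_mul ?_ _
    refine IntegrableOn.of_forall_sdiff_eq_zero (s := Ioc 0 R) ?_ measurableSet_Ioi ?_
    · refine Measure.integrableOn_of_bounded (M := ∑' n, b n) measure_Ioc_lt_top.ne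
        (aestronglyMeasurable_tsum hb (hmeas2 φ hφ) hle) (Eventually.of_forall fun t => ?_)
      exact tsum_of_norm_bounded hb.hasSum fun n => hle n t
    · intro t ht
      have : R ≤ |t| := by
        rw [abs_of_pos ht.1]
        by_contra h
        exact ht.2 ⟨ht.1, (not_le.1 h).le⟩
      simp [hcoef0 (hR t this)]
  · intro φ hφ
    obtain ⟨b, hb, hle⟩ := hdom φ hφ
    obtain ⟨R, hR0, hR⟩ := hφ.exists_pos
    set ψ : ℝ → Torus a → E4 := fun t x => deriv (fun s => φ s x) t with hψ
    have hψs : ∀ l, IsSmoothST a fun t x => ψ t x l := by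
      intro l
      simp only [hψ, hφ.deriv_apply]
      exact (hφ.isSmoothST l).deriv_time
    have hψ0 : ∀ t, R + 1 ≤ |t| → ∀ x, ψ t x = 0 := fun t ht x =>
      deriv_eq_zero_of_support hR (by linarith) x
    obtain ⟨B, hB0, hB⟩ := exists_norm_coeff_le hψs hψ0
    have hR' : ∀ t, R < t → ∀ x, φ t x = 0 := fun t ht =>
      hR t (ht.le.trans (le_abs_self t))
    -- the three series
    have h1 : HasSum (fun n => ∫ t in (0 : ℝ)..R, inner ℂ (coeff a (ψ t) n) (u t n))
        ((((vol a)⁻¹ * ∫ t in Ioi (0 : ℝ), ∫ x, inner ℝ (synth a (u t) (hs t) x) (ψ t x) : ℝ)) : ℂ) := by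
      have hd : Summable fun n => B * √E₀ * (weight a n)⁻¹ := summable_inv_weight.mul_left _
      have hle2 : ∀ n t, ‖inner ℂ (coeff a (ψ t) n) (u t n)‖ ≤ B * √E₀ * (weight a n)⁻¹ := by
        intro n t
        have hw : 1 ≤ weight a n := by
          linarith [one_add_normSq_le_weight (a := a) n, normSq_nonneg a n]
        refine (norm_inner_le_norm _ _).trans ?_
        calc _ ≤ (B * ((weight a n)⁻¹) ^ 2) * √E₀ :=
              mul_le_mul (hB t n) (norm_le_of_energy (hE t) n) (norm_nonneg _) (by positivity)
          _ = B * √E₀ * ((weight a n)⁻¹ * (weight a n)⁻¹) := by ring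
          _ ≤ B * √E₀ * (weight a n)⁻¹ := by
              refine mul_le_mul_of_nonneg_left ?_ (by positivity)
              exact mul_le_of_le_one_left (by positivity) (inv_le_one_of_one_le₀ hw)
      have h := hasSum_intervalIntegral_of_dominated hd (q := fun n t =>
        inner ℂ (coeff a (ψ t) n) (u t n))
        (fun n => ((hφ.continuous_coeff_deriv n).inner (hcont n)).aestronglyMeasurable) hle2 R
      have e : ∀ t, ∑' n, inner ℂ (coeff a (ψ t) n) (u t n) =
          (((vol a)⁻¹ * ∫ x, inner ℝ (synth a (u t) (hs t) x) (ψ t x) : ℝ) : ℂ) := by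
        intro t
        have := (hasSum_inner_coeff_continuous (synth a (u t) (hs t)) (hφ.continuous_deriv t)).tsum_eq
        rwa [hcoef] at this
      simp only [e] at h
      rw [intervalIntegral.integral_ofReal, intervalIntegral.integral_const_mul] at h
      rwa [setIntegral_Ioi_eq_intervalIntegral hR0.le]
      intro t ht
      have : ∀ x, ψ t x = 0 := deriv_eq_zero_of_support hR (ht.trans_le (le_abs_self t))
      simp [this]
    have h2 := hasSum_inner_coeff_continuous V₀ (hφ.continuous_apply 0)
    have h3 : HasSum (fun n => ∫ t in (0 : ℝ)..R, inner ℂ (coeff a (φ t) n) (limOp a F ν ν' (u t) n))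
        (((vol a)⁻¹ : ℝ) * ∫ t in Ioi (0 : ℝ),
          pairing a (limitOp a F ν ν' (synth a (u t) (hs t))) (φ t)) := by
      have h := hasSum_intervalIntegral_of_dominated hb (hmeas2 φ hφ) hle R
      have e : ∫ t in Ioi (0 : ℝ), pairing a (limitOp a F ν ν' (synth a (u t) (hs t))) (φ t) =
          vol a * ∫ t in (0 : ℝ)..R, ∑' n, inner ℂ (coeff a (φ t) n) (limOp a F ν ν' (u t) n) := by
        rw [setIntegral_Ioi_eq_intervalIntegral hR0.le,
          ← intervalIntegral.integral_const_mul]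
        · simp only [pairing, hlim]
          rfl
        · intro t ht
          simp [pairing, hcoef0 (hR' t ht)]
      rw [e, ← mul_assoc]
      have : ((((vol a)⁻¹ : ℝ) : ℂ) * vol a) = 1 := by
        exact_mod_cast inv_mul_cancel₀ hv
      rwa [this, one_mul]
    have h4 := (h1.add h2).unique (h3.congr_fun fun n =>
      (heq n _ _ R hR0.le (hφ.hasDerivAt_coeff n) (hφ.continuous_coeff_deriv n)
        (hcoef0 (hR R (le_abs_self R)) n)))
    have h5 : (((vol a)⁻¹ : ℝ) : ℂ) ≠ 0 := by exact_mod_cast inv_ne_zero hv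
    push_cast at h4
    push_cast at h5
    rw [← mul_add] at h4
    have h6 := mul_left_cancel₀ h5 h4
    rw [← h6]
    ring

end Assembly

/-! ### Existence -/

section Existence

variable {a : Fin 3 → ℝ} [ha : ∀ i, Fact (0 < a i)] {F ν ν' : ℝ}

lemma aestronglyMeasurable_gradField {u : ℝ → (Fin 3 → ℤ) → C4} {μ : Measure ℝ}
    (hcont : ∀ n, Continuous fun t => u t n) {j : Fin 3}
    (h : ∀ᵐ t ∂μ, Summable fun m => freq a m j ^ 2 * ‖u t m‖ ^ 2) :
    AEStronglyMeasurable (fun t => gradField a j (u t)) μ := by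
  refine aestronglyMeasurable_synth a (fun n => ?_) _
  have h1 : Continuous fun t => (Complex.I * freq a n j) • u t n := by
    have := hcont n
    fun_prop
  refine h1.aestronglyMeasurable.congr ?_
  filter_upwards [h] with t ht
  rw [gradCoeff, if_pos ht]

/-- Existence of a solution, with the constant `1` in the energy inequality. -/
theorem exists_isDistribSolution (hF : 0 < F) (hF1 : F ≠ 1) (hν : 0 < ν) (hν' : 0 < ν')
    {V₀ : L2Field a} (hmean : MeanZero a V₀) (hdiv₀ : DivFree a V₀)
    {Ω₀ : Lp ℝ 2 (volume : Measure (Torus a))} (hΩ : IsPotentialVorticity a F V₀ Ω₀) :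
    ∃ U G₁ G₂ : ℝ → L2Field a,
      MemLp U ⊤ (volume.restrict (Ioi (0 : ℝ))) ∧
      MemLp G₁ 2 (volume.restrict (Ioi (0 : ℝ))) ∧
      MemLp G₂ 2 (volume.restrict (Ioi (0 : ℝ))) ∧
      (∀ᵐ t ∂(volume.restrict (Ioi (0 : ℝ))),
        IsWeakPartial a 0 (U t) (G₁ t) ∧ IsWeakPartial a 1 (U t) (G₂ t)) ∧
      IsDistribSolution a F ν ν' V₀ U ∧
      ∀ t : ℝ, 0 ≤ t →
        ‖U t‖ ^ 2 + min ν ν' * ∫ s in (0 : ℝ)..t, (‖G₁ s‖ ^ 2 + ‖G₂ s‖ ^ 2) ≤ ‖V₀‖ ^ 2 := by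
  classical
  have hvol := vol_pos a
  have hc : 0 < min ν ν' := lt_min hν hν'
  obtain ⟨u, hcont, hreal, hdiv, hzero, hE, hdiss, heq⟩ := exists_fourier_solution a F ν ν'
    hF hF1 hν hν' (coeff_neg a V₀) (fdot_coeff_of_divFree hdiv₀) ((meanZero_iff V₀).1 hmean)
    (hasSum_norm_sq_coeff a V₀).summable (summable_norm_sq_pv hΩ)
  set E₀ := ∑' n, ‖coeff a V₀ n‖ ^ 2 with hE₀
  have hV₀ : ‖V₀‖ ^ 2 = vol a * E₀ := norm_sq_eq_tsum V₀
  have hs : ∀ t, Summable fun n => ‖u t n‖ ^ 2 := fun t => summable_of_energy (hE t)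
  have hU2 : ∀ t, ‖synth a (u t) (hs t)‖ ^ 2 = vol a * ∑' n, ‖u t n‖ ^ 2 := fun t =>
    norm_sq_synth (hs t) (hreal t)
  set d : (Fin 3 → ℤ) → ℝ → ℝ := fun n t => normHsq a n * ‖u t n‖ ^ 2 with hd
  have hdc : ∀ n, Continuous (d n) := fun n => ((hcont n).norm.pow 2).const_mul _
  have hd0 : ∀ n t, 0 ≤ d n t := fun n t => mul_nonneg (normHsq_nonneg a n) (sq_nonneg _)
  have hdB : ∀ T, 0 ≤ T → ∀ K : Finset (Fin 3 → ℤ),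
      ∫ t in (0 : ℝ)..T, ∑ n ∈ K, d n t ≤ E₀ / (2 * min ν ν') := by
    intro T hT K
    have h1 := hdiss T hT K
    have h2 : 0 ≤ ∑ n ∈ K, ‖u T n‖ ^ 2 := Finset.sum_nonneg fun n _ => sq_nonneg _
    rw [le_div_iff₀ (by positivity)]
    linarith
  obtain ⟨hsum, hint⟩ := integrableOn_tsum_of_bound hdc hd0 hdB
  have hsplit : ∀ n t, freq a n 0 ^ 2 * ‖u t n‖ ^ 2 + freq a n 1 ^ 2 * ‖u t n‖ ^ 2 = d n t := by
    intro n t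
    simp only [hd, normHsq]
    ring
  have hs0 : ∀ t, (Summable fun n => d n t) → Summable fun n => freq a n 0 ^ 2 * ‖u t n‖ ^ 2 :=
    fun t ht => ht.of_nonneg_of_le (fun n => by positivity) fun n => by
      rw [← hsplit]; exact le_add_of_nonneg_right (by positivity)
  have hs1 : ∀ t, (Summable fun n => d n t) → Summable fun n => freq a n 1 ^ 2 * ‖u t n‖ ^ 2 :=
    fun t ht => ht.of_nonneg_of_le (fun n => by positivity) fun n => by
      rw [← hsplit]; exact le_add_of_nonneg_left (by positivity)
  have hG : ∀ t, (Summable fun n => d n t) →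
      ‖gradField a 0 (u t)‖ ^ 2 + ‖gradField a 1 (u t)‖ ^ 2 = vol a * ∑' n, d n t := by
    intro t ht
    rw [norm_sq_gradField (hreal t) (hs0 t ht), norm_sq_gradField (hreal t) (hs1 t ht), ← mul_add,
      ← (hs0 t ht).tsum_add (hs1 t ht)]
    simp only [hsplit]
  have hm0 : AEStronglyMeasurable (fun t => gradField a 0 (u t)) (volume.restrict (Ioi (0 : ℝ))) :=
    aestronglyMeasurable_gradField hcont (hsum.mono hs0)
  have hm1 : AEStronglyMeasurable (fun t => gradField a 1 (u t)) (volume.restrict (Ioi (0 : ℝ))) :=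
    aestronglyMeasurable_gradField hcont (hsum.mono hs1)
  have hint' : Integrable (fun t => vol a * ∑' n, d n t) (volume.restrict (Ioi (0 : ℝ))) :=
    hint.const_mul _
  refine ⟨fun t => synth a (u t) (hs t), fun t => gradField a 0 (u t), fun t => gradField a 1 (u t),
    ?_, ?_, ?_, ?_, isDistribSolution_synth hF hF1 hν hν' hcont hreal hdiv hzero hE heq, ?_⟩
  · refine memLp_top_of_bound (aestronglyMeasurable_synth a
      (fun n => (hcont n).aestronglyMeasurable) hs) ‖V₀‖ (Eventually.of_forall fun t => ?_)
    refine abs_le_of_sq_le_sq' ?_ (norm_nonneg _) |>.2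
    rw [hU2, hV₀]
    exact mul_le_mul_of_nonneg_left ((hs t).tsum_le_of_sum_le (hE t)) hvol.le
  · refine (memLp_two_iff_integrable_sq_norm hm0).2 (hint'.mono' (hm0.norm.pow 2) ?_)
    filter_upwards [hsum] with t ht
    rw [Real.norm_of_nonneg (sq_nonneg _), ← hG t ht]
    exact le_add_of_nonneg_right (sq_nonneg _)
  · refine (memLp_two_iff_integrable_sq_norm hm1).2 (hint'.mono' (hm1.norm.pow 2) ?_)
    filter_upwards [hsum] with t ht
    rw [Real.norm_of_nonneg (sq_nonneg _), ← hG t ht]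
    exact le_add_of_nonneg_left (sq_nonneg _)
  · filter_upwards [hsum] with t ht
    exact ⟨isWeakPartial_gradField (hs t) (hreal t) (hs0 t ht),
      isWeakPartial_gradField (hs t) (hreal t) (hs1 t ht)⟩
  · intro t ht
    have h1 := hasSum_integral_of_bound hdc hd0 ht (hdB t ht)
    have h2 : ∫ s in (0 : ℝ)..t, (‖gradField a 0 (u s)‖ ^ 2 + ‖gradField a 1 (u s)‖ ^ 2) =
        vol a * ∫ s in (0 : ℝ)..t, ∑' n, d n s := by
      rw [← intervalIntegral.integral_const_mul, intervalIntegral.integral_of_le ht,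
        intervalIntegral.integral_of_le ht]
      refine integral_congr_ae ?_
      filter_upwards [ae_restrict_of_ae_restrict_of_subset Ioc_subset_Ioi_self hsum] with s hsm
      exact hG s hsm
    have h3 : ∑' n, ‖u t n‖ ^ 2 + 2 * min ν ν' * ∫ s in (0 : ℝ)..t, ∑' n, d n s ≤ E₀ := by
      refine le_of_tendsto ((hs t).hasSum.add (h1.mul_left (2 * min ν ν'))) ?_
      refine Eventually.of_forall fun K => ?_
      have h4 := hdiss t ht K
      rw [intervalIntegral.integral_finsetSum fun n _ => (hdc n).intervalIntegrable _ _] at h4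
      rw [Finset.sum_add_distrib, ← Finset.mul_sum]
      exact h4
    have h5 : 0 ≤ ∫ s in (0 : ℝ)..t, ∑' n, d n s :=
      intervalIntegral.integral_nonneg ht fun s _ => tsum_nonneg fun n => hd0 n s
    rw [hU2, h2, hV₀]
    -- the factor `2` in front of the dissipation is given up
    have h6 : ∑' n, ‖u t n‖ ^ 2 + min ν ν' * ∫ s in (0 : ℝ)..t, ∑' n, d n s ≤ E₀ := by
      nlinarith [mul_nonneg hc.le h5]
    calc _ = vol a * (∑' n, ‖u t n‖ ^ 2 + min ν ν' * ∫ s in (0 : ℝ)..t, ∑' n, d n s) := by ring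
      _ ≤ vol a * E₀ := mul_le_mul_of_nonneg_left h6 hvol.le

end Existence
end LimitPE

open LimitPE
theorem theorem1 :
    ∃ C : ℝ, 0 < C ∧
      ∀ (a : Fin 3 → ℝ) [∀ i, Fact (0 < a i)] (F ν ν' : ℝ),
        0 < F → F ≠ 1 → 0 < ν → 0 < ν' →
        ∀ V₀ : L2Field a, MeanZero a V₀ → DivFree a V₀ →
          (∃ Ω₀ : Lp ℝ 2 (volume : Measure (Torus a)), IsPotentialVorticity a F V₀ Ω₀) →
          ∃ U G₁ G₂ : ℝ → L2Field a,
            MemLp U ⊤ (volume.restrict (Ioi (0 : ℝ))) ∧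
            MemLp G₁ 2 (volume.restrict (Ioi (0 : ℝ))) ∧
            MemLp G₂ 2 (volume.restrict (Ioi (0 : ℝ))) ∧
            (∀ᵐ t ∂(volume.restrict (Ioi (0 : ℝ))),
              IsWeakPartial a 0 (U t) (G₁ t) ∧ IsWeakPartial a 1 (U t) (G₂ t)) ∧
            IsDistribSolution a F ν ν' V₀ U ∧
            ∀ t : ℝ, 0 ≤ t →
              ‖U t‖ ^ 2 + min ν ν' * ∫ s in (0 : ℝ)..t, (‖G₁ s‖ ^ 2 + ‖G₂ s‖ ^ 2)
                ≤ C * ‖V₀‖ ^ 2 := by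
  refine ⟨1, one_pos, ?_⟩
  rintro a _ F ν ν' hF hF1 hν hν' V₀ hmean hdiv ⟨Ω₀, hΩ⟩
  simp only [one_mul]
  exact exists_isDistribSolution hF hF1 hν hν' hmean hdiv hΩ
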